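/- **Setting.** All manifolds are smooth, finite dimensional, Hausdorff and second countable. A *Courant algebroid* (CA) is a smooth real vector bundle $E\to M$ of finite rank with a fibrewise non-degenerate symmetric pairing $\langle,\rangle$, an anchor $\rho:E\to TM$ and an $\mathbb R$-bilinear bracket on $\Gamma(E)$ such that, with $u\cdot f:=\rho(u)f$, $$[u,[v,w]]=[[u,v],w]+[v,[u,w]],\quad [u,fv]=f[u,v]+(u\cdot f)v,$$ $$u\cdot\langle v,w\rangle=\langle[u,v],w\rangle+\langle v,[u,w]\rangle,\quad \langle w,[u,v]+[v,u]\rangle=w\cdot\langle u,v\rangle .$$ A *divergence* is an $\mathbb R$-linear map $\operatorname{div}:\Gamma(E)\to C^\infty(M)$ with $\operatorname{div}(fu)=f\operatorname{div}u+u\cdot f$. A *generalized pseudometric* is a smooth subbundle $V_+\subset E$ on which $\langle,\rangle$ is non-degenerate; put $V_-=V_+^\perp$, and let $u_\pm$ be the orthogonal projections of $u$ to $V_\pm$. Let $\mathcal M_E$ be the set of all generalized pseudometrics on $E$. A tangent vector to $\mathcal M_E$ at $V_+$ is a section $A$ of $V_+^*\otimes V_-^*$: a curve $V_+(t)$ in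 $\mathcal M_E$ has velocity $A$ at $t_0$ if $\frac{d}{dt}\big|_{t=t_0}\langle P_t a,b\rangle=A(a,b)$ (pointwise on $M$) for all $a\in\Gamma(V_+(t_0))$, $b\in\Gamma(V_-(t_0))$, where $P_t$ is the orthogonal projection to $V_+(t)$. A curve is smooth if $V_+(t)$ has local frames which are jointly smooth in $t$ and in the point of $M$. A divergence defines the vector field $\mathrm{GRic}^E_{\operatorname{div}}$ on $\mathcal M_E$ whose value at $V_+$ is the generalized Ricci tensor $$\mathrm{GRic}^E_{V_+,\operatorname{div}}(a_+,b_-)=\operatorname{div}[b_-,a_+]_+-b_-\cdot\operatorname{div}a_+-\operatorname{Tr}_{V_+}[[\,\cdot\,,b_-]_-,a_+]_+ .$$ **Equivariance.** Let $\mathsf S$ be a connected Lie group with Lie algebra $\mathfrak s$. An *$\mathfrak s$-equivariant* CA (for the zero pairing on $\mathfrak s$) is a CA $E\to M$ with a linear map $\chi:\mathfrak s\to\Gamma(E)$ such that $[\chi(s),\chi(t)]=\chi([s,t])$, $\langle\chi(s),\chi(t)\rangle=0$, and $\chi$ is injective at every point of $M$. Let $\mathfrak s_E\subset E$ be the subbundle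 with fibres $\chi_x(\mathfrak s)$. A section $u$ is *invariant* if $[\chi(s),u]=0$ for all $s\in\mathfrak s$. A divergence is *equivariant* if $\chi(s)\cdot\operatorname{div}u=\operatorname{div}[\chi(s),u]$ and $\operatorname{div}\chi(s)=-\operatorname{Tr}_{\mathfrak s}\mathrm{ad}_s$. A generalized pseudometric $V_+$ is *admissible* if $V_+\subset\mathfrak s_E^\perp$ and $[\chi(s),\Gamma(V_+)]\subset\Gamma(V_+)$ for all $s\in\mathfrak s$. Let $\mathcal N_E\subset\mathcal M_E$ be the set of admissible ones. **Pullback and reduction.** Let $E\to M$ be an $\mathfrak s$-equivariant CA with an equivariant divergence $\operatorname{div}$. Let $\tau:M'\to M$ be smooth and let $E'=\tau^*E\to M'$ carry a *CA-pullback* structure, i.e. a CA structure with $\langle\tau^*u,\tau^*v\rangle'=\tau^*\langle u,v\rangle$, $[\tau^*u,\tau^*v]'=\tau^*[u,v]$ and $\tau_*\circ\rho'=\rho$; then $E'$ is $\mathfrak s$-equivariant via $\chi'(s)=\tau^*\chi(s)$. Suppose that the action of $\mathfrak s$ on $E'\to M'$ given by $[\chi'(s),\cdot\,]'$ and $\rho'(\chi'(s))$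 integrates to an action of $\mathsf S$ on $E'\to M'$ by vector bundle automorphisms, and that the action of $\mathsf S$ on $M'$ is free and proper. Let $\pi:M'\to M'/\mathsf S$ be the projection, and let $E'_{\mathrm{red}}=(\mathfrak s_{E'}^\perp/\mathfrak s_{E'})/\mathsf S\to M'/\mathsf S$ be the reduced CA: its pairing, anchor and bracket are induced from those of $E'$, where a section of $E'_{\mathrm{red}}$ is represented by an invariant section of $\mathfrak s_{E'}^\perp$. **Theorem.** 1. There are a unique divergence $\tau^*\operatorname{div}$ on $E'$ with $(\tau^*\operatorname{div})(\tau^*u)=\tau^*(\operatorname{div}u)$ for all $u\in\Gamma(E)$, and a unique divergence $\operatorname{div}'_{\mathrm{red}}$ on $E'_{\mathrm{red}}$ such that $\pi^*(\operatorname{div}'_{\mathrm{red}}\tilde u)=(\tau^*\operatorname{div})u$ whenever the invariant section $u$ of $\mathfrak s_{E'}^\perp$ represents $\tilde u$. For every $V_+\in\mathcal N_E$, the image of $\tau^*V_+\subset\mathfrak s_{E'}^\perp$ in $E'_{\mathrm{red}}$ is a well-defined generalized pseudometric $\varphi(V_+)$. This defines a map $\varphi:\mathcal N_E\to\mathcal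 M_{E'_{\mathrm{red}}}$. 2. $\mathrm{GRic}^E_{\operatorname{div}}$ is tangent to $\mathcal N_E$: for every $V_+\in\mathcal N_E$ there is a smooth curve in $\mathcal N_E$ through $V_+$ whose velocity at $V_+$ is $\mathrm{GRic}^E_{V_+,\operatorname{div}}$. 3. The vector field $\mathrm{GRic}^E_{\operatorname{div}}$ on $\mathcal N_E$ pushes forward, via $\varphi$, to the vector field $\mathrm{GRic}^{E'_{\mathrm{red}}}_{\operatorname{div}'_{\mathrm{red}}}$ on $\mathcal M_{E'_{\mathrm{red}}}$: if $V_+(t)$ is a smooth curve in $\mathcal N_E$, then $\varphi(V_+(t))$ is a smooth curve in $\mathcal M_{E'_{\mathrm{red}}}$, and whenever $V_+(t)$ has velocity $\mathrm{GRic}^E_{V_+(t_0),\operatorname{div}}$ at $t_0$, the curve $\varphi(V_+(t))$ has velocity $\mathrm{GRic}^{E'_{\mathrm{red}}}_{\varphi(V_+(t_0)),\operatorname{div}'_{\mathrm{red}}}$ at $t_0$. In particular $\varphi$ maps smooth solutions of the generalized Ricci flow to solutions. -/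

import Mathlib

open Bundle Set Filter
open scoped Manifold ContDiff Topology Bundle

noncomputable section

set_option linter.unusedSectionVars false

namespace Courant

/-! ## Sections of vector bundles -/

/-- The fibres of a pullback bundle are abelian groups. -/
instance pullbackFiberAddCommGroup {B B' : Type*} (E : B → Type*) [∀ x, AddCommGroup (E x)]
    (f : B' → B) (x : B') : AddCommGroup ((f *ᵖ E) x) :=
  inferInstanceAs (AddCommGroup (E (f x)))

section Bundles

variable {EM : Type*} [NormedAddCommGroup EM] [NormedSpace ℝ EM]
  {M : Type*} [TopologicalSpace M] [ChartedSpace EM M]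
  {F : Type*} [NormedAddCommGroup F] [NormedSpace ℝ F]
  {E : M → Type*} [∀ x, AddCommGroup (E x)] [∀ x, Module ℝ (E x)]
  [∀ x, TopologicalSpace (E x)] [TopologicalSpace (TotalSpace F E)]
  [FiberBundle F E] [VectorBundle ℝ F E]

/-- The section `f u`, for a smooth function `f` and a smooth section `u`. -/
def fsmul (f : C^∞⟮𝓘(ℝ, EM), M; ℝ⟯) (u : Cₛ^∞⟮𝓘(ℝ, EM); F, E⟯) : Cₛ^∞⟮𝓘(ℝ, EM); F, E⟯ :=
  ⟨fun x => f x • u x, f.contMDiff.smul_section u.contMDiff⟩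

@[simp] lemma fsmul_apply (f : C^∞⟮𝓘(ℝ, EM), M; ℝ⟯) (u : Cₛ^∞⟮𝓘(ℝ, EM); F, E⟯) (x : M) :
    fsmul f u x = f x • u x := rfl

lemma sum_apply {ι : Type*} (s : Finset ι) (S : ι → Cₛ^∞⟮𝓘(ℝ, EM); F, E⟯) (x : M) :
    (∑ i ∈ s, S i) x = ∑ i ∈ s, S i x := by
  classical
  induction s using Finset.induction_on with
  | empty => simp
  | insert a s ha ih => simp [Finset.sum_insert ha, ih]

variable [FiniteDimensional ℝ EM] [T2Space M] [FiniteDimensional ℝ F]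
  [ContMDiffVectorBundle ∞ F E 𝓘(ℝ, EM)] [IsManifold 𝓘(ℝ, EM) ∞ M]

/-- Every vector is the value of a smooth section. -/
lemma exists_section (x : M) (v : E x) : ∃ u : Cₛ^∞⟮𝓘(ℝ, EM); F, E⟯, u x = v := by
  let t := trivializationAt F E x
  have hx : x ∈ t.baseSet := FiberBundle.mem_baseSet_trivializationAt F E x
  let b := Module.finBasis ℝ F
  obtain ⟨ψ, -, hψ⟩ := (SmoothBumpFunction.nhds_basis_tsupport (I := 𝓘(ℝ, EM)) x).mem_iff.1
    (t.open_baseSet.mem_nhds hx)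
  have hS : ∀ i, CMDiff ∞ (T% ((ψ : M → ℝ) • t.localFrame b i)) := fun i =>
    ContMDiffOn.smul_section_of_tsupport (u := t.baseSet) ψ.contMDiff.contMDiffOn t.open_baseSet hψ
      (t.contMDiffOn_localFrame_baseSet ∞ b i)
  let S : _ → Cₛ^∞⟮𝓘(ℝ, EM); F, E⟯ := fun i => ⟨_, hS i⟩
  refine ⟨∑ i, (t.basisAt b hx).repr v i • S i, ?_⟩
  have h1 : ∀ i, S i x = t.basisAt b hx i := by
    intro i
    change (ψ x) • t.localFrame b i x = _
    rw [ψ.eq_one, one_smul, t.localFrame_apply_of_mem_baseSet b hx]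
  rw [sum_apply]
  simp only [ContMDiffSection.coe_smul, Pi.smul_apply, h1]
  exact (t.basisAt b hx).sum_repr v

/-- A `C^∞(M)`-linear map of sections acts pointwise. -/
lemma tensorial {E' : M → Type*} [∀ x, AddCommGroup (E' x)] [∀ x, Module ℝ (E' x)]
    {F' : Type*} [NormedAddCommGroup F'] [NormedSpace ℝ F']
    [∀ x, TopologicalSpace (E' x)] [TopologicalSpace (TotalSpace F' E')]
    [FiberBundle F' E'] [VectorBundle ℝ F' E']
    (Φ : Cₛ^∞⟮𝓘(ℝ, EM); F, E⟯ →ₗ[ℝ] Cₛ^∞⟮𝓘(ℝ, EM); F', E'⟯)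
    (hΦ : ∀ (f : C^∞⟮𝓘(ℝ, EM), M; ℝ⟯) (u : Cₛ^∞⟮𝓘(ℝ, EM); F, E⟯), Φ (fsmul f u) = fsmul f (Φ u))
    (u : Cₛ^∞⟮𝓘(ℝ, EM); F, E⟯) (x : M) (hu : u x = 0) : Φ u x = 0 := by
  let t := trivializationAt F E x
  have hx : x ∈ t.baseSet := FiberBundle.mem_baseSet_trivializationAt F E x
  let b := Module.finBasis ℝ F
  have : ContMDiffVectorBundle 1 F E 𝓘(ℝ, EM) :=
    ContMDiffVectorBundle.of_le (n := ∞) (by exact_mod_cast le_top)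
  obtain ⟨ψ, -, hψ⟩ := (SmoothBumpFunction.nhds_basis_tsupport (I := 𝓘(ℝ, EM)) x).mem_iff.1
    (t.open_baseSet.mem_nhds hx)
  have hS : ∀ i, CMDiff ∞ (T% ((ψ : M → ℝ) • t.localFrame b i)) := fun i =>
    ContMDiffOn.smul_section_of_tsupport (u := t.baseSet) ψ.contMDiff.contMDiffOn t.open_baseSet hψ
      (t.contMDiffOn_localFrame_baseSet ∞ b i)
  let S : _ → Cₛ^∞⟮𝓘(ℝ, EM); F, E⟯ := fun i => ⟨_, hS i⟩
  let c : _ → M → ℝ := fun i => LinearMap.piApply (t.localFrameCoeff 𝓘(ℝ, EM) b i) u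
  have hc : ∀ i, CMDiff[t.baseSet] ∞ (c i) := fun i =>
    contMDiffOn_baseSet_localFrameCoeff b u.contMDiff.contMDiffOn i
  have hf : ∀ i, CMDiff ∞ (fun y => ψ y • c i y) := by
    intro i
    refine contMDiff_of_tsupport fun y hy => ?_
    have hy' : y ∈ t.baseSet := hψ (closure_mono (Function.support_smul_subset_left _ _) hy)
    exact (ψ.contMDiff y).smul ((hc i).contMDiffAt (t.open_baseSet.mem_nhds hy'))
  let f : _ → C^∞⟮𝓘(ℝ, EM), M; ℝ⟯ := fun i => ⟨_, hf i⟩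
  let p : C^∞⟮𝓘(ℝ, EM), M; ℝ⟯ := ⟨fun y => ψ y, ψ.contMDiff⟩
  have key : fsmul p (fsmul p u) = ∑ i, fsmul (f i) (S i) := by
    ext y
    rw [sum_apply]
    by_cases hy : y ∈ t.baseSet
    · have := t.eq_sum_localFrameCoeff_smul (I := 𝓘(ℝ, EM)) (b := b) (s := u) hy
      change ψ y • ψ y • u y = ∑ i, (ψ y • c i y) • (ψ y • t.localFrame b i y)
      conv_lhs => rw [this]
      rw [Finset.smul_sum, Finset.smul_sum]
      refine Finset.sum_congr rfl fun i _ => ?_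
      change ψ y • ψ y • (c i y) • _ = _
      simp only [smul_smul, smul_eq_mul]
      ring_nf
    · have h0 : ψ y = 0 := by
        by_contra h
        exact hy (hψ (subset_tsupport _ h))
      change ψ y • ψ y • u y = ∑ i, (ψ y • c i y) • (ψ y • t.localFrame b i y)
      simp [h0]
  have h2 := congrArg (fun w => (Φ w) x) key
  have hp : p x = 1 := ψ.eq_one
  have hfx : ∀ i, f i x = 0 := by
    intro i
    change ψ x • (t.localFrameCoeff 𝓘(ℝ, EM) b i x) (u x) = 0
    rw [hu, map_zero, smul_zero]
  simp only [hΦ, map_sum, sum_apply, fsmul_apply, hp, one_smul, hfx, zero_smul,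
    Finset.sum_const_zero] at h2
  exact h2

/-- The vector bundle endomorphism given by a `C^∞(M)`-linear endomorphism `Φ` of `Γ(E)`, at the
point `x`. -/
def pointwise (Φ : Cₛ^∞⟮𝓘(ℝ, EM); F, E⟯ →ₗ[ℝ] Cₛ^∞⟮𝓘(ℝ, EM); F, E⟯)
    (hΦ : ∀ (f : C^∞⟮𝓘(ℝ, EM), M; ℝ⟯) (u : Cₛ^∞⟮𝓘(ℝ, EM); F, E⟯), Φ (fsmul f u) = fsmul f (Φ u))
    (x : M) : E x →ₗ[ℝ] E x where
  toFun v := Φ (exists_section x v).choose x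
  map_add' v w := by
    have h := tensorial Φ hΦ ((exists_section (F := F) x (v + w)).choose -
      ((exists_section (F := F) x v).choose + (exists_section (F := F) x w).choose)) x (by
        simp only [ContMDiffSection.coe_sub, ContMDiffSection.coe_add, Pi.sub_apply, Pi.add_apply,
          (exists_section (F := F) x (v + w)).choose_spec,
          (exists_section (F := F) x v).choose_spec, (exists_section (F := F) x w).choose_spec]
        abel)
    rw [map_sub, map_add] at h
    exact sub_eq_zero.1 h
  map_smul' c v := by
    have h := tensorial Φ hΦ ((exists_section (F := F) x (c • v)).choose -
      c • (exists_section (F := F) x v).choose) x (by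
        simp only [ContMDiffSection.coe_sub, ContMDiffSection.coe_smul, Pi.sub_apply, Pi.smul_apply,
          (exists_section (F := F) x (c • v)).choose_spec,
          (exists_section (F := F) x v).choose_spec, sub_self])
    rw [map_sub, map_smul] at h
    exact sub_eq_zero.1 h

lemma pointwise_apply (Φ : Cₛ^∞⟮𝓘(ℝ, EM); F, E⟯ →ₗ[ℝ] Cₛ^∞⟮𝓘(ℝ, EM); F, E⟯)
    (hΦ : ∀ (f : C^∞⟮𝓘(ℝ, EM), M; ℝ⟯) (u : Cₛ^∞⟮𝓘(ℝ, EM); F, E⟯), Φ (fsmul f u) = fsmul f (Φ u))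
    (u : Cₛ^∞⟮𝓘(ℝ, EM); F, E⟯) (x : M) : pointwise Φ hΦ x (u x) = Φ u x := by
  have h := tensorial Φ hΦ ((exists_section (F := F) x (u x)).choose - u) x (by
    simp only [ContMDiffSection.coe_sub, Pi.sub_apply,
      (exists_section (F := F) x (u x)).choose_spec, sub_self])
  rw [map_sub] at h
  exact sub_eq_zero.1 h

/-! ## Courant algebroids -/

end Bundles

section CA

variable (EM : Type*) [NormedAddCommGroup EM] [NormedSpace ℝ EM]
  {M : Type*} [TopologicalSpace M] [ChartedSpace EM M]
  (F : Type*) [NormedAddCommGroup F] [NormedSpace ℝ F]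
  (E : M → Type*) [∀ x, AddCommGroup (E x)] [∀ x, Module ℝ (E x)]
  [∀ x, TopologicalSpace (E x)] [TopologicalSpace (TotalSpace F E)]
  [FiberBundle F E] [VectorBundle ℝ F E] [IsManifold 𝓘(ℝ, EM) ∞ M]

/-- The derivative `X f` at `x` of a real function `f` along a tangent vector `X` at `x`. -/
def dirDeriv {EM : Type*} [NormedAddCommGroup EM] [NormedSpace ℝ EM]
    {M : Type*} [TopologicalSpace M] [ChartedSpace EM M]
    (f : M → ℝ) (x : M) (X : TangentSpace 𝓘(ℝ, EM) x) : ℝ :=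
  mfderiv 𝓘(ℝ, EM) 𝓘(ℝ, ℝ) f x X

/-- A Courant algebroid structure on the smooth vector bundle `E → M`: a fibrewise non-degenerate
symmetric pairing, an anchor `E → TM` (both smooth), and a bracket on `Γ(E)`, such that
`[u,[v,w]] = [[u,v],w] + [v,[u,w]]`, `[u,fv] = f[u,v] + (u·f)v`,
`u·⟨v,w⟩ = ⟨[u,v],w⟩ + ⟨v,[u,w]⟩` and `[u,v] + [v,u] = d_E⟨u,v⟩`, where `u·f = ρ(u)f` and
`⟨w, d_E f⟩ = w·f`. -/
structure CourantAlgebroid where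
  /-- the pairing -/
  pairing : ∀ x, LinearMap.BilinForm ℝ (E x)
  pairing_smooth : ∀ (u v : ∀ x, E x) (x₀ : M),
    ContMDiffAt 𝓘(ℝ, EM) (𝓘(ℝ, EM).prod 𝓘(ℝ, F)) ∞ (fun x => TotalSpace.mk' F x (u x)) x₀ →
    ContMDiffAt 𝓘(ℝ, EM) (𝓘(ℝ, EM).prod 𝓘(ℝ, F)) ∞ (fun x => TotalSpace.mk' F x (v x)) x₀ →
    ContMDiffAt 𝓘(ℝ, EM) 𝓘(ℝ, ℝ) ∞ (fun x => pairing x (u x) (v x)) x₀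
  pairing_symm : ∀ x a b, pairing x a b = pairing x b a
  pairing_nondegenerate : ∀ x a, (∀ b, pairing x a b = 0) → a = 0
  /-- the anchor -/
  anchor : ∀ x, E x →ₗ[ℝ] TangentSpace 𝓘(ℝ, EM) x
  anchor_smooth : ∀ (u : ∀ x, E x) (x₀ : M),
    ContMDiffAt 𝓘(ℝ, EM) (𝓘(ℝ, EM).prod 𝓘(ℝ, F)) ∞ (fun x => TotalSpace.mk' F x (u x)) x₀ →
    ContMDiffAt 𝓘(ℝ, EM) (𝓘(ℝ, EM).prod 𝓘(ℝ, EM)) ∞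
      (fun x => (⟨x, anchor x (u x)⟩ : TangentBundle 𝓘(ℝ, EM) M)) x₀
  /-- the bracket -/
  bracket : Cₛ^∞⟮𝓘(ℝ, EM); F, E⟯ →ₗ[ℝ] Cₛ^∞⟮𝓘(ℝ, EM); F, E⟯ →ₗ[ℝ] Cₛ^∞⟮𝓘(ℝ, EM); F, E⟯
  jacobi : ∀ u v w : Cₛ^∞⟮𝓘(ℝ, EM); F, E⟯,
    bracket u (bracket v w) = bracket (bracket u v) w + bracket v (bracket u w)
  leibniz : ∀ (u : Cₛ^∞⟮𝓘(ℝ, EM); F, E⟯) (f : C^∞⟮𝓘(ℝ, EM), M; ℝ⟯) (v : Cₛ^∞⟮𝓘(ℝ, EM); F, E⟯) (x : M),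
    bracket u (fsmul f v) x = f x • bracket u v x + dirDeriv f x (anchor x (u x)) • v x
  invariant : ∀ (u v w : Cₛ^∞⟮𝓘(ℝ, EM); F, E⟯) (x : M),
    dirDeriv (fun y => pairing y (v y) (w y)) x (anchor x (u x)) =
      pairing x (bracket u v x) (w x) + pairing x (v x) (bracket u w x)
  bracket_add_swap : ∀ (u v w : Cₛ^∞⟮𝓘(ℝ, EM); F, E⟯) (x : M),
    pairing x (w x) (bracket u v x + bracket v u x) =
      dirDeriv (fun y => pairing y (u y) (v y)) x (anchor x (w x))

variable {EM F E}

/-- A divergence on `E`: an `ℝ`-linear map `div : Γ(E) → C^∞(M)` with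
`div(fu) = f div u + u·f`. -/
structure Divergence (C : CourantAlgebroid EM F E) where
  /-- the underlying linear map -/
  toFun : Cₛ^∞⟮𝓘(ℝ, EM); F, E⟯ →ₗ[ℝ] C^∞⟮𝓘(ℝ, EM), M; ℝ⟯
  map_fsmul : ∀ (f : C^∞⟮𝓘(ℝ, EM), M; ℝ⟯) (u : Cₛ^∞⟮𝓘(ℝ, EM); F, E⟯) (x : M),
    toFun (fsmul f u) x = f x * toFun u x + dirDeriv f x (C.anchor x (u x))

/-- A generalized pseudometric: a smooth subbundle `V₊ ⊆ E` on which the pairing is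
non-degenerate. -/
structure GenPseudometric (C : CourantAlgebroid EM F E) where
  /-- the fibres of `V₊` -/
  plus : ∀ x, Submodule ℝ (E x)
  exists_frame : ∀ x₀, ∃ (U : Set M) (n : ℕ) (e : Fin n → ∀ x, E x), IsOpen U ∧ x₀ ∈ U ∧
    (∀ i, ContMDiffOn 𝓘(ℝ, EM) (𝓘(ℝ, EM).prod 𝓘(ℝ, F)) ∞
      (fun x => TotalSpace.mk' F x (e i x)) U) ∧
    ∀ x ∈ U, LinearIndependent ℝ (fun i => e i x) ∧
      Submodule.span ℝ (Set.range fun i => e i x) = plus x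
  nondegenerate : ∀ x, ∀ a ∈ plus x, (∀ b ∈ plus x, C.pairing x a b = 0) → a = 0

namespace GenPseudometric

variable {C : CourantAlgebroid EM F E} (V : GenPseudometric C)

/-- The fibres of `V₋ = V₊^⊥`. -/
def minus (x : M) : Submodule ℝ (E x) := (C.pairing x).orthogonal (V.plus x)

lemma mem_minus {x : M} {b : E x} : b ∈ V.minus x ↔ ∀ a ∈ V.plus x, C.pairing x a b = 0 :=
  LinearMap.BilinForm.mem_orthogonal_iff

variable [FiniteDimensional ℝ F]

lemma isCompl (x : M) : IsCompl (V.plus x) (V.minus x) := by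
  have : FiniteDimensional ℝ (E x) := VectorBundle.finiteDimensional ℝ F E x
  refine (LinearMap.BilinForm.isCompl_orthogonal_iff_disjoint
    (fun a b h => by rw [C.pairing_symm]; exact h)).2 ?_
  rw [Submodule.disjoint_def]
  intro a ha ha'
  refine V.nondegenerate x a ha fun b hb => ?_
  rw [C.pairing_symm]
  exact V.mem_minus.1 ha' b hb

/-- The orthogonal projection `E_x → V₊`. -/
def proj (x : M) : E x →ₗ[ℝ] E x := (V.plus x).projection (V.minus x) (V.isCompl x)

lemma proj_mem (x : M) (a : E x) : V.proj x a ∈ V.plus x :=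
  Submodule.projection_apply_mem _ _

lemma sub_proj_mem (x : M) (a : E x) : a - V.proj x a ∈ V.minus x :=
  Submodule.sub_projection_mem _ _

lemma proj_eq {x : M} {a w : E x} (hw : w ∈ V.plus x) (h : a - w ∈ V.minus x) :
    V.proj x a = w := by
  have h1 : V.proj x w = w := Submodule.projection_apply_of_mem_left _ hw
  have h2 : V.proj x (a - w) = 0 := (Submodule.projection_apply_eq_zero_iff _).2 h
  rw [map_sub, h1] at h2
  exact sub_eq_zero.1 h2

lemma proj_of_mem {x : M} {a : E x} (ha : a ∈ V.plus x) : V.proj x a = a :=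
  V.proj_eq ha (by rw [sub_self]; exact Submodule.zero_mem _)

lemma proj_proj (x : M) (a : E x) : V.proj x (V.proj x a) = V.proj x a :=
  V.proj_of_mem (V.proj_mem x a)

lemma contMDiffAt_det {n : ℕ} {G : M → Matrix (Fin n) (Fin n) ℝ} {x₀ : M}
    (hG : ∀ i j, ContMDiffAt 𝓘(ℝ, EM) 𝓘(ℝ, ℝ) ∞ (fun x => G x i j) x₀) :
    ContMDiffAt 𝓘(ℝ, EM) 𝓘(ℝ, ℝ) ∞ (fun x => (G x).det) x₀ := by
  have : (fun x => (G x).det) = fun x => ∑ σ : Equiv.Perm (Fin n),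
      ((Equiv.Perm.sign σ : ℤ) : ℝ) * ∏ i, G x (σ i) i := by
    funext x; exact Matrix.det_apply' _
  rw [this]
  refine ContMDiffAt.sum fun σ _ => contMDiffAt_const.mul ?_
  exact contMDiffAt_finsetProd fun i _ => hG _ _

/-- The orthogonal projection to `V₊` of a smooth section is smooth. -/
lemma proj_smooth (u : ∀ x, E x) (x₀ : M)
    (hu : ContMDiffAt 𝓘(ℝ, EM) (𝓘(ℝ, EM).prod 𝓘(ℝ, F)) ∞ (fun x => TotalSpace.mk' F x (u x)) x₀) :
    ContMDiffAt 𝓘(ℝ, EM) (𝓘(ℝ, EM).prod 𝓘(ℝ, F)) ∞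
      (fun x => TotalSpace.mk' F x (V.proj x (u x))) x₀ := by
  obtain ⟨U, n, e, hU, hx₀, he, hspan⟩ := V.exists_frame x₀
  have he' : ∀ i, ContMDiffAt 𝓘(ℝ, EM) (𝓘(ℝ, EM).prod 𝓘(ℝ, F)) ∞
      (fun x => TotalSpace.mk' F x (e i x)) x₀ := fun i => (he i).contMDiffAt (hU.mem_nhds hx₀)
  let G : M → Matrix (Fin n) (Fin n) ℝ := fun x => Matrix.of fun i j => C.pairing x (e i x) (e j x)
  let h : M → Fin n → ℝ := fun x i => C.pairing x (e i x) (u x)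
  have hG : ∀ i j, ContMDiffAt 𝓘(ℝ, EM) 𝓘(ℝ, ℝ) ∞ (fun x => G x i j) x₀ := fun i j =>
    C.pairing_smooth _ _ _ (he' i) (he' j)
  have hh : ∀ i, ContMDiffAt 𝓘(ℝ, EM) 𝓘(ℝ, ℝ) ∞ (fun x => h x i) x₀ := fun i =>
    C.pairing_smooth _ _ _ (he' i) hu
  have hdet : ∀ x ∈ U, (G x).det ≠ 0 := by
    intro x hx hdet
    obtain ⟨c, hc, hGc⟩ := Matrix.exists_mulVec_eq_zero_iff.2 hdet
    apply hc
    have hw : ∑ j, c j • e j x = 0 := by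
      refine V.nondegenerate x _ ?_ ?_
      · rw [← (hspan x hx).2]
        exact Submodule.sum_mem _ fun j _ => Submodule.smul_mem _ _ (Submodule.subset_span ⟨j, rfl⟩)
      · intro b hb
        rw [← (hspan x hx).2] at hb
        induction hb using Submodule.span_induction with
        | mem b hb =>
          obtain ⟨i, rfl⟩ := hb
          have := congrFun hGc i
          simp only [Matrix.mulVec, dotProduct, Pi.zero_apply] at this
          rw [C.pairing_symm, map_sum, ← this]
          refine Finset.sum_congr rfl fun j _ => ?_
          simp [G, mul_comm]
        | zero => simp
        | add a b _ _ ha hb => rw [map_add, ha, hb, add_zero]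
        | smul r a _ ha => rw [map_smul, ha, smul_zero]
    exact funext fun j => (Fintype.linearIndependent_iff.1 (hspan x hx).1 c hw j)
  let c : Fin n → M → ℝ := fun i x => ((G x).det)⁻¹ * ((G x).cramer (h x) i)
  have hc : ∀ i, ContMDiffAt 𝓘(ℝ, EM) 𝓘(ℝ, ℝ) ∞ (c i) x₀ := by
    intro i
    refine ContMDiffAt.mul ((contMDiffAt_det hG).inv₀ (hdet x₀ hx₀)) ?_
    have : (fun x => (G x).cramer (h x) i) = fun x => ((G x).updateCol i (h x)).det := by
      funext x; exact Matrix.cramer_apply _ _ _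
    rw [this]
    refine contMDiffAt_det fun k l => ?_
    by_cases hl : l = i
    · subst hl
      simpa using hh k
    · simpa [Matrix.updateCol_apply, hl] using hG k l
  have hsum : ContMDiffAt 𝓘(ℝ, EM) (𝓘(ℝ, EM).prod 𝓘(ℝ, F)) ∞
      (fun x => TotalSpace.mk' F x (∑ i, c i x • e i x)) x₀ :=
    ContMDiffAt.sum_section fun i _ => (hc i).smul_section (he' i)
  refine hsum.congr_of_eventuallyEq ?_
  filter_upwards [hU.mem_nhds hx₀] with x hx
  congr 1
  refine V.proj_eq ?_ ?_
  · rw [← (hspan x hx).2]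
    exact Submodule.sum_mem _ fun j _ => Submodule.smul_mem _ _ (Submodule.subset_span ⟨j, rfl⟩)
  · rw [V.mem_minus]
    intro a ha
    rw [← (hspan x hx).2] at ha
    induction ha using Submodule.span_induction with
    | mem a ha =>
      obtain ⟨i, rfl⟩ := ha
      have h1 := congrFun (Matrix.mulVec_cramer (G x) (h x)) i
      simp only [Matrix.mulVec, dotProduct, Pi.smul_apply, smul_eq_mul] at h1
      have h2 : ∑ j, c j x * C.pairing x (e i x) (e j x) = h x i := by
        rw [← mul_right_inj' (hdet x hx), ← h1, Finset.mul_sum]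
        refine Finset.sum_congr rfl fun j _ => ?_
        simp only [c, G, Matrix.of_apply]
        rw [← mul_assoc, ← mul_assoc, mul_inv_cancel₀ (hdet x hx), one_mul, mul_comm]
      rw [map_sub, map_sum]
      simp only [map_smul, smul_eq_mul]
      rw [h2, sub_self]
    | zero => simp
    | add a b _ _ ha hb => rw [map_add, LinearMap.add_apply, ha, hb, add_zero]
    | smul r a _ ha => rw [map_smul, LinearMap.smul_apply, ha, smul_zero]

/-- The orthogonal projection `u ↦ u₊` of sections to `V₊`. -/
def projPlus : Cₛ^∞⟮𝓘(ℝ, EM); F, E⟯ →ₗ[ℝ] Cₛ^∞⟮𝓘(ℝ, EM); F, E⟯ where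
  toFun u := ⟨fun x => V.proj x (u x), fun x => V.proj_smooth _ x (u.contMDiff x)⟩
  map_add' u v := by ext x; exact map_add (V.proj x) (u x) (v x)
  map_smul' r u := by ext x; exact map_smul (V.proj x) r (u x)

/-- The orthogonal projection `u ↦ u₋ = u - u₊` of sections to `V₋`. -/
def projMinus : Cₛ^∞⟮𝓘(ℝ, EM); F, E⟯ →ₗ[ℝ] Cₛ^∞⟮𝓘(ℝ, EM); F, E⟯ := LinearMap.id - V.projPlus

lemma projPlus_apply (u : Cₛ^∞⟮𝓘(ℝ, EM); F, E⟯) (x : M) : V.projPlus u x = V.proj x (u x) := rfl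

lemma projMinus_apply (u : Cₛ^∞⟮𝓘(ℝ, EM); F, E⟯) (x : M) :
    V.projMinus u x = u x - V.proj x (u x) := rfl

variable [FiniteDimensional ℝ EM] [T2Space M] [ContMDiffVectorBundle ∞ F E 𝓘(ℝ, EM)]

/-- The smooth sections of `V₊`. -/
def sectionsPlus : Submodule ℝ Cₛ^∞⟮𝓘(ℝ, EM); F, E⟯ where
  carrier := {u | ∀ x, u x ∈ V.plus x}
  add_mem' ha hb x := (V.plus x).add_mem (ha x) (hb x)
  zero_mem' x := (V.plus x).zero_mem
  smul_mem' r _ ha x := (V.plus x).smul_mem r (ha x)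

/-- The smooth sections of `V₋`. -/
def sectionsMinus : Submodule ℝ Cₛ^∞⟮𝓘(ℝ, EM); F, E⟯ where
  carrier := {u | ∀ x, u x ∈ V.minus x}
  add_mem' ha hb x := (V.minus x).add_mem (ha x) (hb x)
  zero_mem' x := (V.minus x).zero_mem
  smul_mem' r _ ha x := (V.minus x).smul_mem r (ha x)

lemma projPlus_fsmul (f : C^∞⟮𝓘(ℝ, EM), M; ℝ⟯) (u : Cₛ^∞⟮𝓘(ℝ, EM); F, E⟯) :
    V.projPlus (fsmul f u) = fsmul f (V.projPlus u) := by
  ext x; exact map_smul (V.proj x) (f x) (u x)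

lemma projMinus_fsmul (f : C^∞⟮𝓘(ℝ, EM), M; ℝ⟯) (u : Cₛ^∞⟮𝓘(ℝ, EM); F, E⟯) :
    V.projMinus (fsmul f u) = fsmul f (V.projMinus u) := by
  ext x
  simp only [projMinus_apply, fsmul_apply, map_smul, smul_sub]

/-- If `u ⊥ b` then `[fu, b] = f[u, b] - (b·f)u`. -/
lemma bracket_fsmul_of_orthogonal (f : C^∞⟮𝓘(ℝ, EM), M; ℝ⟯) (u b : Cₛ^∞⟮𝓘(ℝ, EM); F, E⟯)
    (h : ∀ x, C.pairing x (u x) (b x) = 0) (x : M) :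
    C.bracket (fsmul f u) b x = f x • C.bracket u b x - dirDeriv f x (C.anchor x (b x)) • u x := by
  have skew : ∀ v : Cₛ^∞⟮𝓘(ℝ, EM); F, E⟯, (∀ x, C.pairing x (v x) (b x) = 0) →
      C.bracket v b x = - C.bracket b v x := by
    intro v hv
    refine eq_neg_of_add_eq_zero_left (C.pairing_nondegenerate x _ fun w => ?_)
    obtain ⟨W, rfl⟩ := exists_section (EM := EM) (F := F) x w
    rw [C.pairing_symm]
    refine (C.bracket_add_swap v b W x).trans ?_
    have : (fun y => C.pairing y (v y) (b y)) = fun _ => (0 : ℝ) := funext hv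
    rw [this, dirDeriv, mfderiv_const]
    rfl
  rw [skew u h, skew (fsmul f u) (fun y => by simp [h]), C.leibniz]
  rw [smul_neg, neg_add, sub_eq_add_neg]

/-- The map `u ↦ [[u₊, b]₋, a]₊` on sections. -/
def ricciOp (a : V.sectionsPlus) (b : V.sectionsMinus) :
    Cₛ^∞⟮𝓘(ℝ, EM); F, E⟯ →ₗ[ℝ] Cₛ^∞⟮𝓘(ℝ, EM); F, E⟯ :=
  V.projPlus ∘ₗ C.bracket.flip a.1 ∘ₗ V.projMinus ∘ₗ C.bracket.flip b.1 ∘ₗ V.projPlus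

lemma ricciOp_apply (a : V.sectionsPlus) (b : V.sectionsMinus) (u : Cₛ^∞⟮𝓘(ℝ, EM); F, E⟯) :
    V.ricciOp a b u = V.projPlus (C.bracket (V.projMinus (C.bracket (V.projPlus u) b.1)) a.1) := rfl

lemma ricciOp_fsmul (a : V.sectionsPlus) (b : V.sectionsMinus) (f : C^∞⟮𝓘(ℝ, EM), M; ℝ⟯)
    (u : Cₛ^∞⟮𝓘(ℝ, EM); F, E⟯) : V.ricciOp a b (fsmul f u) = fsmul f (V.ricciOp a b u) := by
  have h1 : V.projMinus (C.bracket (V.projPlus (fsmul f u)) b.1) =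
      fsmul f (V.projMinus (C.bracket (V.projPlus u) b.1)) := by
    ext x
    rw [projPlus_fsmul, projMinus_apply, bracket_fsmul_of_orthogonal, map_sub, map_smul, map_smul,
      projPlus_apply, fsmul_apply, projMinus_apply, V.proj_proj, smul_sub]
    · abel
    · exact fun y => V.mem_minus.1 (b.2 y) _ (V.proj_mem y (u y))
  rw [ricciOp_apply, h1]
  ext x
  have h2 : ∀ w : Cₛ^∞⟮𝓘(ℝ, EM); F, E⟯, V.proj x (V.projMinus w x) = 0 := by
    intro w
    rw [projMinus_apply, map_sub, V.proj_proj, sub_self]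
  rw [projPlus_apply, bracket_fsmul_of_orthogonal, map_sub, map_smul, map_smul, h2, smul_zero,
    sub_zero]
  · rfl
  · intro y
    rw [C.pairing_symm]
    exact V.mem_minus.1 (V.sub_proj_mem y _) _ (a.2 y)

/-- The endomorphism `[[·, b₋]₋, a₊]₊` of the fibre of `V₊` at `x`. -/
def ricciEnd (a : V.sectionsPlus) (b : V.sectionsMinus) (x : M) : V.plus x →ₗ[ℝ] V.plus x :=
  (pointwise (V.ricciOp a b) (V.ricciOp_fsmul a b) x).restrict (by
    intro v _
    obtain ⟨u, rfl⟩ := exists_section (EM := EM) (F := F) x v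
    rw [pointwise_apply]
    exact V.proj_mem x _)

/-- The characterizing property of `ricciEnd`. -/
lemma ricciEnd_apply (a : V.sectionsPlus) (b : V.sectionsMinus) (x : M) (u : V.sectionsPlus) :
    (V.ricciEnd a b x ⟨u.1 x, u.2 x⟩ : E x) =
      V.projPlus (C.bracket (V.projMinus (C.bracket u.1 b.1)) a.1) x := by
  have hu : V.projPlus u.1 = u.1 := by
    ext y
    exact V.proj_of_mem (u.2 y)
  change pointwise (V.ricciOp a b) (V.ricciOp_fsmul a b) x (u.1 x) = _
  rw [pointwise_apply, ricciOp_apply, hu]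

/-- The generalized Ricci tensor
`GRic(a₊, b₋) = div [b₋, a₊]₊ - b₋·div a₊ - Tr_{V₊} [[·, b₋]₋, a₊]₊`. -/
def GRic (div : Divergence C) (a : V.sectionsPlus) (b : V.sectionsMinus) (x : M) : ℝ :=
  div.toFun (V.projPlus (C.bracket b.1 a.1)) x
    - dirDeriv (div.toFun a.1) x (C.anchor x (b.1 x))
    - LinearMap.trace ℝ (V.plus x) (V.ricciEnd a b x)

/-! ### Curves of generalized pseudometrics and their velocities -/

/-- A family `(γ t)` of generalized pseudometrics is a smooth curve if it depends smoothly on `t`,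
i.e. if the `(γ t)₊` have local frames that are jointly smooth in `t` and in the point of `M`. -/
def IsSmoothCurve (γ : ℝ → GenPseudometric C) : Prop :=
  ∀ p₀ : ℝ × M, ∃ (W : Set (ℝ × M)) (n : ℕ) (e : Fin n → ∀ p : ℝ × M, E p.2),
    IsOpen W ∧ p₀ ∈ W ∧
    (∀ i, ContMDiffOn (𝓘(ℝ, ℝ).prod 𝓘(ℝ, EM)) (𝓘(ℝ, EM).prod 𝓘(ℝ, F)) ∞
      (fun p : ℝ × M => TotalSpace.mk' F p.2 (e i p)) W) ∧
    ∀ p ∈ W, LinearIndependent ℝ (fun i => e i p) ∧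
      Submodule.span ℝ (Set.range fun i => e i p) = (γ p.1).plus p.2

/-- A tangent vector to the space of generalized pseudometrics at `V₊` is an infinitesimal
deformation `V₊ → V₋`, i.e. a section of `V₊^* ⊗ V₋^*`; here `A` is such a section, given by its
values `A(a₊, b₋)`. The curve `γ` has velocity `A` at time `t` if
`d/ds ⟨a_s, b₋⟩ = A(a₊, b₋)` at `s = t`, where `a_s` is the projection of `a₊` to `(γ s)₊`:
this says that `a₊ + (s - t) A(a₊) + o(s - t)` is in `(γ s)₊`. -/
def HasVelocityAt (γ : ℝ → GenPseudometric C) (t : ℝ)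
    (A : (γ t).sectionsPlus → (γ t).sectionsMinus → M → ℝ) : Prop :=
  ∀ (a : (γ t).sectionsPlus) (b : (γ t).sectionsMinus) (x : M),
    HasDerivAt (fun s => C.pairing x ((γ s).proj x (a.1 x)) (b.1 x)) (A a b x) t

end GenPseudometric

/-! ## Equivariant Courant algebroids -/

/-- An `𝔰`-equivariant structure on a Courant algebroid, for a Lie algebra `𝔰` with the zero
pairing. -/
structure EquivariantStructure (C : CourantAlgebroid EM F E) (𝔰 : Type*) [LieRing 𝔰]
    [LieAlgebra ℝ 𝔰] where
  /-- the map `χ : 𝔰 → Γ(E)` -/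
  χ : 𝔰 →ₗ[ℝ] Cₛ^∞⟮𝓘(ℝ, EM); F, E⟯
  bracket_χ : ∀ s t, C.bracket (χ s) (χ t) = χ ⁅s, t⁆
  isotropic : ∀ s t x, C.pairing x (χ s x) (χ t x) = 0
  injective : ∀ x s, χ s x = 0 → s = 0

namespace EquivariantStructure

variable {C : CourantAlgebroid EM F E} {𝔰 : Type*} [LieRing 𝔰] [LieAlgebra ℝ 𝔰]
  (K : EquivariantStructure C 𝔰)

/-- The fibre of `𝔰_E^⊥` at `x`. -/
def perp (x : M) : Submodule ℝ (E x) where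
  carrier := {a | ∀ s, C.pairing x (K.χ s x) a = 0}
  add_mem' ha hb s := by rw [map_add, ha s, hb s, add_zero]
  zero_mem' s := map_zero _
  smul_mem' r a ha s := by rw [map_smul, ha s, smul_zero]

/-- A section is invariant if it is annihilated by all `[χ(s), ·]`. -/
def IsInvariant (u : Cₛ^∞⟮𝓘(ℝ, EM); F, E⟯) : Prop := ∀ s, C.bracket (K.χ s) u = 0

/-- An equivariant divergence: `χ(s)·div u = div [χ(s),u]` and `div χ(s) = -Tr_𝔰 ad_s`. -/
structure IsEquivariantDivergence (div : Divergence C) : Prop where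
  equivariant : ∀ s u x,
    dirDeriv (div.toFun u) x (C.anchor x (K.χ s x)) = div.toFun (C.bracket (K.χ s) u) x
  div_χ : ∀ s x, div.toFun (K.χ s) x = - LinearMap.trace ℝ 𝔰 (LieAlgebra.ad ℝ 𝔰 s)

/-- An admissible generalized pseudometric: `V₊` is `𝔰`-invariant and `V₊ ⊆ 𝔰_E^⊥`. -/
structure IsAdmissible [FiniteDimensional ℝ F] [FiniteDimensional ℝ EM] [T2Space M]
    [ContMDiffVectorBundle ∞ F E 𝓘(ℝ, EM)] (V : GenPseudometric C) : Prop where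
  invariant : ∀ s, ∀ a ∈ V.sectionsPlus, C.bracket (K.χ s) a ∈ V.sectionsPlus
  le_perp : ∀ x, V.plus x ≤ K.perp x

end EquivariantStructure

end CA

/-! ## Pullbacks -/

section Pullback

variable {EM : Type*} [NormedAddCommGroup EM] [NormedSpace ℝ EM]
  {M : Type*} [TopologicalSpace M] [ChartedSpace EM M]
  {F : Type*} [NormedAddCommGroup F] [NormedSpace ℝ F]
  {E : M → Type*} [∀ x, AddCommGroup (E x)] [∀ x, Module ℝ (E x)]
  [∀ x, TopologicalSpace (E x)] [TopologicalSpace (TotalSpace F E)]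
  [FiberBundle F E] [VectorBundle ℝ F E] [IsManifold 𝓘(ℝ, EM) ∞ M]
  [ContMDiffVectorBundle ∞ F E 𝓘(ℝ, EM)]
  {EM' : Type*} [NormedAddCommGroup EM'] [NormedSpace ℝ EM']
  {M' : Type*} [TopologicalSpace M'] [ChartedSpace EM' M'] [IsManifold 𝓘(ℝ, EM') ∞ M']
  (τ : C^∞⟮𝓘(ℝ, EM'), M'; 𝓘(ℝ, EM), M⟯)

lemma contMDiffAt_pullback {u : ∀ x, E x} {x₀ : M'}
    (hu : ContMDiffAt 𝓘(ℝ, EM) (𝓘(ℝ, EM).prod 𝓘(ℝ, F)) ∞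
      (fun x => TotalSpace.mk' F x (u x)) (τ x₀)) :
    ContMDiffAt 𝓘(ℝ, EM') (𝓘(ℝ, EM').prod 𝓘(ℝ, F)) ∞
      (fun x => (TotalSpace.mk' F x (u (τ x)) : TotalSpace F (τ *ᵖ E))) x₀ := by
  rw [contMDiffAt_section] at hu
  let w : ∀ x, (τ *ᵖ E) x := fun x => (u (τ x) : E (τ x))
  change ContMDiffAt 𝓘(ℝ, EM') (𝓘(ℝ, EM').prod 𝓘(ℝ, F)) ∞ (fun x => TotalSpace.mk' F x (w x)) x₀
  exact (contMDiffAt_section x₀).2 (hu.comp x₀ τ.contMDiff.contMDiffAt)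

/-- The section `τ^*u` of the pullback bundle `τ^*E`. -/
def pullbackSection (u : Cₛ^∞⟮𝓘(ℝ, EM); F, E⟯) : Cₛ^∞⟮𝓘(ℝ, EM'); F, (τ *ᵖ E)⟯ :=
  ⟨fun x => u (τ x), fun x => contMDiffAt_pullback τ (u.contMDiff (τ x))⟩

/-- A Courant algebroid structure `C'` on `τ^*E` makes it a CA-pullback of `(E, C)` if
`⟨τ^*u, τ^*v⟩' = τ^*⟨u,v⟩`, `[τ^*u, τ^*v]' = τ^*[u,v]` and `τ_* ρ'(τ^*u) = ρ(u)`. -/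
structure IsCAPullback (C : CourantAlgebroid EM F E) (C' : CourantAlgebroid EM' F (τ *ᵖ E)) :
    Prop where
  pairing : ∀ (x : M') (a b : E (τ x)), C'.pairing x a b = C.pairing (τ x) a b
  bracket : ∀ u v : Cₛ^∞⟮𝓘(ℝ, EM); F, E⟯,
    C'.bracket (pullbackSection τ u) (pullbackSection τ v) = pullbackSection τ (C.bracket u v)
  anchor : ∀ (x : M') (a : E (τ x)),
    mfderiv 𝓘(ℝ, EM') 𝓘(ℝ, EM) τ x (C'.anchor x a) = C.anchor (τ x) a

variable {C : CourantAlgebroid EM F E} {C' : CourantAlgebroid EM' F (τ *ᵖ E)} {τ}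

/-- The divergence `div'` is `τ^*div`. -/
def IsPullbackDivergence (div : Divergence C) (div' : Divergence C') : Prop :=
  ∀ (u : Cₛ^∞⟮𝓘(ℝ, EM); F, E⟯) (x : M'), div'.toFun (pullbackSection τ u) x = div.toFun u (τ x)

/-- The equivariant structure `χ'(s) = τ^*χ(s)` on a CA-pullback. -/
def EquivariantStructure.pullback {𝔰 : Type*} [LieRing 𝔰] [LieAlgebra ℝ 𝔰]
    (K : EquivariantStructure C 𝔰) (h : IsCAPullback τ C C') :
    EquivariantStructure C' 𝔰 where
  χ :=
    { toFun := fun s => pullbackSection τ (K.χ s)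
      map_add' := fun s t => by ext x; exact congrArg (fun u => u (τ x)) (map_add K.χ s t)
      map_smul' := fun r s => by ext x; exact congrArg (fun u => u (τ x)) (map_smul K.χ r s) }
  bracket_χ s t := by
    change C'.bracket (pullbackSection τ (K.χ s)) (pullbackSection τ (K.χ t)) = _
    rw [h.bracket, K.bracket_χ]
    rfl
  isotropic s t x := (h.pairing x _ _).trans (K.isotropic s t (τ x))
  injective x s hs := K.injective (τ x) s hs

/-- The generalized pseudometric `τ^*V₊` on a CA-pullback. -/
def GenPseudometric.pullback (V : GenPseudometric C) (h : IsCAPullback τ C C') :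
    GenPseudometric C' where
  plus x := V.plus (τ x)
  exists_frame x₀ := by
    obtain ⟨U, n, e, hU, hx₀, he, hspan⟩ := V.exists_frame (τ x₀)
    refine ⟨τ ⁻¹' U, n, fun i x => e i (τ x), hU.preimage τ.contMDiff.continuous, hx₀,
      fun i x hx => ?_, fun x hx => hspan (τ x) hx⟩
    exact (contMDiffAt_pullback τ ((he i).contMDiffAt (hU.mem_nhds hx))).contMDiffWithinAt
  nondegenerate x a ha hab := V.nondegenerate (τ x) a ha fun b hb =>
    (h.pairing x a b).symm.trans (hab b hb)

end Pullback

/-! ## Reduction -/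

section Reduction

/-- A smooth Lie group is smooth enough for its tangent space at `1` to be a Lie algebra. -/
instance lieGroup_minSmoothness {ES : Type*} [NormedAddCommGroup ES] [NormedSpace ℝ ES]
    {S : Type*} [TopologicalSpace S] [ChartedSpace ES S] [Group S] [LieGroup 𝓘(ℝ, ES) ∞ S] :
    LieGroup 𝓘(ℝ, ES) (minSmoothness ℝ 3) S := by
  rw [minSmoothness_of_isRCLikeNormedField]
  infer_instance

variable {EM : Type*} [NormedAddCommGroup EM] [NormedSpace ℝ EM]
  {M : Type*} [TopologicalSpace M] [ChartedSpace EM M]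
  {F : Type*} [NormedAddCommGroup F] [NormedSpace ℝ F]
  {E : M → Type*} [∀ x, AddCommGroup (E x)] [∀ x, Module ℝ (E x)]
  [∀ x, TopologicalSpace (E x)] [TopologicalSpace (TotalSpace F E)]
  [FiberBundle F E] [VectorBundle ℝ F E] [IsManifold 𝓘(ℝ, EM) ∞ M]
  {C : CourantAlgebroid EM F E}
  {ES : Type*} [NormedAddCommGroup ES] [NormedSpace ℝ ES] [CompleteSpace ES]
  {S : Type*} [TopologicalSpace S] [ChartedSpace ES S] [Group S] [LieGroup 𝓘(ℝ, ES) ∞ S]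
  [MulAction S M]

/-- The action of `𝔰 = Lie(S)` on `E → M`, given by the derivations `[χ(s), ·]` of `Γ(E)` and the
vector fields `ρ(χ(s))` on `M`, integrates to the given action of `S` on `M` and to an action of
`S` on `E` by vector bundle automorphisms. The Lie bracket of `𝔰` is that of left-invariant vector
fields, so that `s` acts on functions and sections by the derivative at `g = 1` of
`f ↦ f(g⁻¹ · )` and `u ↦ g u(g⁻¹ · )`. -/
structure Integration (K : EquivariantStructure C (GroupLieAlgebra 𝓘(ℝ, ES) S)) where
  /-- the action of `g` as a map from the fibre at `x` to the fibre at `gx` -/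
  act : ∀ (g : S) (x : M), E x →ₗ[ℝ] E (g • x)
  act_one : ∀ (x : M) (a : E x),
    TotalSpace.mk' F ((1 : S) • x) (act 1 x a) = TotalSpace.mk' F x a
  act_mul : ∀ (g h : S) (x : M) (a : E x),
    TotalSpace.mk' F ((g * h) • x) (act (g * h) x a) =
      TotalSpace.mk' F (g • h • x) (act g (h • x) (act h x a))
  act_smooth : ContMDiff (𝓘(ℝ, ES).prod (𝓘(ℝ, EM).prod 𝓘(ℝ, F))) (𝓘(ℝ, EM).prod 𝓘(ℝ, F)) ∞
    (fun p : S × TotalSpace F E => TotalSpace.mk' F (p.1 • p.2.proj) (act p.1 p.2.proj p.2.snd))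
  anchor_χ : ∀ (s : GroupLieAlgebra 𝓘(ℝ, ES) S) (x : M),
    (C.anchor x (K.χ s x) : EM) = mfderiv 𝓘(ℝ, ES) 𝓘(ℝ, EM) (fun g : S => g⁻¹ • x) 1 s
  bracket_χ : ∀ (s : GroupLieAlgebra 𝓘(ℝ, ES) S) (u v : Cₛ^∞⟮𝓘(ℝ, EM); F, E⟯) (x : M),
    C.pairing x (C.bracket (K.χ s) u x) (v x) =
      dirDeriv (fun g : S => C.pairing (g • g⁻¹ • x) (act g (g⁻¹ • x) (u (g⁻¹ • x)))
        (v (g • g⁻¹ • x))) 1 s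

variable {K : EquivariantStructure C (GroupLieAlgebra 𝓘(ℝ, ES) S)}
  {EMr : Type*} [NormedAddCommGroup EMr] [NormedSpace ℝ EMr]
  {Mr : Type*} [TopologicalSpace Mr] [ChartedSpace EMr Mr]
  {Fr : Type*} [NormedAddCommGroup Fr] [NormedSpace ℝ Fr]
  {Er : Mr → Type*} [∀ y, AddCommGroup (Er y)] [∀ y, Module ℝ (Er y)]
  [∀ y, TopologicalSpace (Er y)] [TopologicalSpace (TotalSpace Fr Er)]
  [FiberBundle Fr Er] [VectorBundle ℝ Fr Er] [IsManifold 𝓘(ℝ, EMr) ∞ Mr]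

/-- `(Er, Cr) → Mr` is the reduced Courant algebroid `E_{/S} → M/S`:
* `pr : M → Mr` is the quotient of `M` by `S`, i.e. a surjective submersion whose fibres are the
  `S`-orbits;
* `q` identifies `Er` with the quotient of `𝔰_E^⊥ / 𝔰_E` by `S`, i.e. it is a smooth bundle map
  over `pr` which is on each fibre the quotient of `𝔰_E^⊥` by `𝔰_E`, and it is `S`-invariant;
* the pairing, the anchor and the bracket of (invariant sections of `𝔰_E^⊥` in) `E` descend to
  those of `Er`. -/
structure Reduction (L : Integration K) (Cr : CourantAlgebroid EMr Fr Er) where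
  /-- the projection `M → M/S` -/
  pr : M → Mr
  isSubmersion : Manifold.IsSubmersion 𝓘(ℝ, EM) 𝓘(ℝ, EMr) ∞ pr
  surjective : Function.Surjective pr
  pr_eq_iff : ∀ x x', pr x = pr x' ↔ ∃ g : S, g • x = x'
  /-- the quotient map on the fibres -/
  q : ∀ x, K.perp x →ₗ[ℝ] Er (pr x)
  q_surjective : ∀ x, Function.Surjective (q x)
  q_eq_zero_iff : ∀ x (a : K.perp x), q x a = 0 ↔ ∃ s, K.χ s x = a
  q_smooth : ∀ (u : ∀ x, K.perp x) (x₀ : M),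
    ContMDiffAt 𝓘(ℝ, EM) (𝓘(ℝ, EM).prod 𝓘(ℝ, F)) ∞
      (fun x => TotalSpace.mk' F x (u x : E x)) x₀ →
    ContMDiffAt 𝓘(ℝ, EM) (𝓘(ℝ, EMr).prod 𝓘(ℝ, Fr)) ∞
      (fun x => TotalSpace.mk' Fr (pr x) (q x (u x))) x₀
  q_act : ∀ (g : S) (x : M) (a : K.perp x) (b : K.perp (g • x)), (b : E (g • x)) = L.act g x a →
    TotalSpace.mk' Fr (pr (g • x)) (q (g • x) b) = TotalSpace.mk' Fr (pr x) (q x a)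
  pairing : ∀ x (a b : K.perp x), Cr.pairing (pr x) (q x a) (q x b) = C.pairing x a b
  anchor : ∀ x (a : K.perp x),
    Cr.anchor (pr x) (q x a) = mfderiv 𝓘(ℝ, EM) 𝓘(ℝ, EMr) pr x (C.anchor x a)
  bracket : ∀ (u v w : Cₛ^∞⟮𝓘(ℝ, EM); F, E⟯) (ur vr : Cₛ^∞⟮𝓘(ℝ, EMr); Fr, Er⟯)
    (hu : ∀ x, u x ∈ K.perp x) (hv : ∀ x, v x ∈ K.perp x) (hw : ∀ x, w x ∈ K.perp x),
    K.IsInvariant u → K.IsInvariant v → w = C.bracket u v →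
    (∀ x, q x ⟨u x, hu x⟩ = ur (pr x)) → (∀ x, q x ⟨v x, hv x⟩ = vr (pr x)) →
    ∀ x, q x ⟨w x, hw x⟩ = Cr.bracket ur vr (pr x)

namespace Reduction

variable {L : Integration K} {Cr : CourantAlgebroid EMr Fr Er} (R : Reduction L Cr)

/-- The invariant section `u` of `𝔰_E^⊥` represents the section `ur` of `E_{/S}`. -/
def Represents (u : Cₛ^∞⟮𝓘(ℝ, EM); F, E⟯) (ur : Cₛ^∞⟮𝓘(ℝ, EMr); Fr, Er⟯) : Prop :=
  K.IsInvariant u ∧ ∃ hu : ∀ x, u x ∈ K.perp x, ∀ x, R.q x ⟨u x, hu x⟩ = ur (R.pr x)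

/-- `divr` is the divergence on `E_{/S}` to which `div` descends. -/
def IsReducedDivergence (div : Divergence C) (divr : Divergence Cr) : Prop :=
  ∀ u ur, R.Represents u ur → ∀ x, divr.toFun ur (R.pr x) = div.toFun u x

/-- `Vr` is the generalized pseudometric on `E_{/S}` to which `V₊ ⊆ 𝔰_E^⊥` descends. -/
def IsReducedPseudometric (V : GenPseudometric C) (Vr : GenPseudometric Cr) : Prop :=
  ∀ x, Vr.plus (R.pr x) = ((V.plus x).comap (K.perp x).subtype).map (R.q x)

end Reduction

end Reduction

end Courant

end

/-! The theorem is a statement of naturality. `GRic` is built from the bracket, the anchor, the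
divergence, the orthogonal projections and a trace. It is therefore compatible with pullback and
reduction once it can be tested on the sections that these operations carry over. This is allowed
because `GRic` is a tensor: the Leibniz anomalies of its three terms cancel (`gricS_fsmul_left`,
`gricS_fsmul_right`), so its value at a point depends only on the values of its arguments there
(`GRic_congr`). On a pullback it suffices to test on sections `τ^*u`, on a reduction on sections
represented by invariant ones.

Tangency. If `V₊` is admissible, the derivations `[χ(s), ·]` preserve `V₊`, hence also `V₋`, the
projections, the divergence and traces. So `GRic` is invariant (`Preserves.lieS_gricS`), and it
vanishes on `χ(s)`, which lies in `V₋` (`Preserves.gricS_eq_zero`). The skew operator `Φ` with `⟨Φu,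
v⟩ = GRic(u₊, v₋) - GRic(v₊, u₋)` then commutes with `[χ(s), ·]` and takes values in `𝔰_E^⊥`. Its
exponential is an isometry that commutes with `[χ(s), ·]` (`bracket_flowS`) and fixes pairings with
`χ(s)`, so `exp(tΦ) V₊` is a curve of admissible generalized pseudometrics; its velocity at `0` is
`GRic`.

Divergences. Two divergences differ by a `C^∞`-linear map, so a divergence is determined by its
values on sections that span every fibre, and local solutions with prescribed values on such
sections glue (`exists_divergence`). For the reduction, a relation between sections downstairs lifts
to a relation upstairs only up to an invariant section of `𝔰_E`. Such a section has divergence zero,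
exactly because `div χ(s) = -Tr ad_s` (`IsEquivariantDivergence.eq_zero_of_mem_χ`).

Reduction. Connectedness of the group turns infinitesimal invariance into invariance under the
group, for functions (`apply_smul_of_lieS`), for the projection to `V₊` (`proj_actTo`) and for
membership in `𝔰_E^⊥` (`mem_perp_smul`). The quotient map is isometric, so it is injective on `V₊`
and its image is non-degenerate; equivariance makes the image independent of the point on the orbit.
A free and proper action has smooth slices, along which vectors spread to invariant sections
(`exists_represents`). Being represented is stable under brackets and projections, so each term of
`GRic` descends, the trace being transported by the isomorphism from `V₊` to its image
(`GRic_reduce`). Finally `⟨P_t a, b⟩` is the same number before and after pullback or reduction, so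
velocities correspond (`hasVelocityAt_pullback`, `hasVelocityAt_reduce`). -/

noncomputable section

namespace Courant

set_option linter.unusedSectionVars false

/-- The smooth sections of `E`. -/
abbrev Sec (EM : Type*) [NormedAddCommGroup EM] [NormedSpace ℝ EM]
    {M : Type*} [TopologicalSpace M] [ChartedSpace EM M]
    (F : Type*) [NormedAddCommGroup F] [NormedSpace ℝ F]
    (E : M → Type*) [∀ x, AddCommGroup (E x)] [∀ x, Module ℝ (E x)]
    [∀ x, TopologicalSpace (E x)] [TopologicalSpace (TotalSpace F E)]
    [FiberBundle F E] [VectorBundle ℝ F E] :=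
  Cₛ^∞⟮𝓘(ℝ, EM); F, E⟯

/-- The smooth real functions on `M`. -/
abbrev Fn (EM : Type*) [NormedAddCommGroup EM] [NormedSpace ℝ EM]
    (M : Type*) [TopologicalSpace M] [ChartedSpace EM M] :=
  C^∞⟮𝓘(ℝ, EM), M; ℝ⟯

/-! ### Directional derivatives, germs and bump functions -/

section DirDeriv

variable {EM : Type*} [NormedAddCommGroup EM] [NormedSpace ℝ EM]
  {M : Type*} [TopologicalSpace M] [ChartedSpace EM M]

lemma dirDeriv_congr {f g : M → ℝ} {x : M} (h : f =ᶠ[𝓝 x] g) (X : TangentSpace 𝓘(ℝ, EM) x) :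
    dirDeriv f x X = dirDeriv g x X := by
  unfold dirDeriv
  rw [h.mfderiv_eq]
  rfl

lemma dirDeriv_const (c : ℝ) (x : M) (X : TangentSpace 𝓘(ℝ, EM) x) :
    dirDeriv (fun _ => c) x X = 0 := by
  rw [dirDeriv, mfderiv_const]; rfl

lemma dirDeriv_of_eventuallyEq_const {f : M → ℝ} {c : ℝ} {x : M} (h : ∀ᶠ y in 𝓝 x, f y = c)
    (X : TangentSpace 𝓘(ℝ, EM) x) : dirDeriv f x X = 0 := by
  rw [dirDeriv_congr (g := fun _ => c) h, dirDeriv_const]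

lemma dirDeriv_add' {f g : M → ℝ} {x : M} (hf : MDifferentiableAt 𝓘(ℝ, EM) 𝓘(ℝ, ℝ) f x)
    (hg : MDifferentiableAt 𝓘(ℝ, EM) 𝓘(ℝ, ℝ) g x) (X : TangentSpace 𝓘(ℝ, EM) x) :
    dirDeriv (fun y => f y + g y) x X = dirDeriv f x X + dirDeriv g x X := by
  unfold dirDeriv
  rw [show (fun y => f y + g y) = f + g from rfl, mfderiv_add hf hg]
  rfl

lemma dirDeriv_mul' {f g : M → ℝ} {x : M} (hf : MDifferentiableAt 𝓘(ℝ, EM) 𝓘(ℝ, ℝ) f x)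
    (hg : MDifferentiableAt 𝓘(ℝ, EM) 𝓘(ℝ, ℝ) g x) (X : TangentSpace 𝓘(ℝ, EM) x) :
    dirDeriv (fun y => f y * g y) x X = f x * dirDeriv g x X + g x * dirDeriv f x X := by
  unfold dirDeriv
  rw [show (fun y => f y * g y) = f * g from rfl, (hf.hasMFDerivAt.mul hg.hasMFDerivAt).mfderiv]
  rfl

lemma dirDeriv_sum' {ι : Type*} (s : Finset ι) {f : ι → M → ℝ} {x : M}
    (hf : ∀ i, MDifferentiableAt 𝓘(ℝ, EM) 𝓘(ℝ, ℝ) (f i) x) (X : TangentSpace 𝓘(ℝ, EM) x) :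
    dirDeriv (fun y => ∑ i ∈ s, f i y) x X = ∑ i ∈ s, dirDeriv (f i) x X := by
  classical
  have key : MDifferentiableAt 𝓘(ℝ, EM) 𝓘(ℝ, ℝ) (fun y => ∑ i ∈ s, f i y) x ∧
      dirDeriv (fun y => ∑ i ∈ s, f i y) x X = ∑ i ∈ s, dirDeriv (f i) x X := by
    induction s using Finset.induction_on with
    | empty => simpa using ⟨mdifferentiableAt_const, dirDeriv_const 0 x X⟩
    | insert a s ha ih =>
      simp only [Finset.sum_insert ha]
      exact ⟨(hf a).add ih.1, by rw [dirDeriv_add' (hf a) ih.1, ih.2]⟩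
  exact key.2

lemma Fn.mdiff (f : Fn EM M) (x : M) : MDifferentiableAt 𝓘(ℝ, EM) 𝓘(ℝ, ℝ) f x :=
  f.contMDiff.mdifferentiableAt (by simp)

lemma dirDeriv_add (f g : Fn EM M) (x : M) (X : TangentSpace 𝓘(ℝ, EM) x) :
    dirDeriv (f + g : Fn EM M) x X = dirDeriv f x X + dirDeriv g x X :=
  dirDeriv_add' (Fn.mdiff f x) (Fn.mdiff g x) X

lemma dirDeriv_mul (f g : Fn EM M) (x : M) (X : TangentSpace 𝓘(ℝ, EM) x) :
    dirDeriv (f * g : Fn EM M) x X = f x * dirDeriv g x X + g x * dirDeriv f x X :=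
  dirDeriv_mul' (Fn.mdiff f x) (Fn.mdiff g x) X

lemma dirDeriv_smul (c : ℝ) (g : Fn EM M) (x : M) (X : TangentSpace 𝓘(ℝ, EM) x) :
    dirDeriv (c • g : Fn EM M) x X = c * dirDeriv g x X := by
  have := dirDeriv_mul' (f := fun _ => c) (x := x) mdifferentiableAt_const (Fn.mdiff g x) X
  rw [dirDeriv_const, mul_zero, add_zero] at this
  exact this

lemma dirDeriv_map_add (f : M → ℝ) (x : M) (X Y : TangentSpace 𝓘(ℝ, EM) x) :
    dirDeriv f x (X + Y) = dirDeriv f x X + dirDeriv f x Y := map_add _ _ _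

lemma dirDeriv_map_smul (f : M → ℝ) (x : M) (c : ℝ) (X : TangentSpace 𝓘(ℝ, EM) x) :
    dirDeriv f x (c • X) = c * dirDeriv f x X := map_smul (mfderiv 𝓘(ℝ, EM) 𝓘(ℝ, ℝ) f x) _ _

lemma dirDeriv_map_zero (f : M → ℝ) (x : M) :
    dirDeriv f x (0 : TangentSpace 𝓘(ℝ, EM) x) = 0 := map_zero (mfderiv 𝓘(ℝ, EM) 𝓘(ℝ, ℝ) f x)

lemma Fn.sum_apply {ι : Type*} (s : Finset ι) (f : ι → Fn EM M) (x : M) :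
    (∑ i ∈ s, f i) x = ∑ i ∈ s, f i x := by
  classical
  induction s using Finset.induction_on with
  | empty => simp
  | insert a s ha ih => simp [Finset.sum_insert ha, ih]

lemma dirDeriv_sum {ι : Type*} (s : Finset ι) (f : ι → Fn EM M) (x : M)
    (X : TangentSpace 𝓘(ℝ, EM) x) :
    dirDeriv (∑ i ∈ s, f i : Fn EM M) x X = ∑ i ∈ s, dirDeriv (f i) x X := by
  rw [← dirDeriv_sum' s fun i => Fn.mdiff (f i) x]
  congr 1
  funext y
  exact Fn.sum_apply s f y

/-- A smooth function near `x` has a globally smooth function with the same germ. -/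
lemma exists_fn_germ [FiniteDimensional ℝ EM] [T2Space M] [IsManifold 𝓘(ℝ, EM) ∞ M]
    {f : M → ℝ} {x : M}
    (hf : ∀ᶠ y in 𝓝 x, ContMDiffAt 𝓘(ℝ, EM) 𝓘(ℝ, ℝ) ∞ f y) : ∃ g : Fn EM M, g =ᶠ[𝓝 x] f := by
  obtain ⟨ψ, -, hψ⟩ := (SmoothBumpFunction.nhds_basis_tsupport (I := 𝓘(ℝ, EM)) x).mem_iff.1 hf
  have h : ContMDiff 𝓘(ℝ, EM) 𝓘(ℝ, ℝ) ∞ (fun y => ψ y • f y) := by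
    refine contMDiff_of_tsupport fun y hy => ?_
    have hy' := hψ (closure_mono (Function.support_smul_subset_left _ _) hy)
    exact (ψ.contMDiff y).smul hy'
  refine ⟨⟨_, h⟩, ?_⟩
  filter_upwards [ψ.eventuallyEq_one] with y hy
  change ψ y • f y = f y
  rw [hy, Pi.one_apply, one_smul]

/-- There are smooth bump functions supported in any given neighbourhood. -/
lemma exists_bump [FiniteDimensional ℝ EM] [T2Space M] [IsManifold 𝓘(ℝ, EM) ∞ M]
    {x : M} {U : Set M} (hU : U ∈ 𝓝 x) :
    ∃ g : Fn EM M, (∀ᶠ y in 𝓝 x, g y = 1) ∧ tsupport g ⊆ U := by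
  obtain ⟨ψ, -, hψ⟩ := (SmoothBumpFunction.nhds_basis_tsupport (I := 𝓘(ℝ, EM)) x).mem_iff.1 hU
  exact ⟨⟨_, ψ.contMDiff⟩, ψ.eventuallyEq_one, hψ⟩

end DirDeriv

/-! ### Calculus of the bracket on smooth sections -/

section Sections

variable {EM : Type*} [NormedAddCommGroup EM] [NormedSpace ℝ EM]
  {M : Type*} [TopologicalSpace M] [ChartedSpace EM M]
  {F : Type*} [NormedAddCommGroup F] [NormedSpace ℝ F]
  {E : M → Type*} [∀ x, AddCommGroup (E x)] [∀ x, Module ℝ (E x)]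
  [∀ x, TopologicalSpace (E x)] [TopologicalSpace (TotalSpace F E)]
  [FiberBundle F E] [VectorBundle ℝ F E]

@[simp] lemma add_sec (u v : Sec EM F E) (x : M) : (u + v) x = u x + v x := rfl
@[simp] lemma sub_sec (u v : Sec EM F E) (x : M) : (u - v) x = u x - v x := rfl
@[simp] lemma zero_sec (x : M) : (0 : Sec EM F E) x = 0 := rfl
@[simp] lemma smul_sec (c : ℝ) (u : Sec EM F E) (x : M) : (c • u) x = c • u x := rfl

lemma fsmul_add (f : Fn EM M) (u v : Sec EM F E) : fsmul f (u + v) = fsmul f u + fsmul f v := by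
  ext x; exact smul_add _ _ _

variable [IsManifold 𝓘(ℝ, EM) ∞ M] (C : CourantAlgebroid EM F E)

namespace CourantAlgebroid

/-- The pairing of two smooth sections. -/
def pairS (u v : Sec EM F E) : Fn EM M :=
  ⟨fun x => C.pairing x (u x) (v x), fun x => C.pairing_smooth _ _ x (u.contMDiff x) (v.contMDiff x)⟩

@[simp] lemma pairS_apply (u v : Sec EM F E) (x : M) :
    C.pairS u v x = C.pairing x (u x) (v x) := rfl

/-- The derivative `u · f` of a smooth function along the anchor of a smooth section. -/
def lieS (u : Sec EM F E) (f : Fn EM M) : Fn EM M :=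
  ⟨fun x => dirDeriv f x (C.anchor x (u x)), fun x => by
    have h1 := C.anchor_smooth u x (u.contMDiff x)
    have h2 : ContMDiff 𝓘(ℝ, EM).tangent 𝓘(ℝ, ℝ).tangent ∞ (tangentMap 𝓘(ℝ, EM) 𝓘(ℝ, ℝ) f) :=
      f.contMDiff.contMDiff_tangentMap (by simp)
    have h3 := (h2 _).comp x h1
    have h4 := (Bundle.contMDiffAt_totalSpace.1 h3).2
    refine h4.congr_of_eventuallyEq ?_
    filter_upwards with y
    simp [tangentMap, dirDeriv]
    rfl⟩

@[simp] lemma lieS_apply (u : Sec EM F E) (f : Fn EM M) (x : M) :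
    C.lieS u f x = dirDeriv f x (C.anchor x (u x)) := rfl

lemma lieS_add (u : Sec EM F E) (f g : Fn EM M) : C.lieS u (f + g) = C.lieS u f + C.lieS u g := by
  ext x; exact dirDeriv_add f g x _

lemma lieS_mul (u : Sec EM F E) (f g : Fn EM M) :
    C.lieS u (f * g) = f * C.lieS u g + g * C.lieS u f := by
  ext x; exact dirDeriv_mul f g x _

lemma lieS_smul (u : Sec EM F E) (c : ℝ) (g : Fn EM M) :
    C.lieS u (c • g) = c • C.lieS u g := by
  ext x; exact dirDeriv_smul c g x _

lemma lieS_sum {ι : Type*} (s : Finset ι) (u : Sec EM F E) (f : ι → Fn EM M) :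
    C.lieS u (∑ i ∈ s, f i) = ∑ i ∈ s, C.lieS u (f i) := by
  ext x
  rw [Fn.sum_apply]
  exact dirDeriv_sum s f x _

lemma bracket_fsmul (u : Sec EM F E) (f : Fn EM M) (v : Sec EM F E) :
    C.bracket u (fsmul f v) = fsmul f (C.bracket u v) + fsmul (C.lieS u f) v := by
  ext x; exact C.leibniz u f v x

lemma lieS_pairS (u v w : Sec EM F E) :
    C.lieS u (C.pairS v w) = C.pairS (C.bracket u v) w + C.pairS v (C.bracket u w) := by
  ext x; exact C.invariant u v w x

end CourantAlgebroid

section Ext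
variable [FiniteDimensional ℝ EM] [T2Space M] [FiniteDimensional ℝ F]
  [ContMDiffVectorBundle ∞ F E 𝓘(ℝ, EM)]

namespace CourantAlgebroid

lemma ext_pairing {x : M} {a b : E x}
    (h : ∀ w : Sec EM F E, C.pairing x a (w x) = C.pairing x b (w x)) : a = b := by
  refine sub_eq_zero.1 (C.pairing_nondegenerate x _ fun w => ?_)
  obtain ⟨W, rfl⟩ := exists_section (EM := EM) (F := F) x w
  rw [map_sub, LinearMap.sub_apply, h, sub_self]

/-- The symmetric part of the bracket is the differential of the pairing, which vanishes for
orthogonal sections. Since `V₊ ⊥ V₋`, this applies to all mixed brackets in `GRic`. -/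
lemma bracket_skew {u v : Sec EM F E} (h : ∀ x, C.pairing x (u x) (v x) = 0) :
    C.bracket u v = - C.bracket v u := by
  ext x
  refine eq_neg_of_add_eq_zero_left (C.pairing_nondegenerate x _ fun w => ?_)
  obtain ⟨W, rfl⟩ := exists_section (EM := EM) (F := F) x w
  rw [C.pairing_symm]
  refine (C.bracket_add_swap u v W x).trans ?_
  exact dirDeriv_of_eventuallyEq_const (c := 0) (Eventually.of_forall h) _

/-- The anchor is a morphism of brackets. -/
lemma lieS_bracket (u v : Sec EM F E) (f : Fn EM M) :
    C.lieS (C.bracket u v) f = C.lieS u (C.lieS v f) - C.lieS v (C.lieS u f) := by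
  ext x
  -- The argument reads off the coefficient of a section that does not vanish at `x`. Over a zero
  -- fibre no such section exists, but there every anchor is zero.
  by_cases hE : ∀ w : E x, w = 0
  · have h0 : ∀ (w : Sec EM F E) (g : Fn EM M), C.lieS w g x = 0 := by
      intro w g
      rw [lieS_apply, hE (w x), map_zero, dirDeriv_map_zero]
    change _ = C.lieS u (C.lieS v f) x - C.lieS v (C.lieS u f) x
    rw [h0, h0, h0, sub_zero]
  · push Not at hE
    obtain ⟨w₀, hw₀⟩ := hE
    obtain ⟨w, rfl⟩ := exists_section (EM := EM) (F := F) x w₀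
    -- The failure of the Jacobi identity to be linear in its last entry: once the identity for `w`
    -- is inserted and the mixed terms cancel, what is left is the claim multiplied by `w`.
    have h := C.jacobi u v (fsmul f w)
    simp only [bracket_fsmul, map_add, C.jacobi u v w] at h
    have h' := congrArg (fun z : Sec EM F E => z x) h
    simp only [add_sec, fsmul_apply] at h'
    have h2 : (C.lieS (C.bracket u v) f x - (C.lieS u (C.lieS v f) x - C.lieS v (C.lieS u f) x)) •
        w x = 0 := by
      rw [← sub_eq_zero] at h'
      rw [← neg_eq_zero]
      refine Eq.trans ?_ h'
      module
    exact sub_eq_zero.1 ((smul_eq_zero.1 h2).resolve_right hw₀)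

end CourantAlgebroid
end Ext

end Sections

/-! ### Dual frames, traces and tensoriality -/

section Frames

variable {EM : Type*} [NormedAddCommGroup EM] [NormedSpace ℝ EM]
  {M : Type*} [TopologicalSpace M] [ChartedSpace EM M]
  {F : Type*} [NormedAddCommGroup F] [NormedSpace ℝ F]
  {E : M → Type*} [∀ x, AddCommGroup (E x)] [∀ x, Module ℝ (E x)]
  [∀ x, TopologicalSpace (E x)] [TopologicalSpace (TotalSpace F E)]
  [FiberBundle F E] [VectorBundle ℝ F E] [IsManifold 𝓘(ℝ, EM) ∞ M]
  (C : CourantAlgebroid EM F E)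

/-- Sections `e i` that form a basis near `x₀`, with the dual sections `t i` cut off by a bump
function `p`, so that `p u = ∑ ⟨u, t i⟩ e i` globally. -/
structure DualFrame (x₀ : M) (ι : Type*) [Fintype ι] [DecidableEq ι] where
  /-- the frame -/
  e : ι → Sec EM F E
  /-- the dual frame -/
  t : ι → Sec EM F E
  /-- the cutoff -/
  p : Fn EM M
  p_one : ∀ᶠ y in 𝓝 x₀, p y = 1
  sum : ∀ y (v : E y), p y • v = ∑ i, C.pairing y v (t i y) • e i y
  dual : ∀ᶠ y in 𝓝 x₀, ∀ i j, C.pairing y (e i y) (t j y) = if i = j then 1 else 0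

variable {C}

lemma DualFrame.p_one_self {x₀ : M} {ι : Type*} [Fintype ι] [DecidableEq ι]
    (B : DualFrame C x₀ ι) : B.p x₀ = 1 := B.p_one.self_of_nhds

lemma DualFrame.sum_of_p_one {x₀ : M} {ι : Type*} [Fintype ι] [DecidableEq ι]
    (B : DualFrame C x₀ ι) {y : M} (hy : B.p y = 1) (v : E y) :
    v = ∑ i, C.pairing y v (B.t i y) • B.e i y := by
  rw [← B.sum, hy, one_smul]

/-- Brackets and divergences act on global sections only. The cutoff turns the local expansion in a
frame into an identity of global sections, to which they can be applied; the cutoff then disappears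
because it is `1` near the point, so that its derivatives vanish there. -/
lemma DualFrame.fsmul_p {x₀ : M} {ι : Type*} [Fintype ι] [DecidableEq ι]
    (B : DualFrame C x₀ ι) (u : Sec EM F E) :
    fsmul B.p u = ∑ i, fsmul (C.pairS u (B.t i)) (B.e i) := by
  ext y
  rw [sum_apply]
  exact B.sum y (u y)

/-- The trace in terms of a frame and the dual frame. -/
lemma trace_eq_sum {V : Type*} [AddCommGroup V] [Module ℝ V] [FiniteDimensional ℝ V]
    (β : LinearMap.BilinForm ℝ V) {ι : Type*} [Fintype ι] (e t : ι → V)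
    (h : ∀ v, v = ∑ i, β v (t i) • e i) (T : V →ₗ[ℝ] V) :
    LinearMap.trace ℝ V T = ∑ i, β (T (e i)) (t i) := by
  have hT : T = ∑ i, (β.flip (t i)).smulRight (T (e i)) := by
    ext v
    conv_lhs => rw [h v, map_sum]
    rw [LinearMap.sum_apply]
    simp
  conv_lhs => rw [hT, map_sum]
  refine Finset.sum_congr rfl fun i _ => ?_
  rw [LinearMap.trace_smulRight]
  rfl

variable [FiniteDimensional ℝ EM] [T2Space M] [FiniteDimensional ℝ F]
  [ContMDiffVectorBundle ∞ F E 𝓘(ℝ, EM)]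

variable (C) in
lemma exists_dual_vectors {x : M} {ι : Type*} [Fintype ι] [DecidableEq ι] (e : ι → E x)
    (he : LinearIndependent ℝ e) :
    ∃ t : ι → E x, ∀ i j, C.pairing x (e i) (t j) = if i = j then 1 else 0 := by
  have : FiniteDimensional ℝ (E x) := VectorBundle.finiteDimensional ℝ F E x
  obtain ⟨g, hg⟩ := LinearMap.exists_leftInverse_of_injective (Fintype.linearCombination ℝ e)
    (LinearMap.ker_eq_bot.2 he.fintypeLinearCombination_injective)
  have hnd : (C.pairing x).Nondegenerate :=
    ⟨fun a h => C.pairing_nondegenerate x a h, fun a h => C.pairing_nondegenerate x a fun b => by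
      rw [C.pairing_symm]; exact h b⟩
  refine ⟨fun j => ((C.pairing x).toDual hnd).symm (LinearMap.proj j ∘ₗ g), fun i j => ?_⟩
  rw [C.pairing_symm, ← LinearMap.BilinForm.toDual_def hnd, LinearEquiv.apply_symm_apply]
  have h1 := LinearMap.congr_fun hg (Pi.single i 1)
  simp only [LinearMap.comp_apply, Fintype.linearCombination_apply_single, one_smul,
    LinearMap.id_apply] at h1
  simp [h1, Pi.single_apply, eq_comm]

variable (C) in
/-- Sections that are linearly independent at `x₀` have dual sections near `x₀`. -/
lemma exists_dual_sections {x₀ : M} {ι : Type*} [Fintype ι] [DecidableEq ι] (e : ι → Sec EM F E)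
    (he : LinearIndependent ℝ fun i => e i x₀) :
    ∃ (t : ι → Sec EM F E) (p : Fn EM M), (∀ᶠ y in 𝓝 x₀, p y = 1) ∧
      ∀ y i j, C.pairing y (e i y) (t j y) = if i = j then p y else 0 := by
  obtain ⟨τ, hτ⟩ := exists_dual_vectors C _ he
  choose T hT using fun j => exists_section (EM := EM) (F := F) x₀ (τ j)
  let G : Matrix ι ι (Fn EM M) := Matrix.of fun i j => C.pairS (e i) (T j)
  -- The adjugate of the Gram matrix gives dual sections up to the factor `det G`, with coefficients
  -- that are smooth everywhere. The division by `det G`, which is `1` at `x₀`, is done afterwards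
  -- and only on germs.
  let t' : ι → Sec EM F E := fun j => ∑ k, fsmul (G.adjugate k j) (T k)
  have ht' : ∀ y i j, C.pairing y (e i y) (t' j y) = if i = j then G.det y else 0 := by
    intro y i j
    have h1 := congrArg (fun A : Matrix ι ι (Fn EM M) => A i j y) (Matrix.mul_adjugate G)
    simp only [Matrix.mul_apply, Fn.sum_apply, Matrix.smul_apply, smul_eq_mul,
      Matrix.one_apply] at h1
    simp only [t', sum_apply, fsmul_apply, map_sum, map_smul, smul_eq_mul]
    refine Eq.trans (Finset.sum_congr rfl fun k _ => ?_) (h1.trans ?_)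
    · exact mul_comm _ _
    · split_ifs <;> simp
  have hdet : G.det x₀ = 1 := by
    have h1 : G.det x₀ = ((ContMDiffMap.evalRingHom x₀ : Fn EM M →+* ℝ).mapMatrix G).det :=
      
      RingHom.map_det (ContMDiffMap.evalRingHom x₀ : Fn EM M →+* ℝ) G
    have h2 : (ContMDiffMap.evalRingHom x₀ : Fn EM M →+* ℝ).mapMatrix G = 1 := by
      ext i j
      change C.pairing x₀ (e i x₀) (T j x₀) = _
      rw [hT, hτ, Matrix.one_apply]
    rw [h1, h2, Matrix.det_one]
  have hne : ∀ᶠ y in 𝓝 x₀, G.det y ≠ 0 :=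
    G.det.contMDiff.continuous.continuousAt.eventually_ne (by rw [hdet]; exact one_ne_zero)
  obtain ⟨f, hf⟩ := exists_fn_germ (EM := EM) (f := fun y => (G.det y)⁻¹) (x := x₀) (by
    filter_upwards [hne] with y hy
    exact (G.det.contMDiff y).inv₀ hy)
  refine ⟨fun j => fsmul f (t' j), f * G.det, ?_, fun y i j => ?_⟩
  · filter_upwards [hf, hne] with y hy hy'
    change f y * G.det y = 1
    rw [hy, inv_mul_cancel₀ hy']
  · rw [fsmul_apply, map_smul, ht']
    split_ifs
    · rfl
    · exact smul_zero _

variable (C) in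
/-- Sections that form a basis at `x₀` are part of a dual frame at `x₀`. -/
lemma exists_dualFrame_of_basis {x₀ : M} {ι : Type*} [Fintype ι] [DecidableEq ι]
    (e : ι → Sec EM F E) (he : LinearIndependent ℝ fun i => e i x₀)
    (hcard : Fintype.card ι = Module.finrank ℝ F) : ∃ B : DualFrame C x₀ ι, B.e = e := by
  obtain ⟨t, p, hp, ht⟩ := exists_dual_sections C e he
  -- The support of `ψ` lies where `p = 1`, so the expansion holds with factor `ψ` at every point:
  -- either `ψ` vanishes, or the frame and its dual are honest bases.
  obtain ⟨ψ, hψ, hsupp⟩ := exists_bump (EM := EM) hp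
  refine ⟨⟨e, fun i => fsmul ψ (t i), ψ, hψ, fun y v => ?_, ?_⟩, rfl⟩
  · by_cases hy : ψ y = 0
    · simp [hy]
    · have hpy : p y = 1 := hsupp (subset_tsupport _ hy)
      have : FiniteDimensional ℝ (E y) := VectorBundle.finiteDimensional ℝ F E y
      have hli : LinearIndependent ℝ fun i => e i y := by
        rw [Fintype.linearIndependent_iff]
        intro c hc j
        have := congrArg (fun w => C.pairing y w (t j y)) hc
        simpa [map_sum, ht, hpy] using this
      have hspan : v ∈ Submodule.span ℝ (Set.range fun i => e i y) := by
        rw [hli.span_eq_top_of_card_eq_finrank' (by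
          rw [hcard]
          exact (VectorBundle.finrank_eq ℝ F E y).symm)]
        trivial
      obtain ⟨c, hc⟩ := (Submodule.mem_span_range_iff_exists_fun ℝ).1 hspan
      rw [← hc, Finset.smul_sum]
      refine Finset.sum_congr rfl fun i _ => ?_
      simp [map_sum, ht, hpy, smul_smul]
  · filter_upwards [hp, hψ] with y hy hy' i j
    rw [fsmul_apply, map_smul, ht, hy, hy', one_smul]

variable (C) in
lemma exists_dualFrame (x₀ : M) : Nonempty (DualFrame C x₀ (Fin (Module.finrank ℝ F))) := by
  have : FiniteDimensional ℝ (E x₀) := VectorBundle.finiteDimensional ℝ F E x₀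
  let b := Module.finBasisOfFinrankEq ℝ (E x₀) (VectorBundle.finrank_eq ℝ F E x₀)
  choose e he using fun i => exists_section (EM := EM) (F := F) x₀ (b i)
  obtain ⟨B, -⟩ := exists_dualFrame_of_basis C e (x₀ := x₀)
    (by simp only [he]; exact b.linearIndependent) (by simp)
  exact ⟨B⟩

variable (C) in
/-- The standard dual frame at a point. -/
def dualFrame (x₀ : M) : DualFrame C x₀ (Fin (Module.finrank ℝ F)) := (exists_dualFrame C x₀).some

/-- A `C^∞(M)`-linear map from sections to functions acts pointwise. -/
lemma tensorial_fn (C : CourantAlgebroid EM F E) (φ : Sec EM F E →ₗ[ℝ] Fn EM M)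
    (hφ : ∀ (f : Fn EM M) (u : Sec EM F E) (x : M), φ (fsmul f u) x = f x * φ u x)
    {u v : Sec EM F E} {x : M} (huv : u x = v x) : φ u x = φ v x := by
  have key : ∀ w : Sec EM F E, w x = 0 → φ w x = 0 := by
    intro w hw
    have h1 := congrArg (fun z => φ z x) ((dualFrame C x).fsmul_p w)
    simp only [map_sum, Fn.sum_apply, hφ, CourantAlgebroid.pairS_apply, hw, map_zero,
      LinearMap.zero_apply, zero_mul, Finset.sum_const_zero, (dualFrame C x).p_one_self, one_mul] at h1
    exact h1
  have := key (u - v) (by rw [sub_sec, huv, sub_self])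
  rw [map_sub] at this
  exact sub_eq_zero.1 this

/-- The trace of a tensorial operator in terms of a dual frame. -/
lemma trace_pointwise (Φ : Sec EM F E →ₗ[ℝ] Sec EM F E)
    (hΦ : ∀ (f : Fn EM M) (u : Sec EM F E), Φ (fsmul f u) = fsmul f (Φ u))
    {x₀ : M} {ι : Type*} [Fintype ι] [DecidableEq ι] (B : DualFrame C x₀ ι) {x : M}
    (hx : B.p x = 1) :
    LinearMap.trace ℝ (E x) (pointwise Φ hΦ x) = ∑ i, C.pairing x (Φ (B.e i) x) (B.t i x) := by
  have : FiniteDimensional ℝ (E x) := VectorBundle.finiteDimensional ℝ F E x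
  rw [trace_eq_sum (C.pairing x) (fun i => B.e i x) (fun i => B.t i x)
    (fun v => B.sum_of_p_one hx v)]
  simp only [pointwise_apply]

end Frames

/-! ### Smooth sections along a map -/

section Along

variable {EM : Type*} [NormedAddCommGroup EM] [NormedSpace ℝ EM]
  {M : Type*} [TopologicalSpace M] [ChartedSpace EM M]
  {F : Type*} [NormedAddCommGroup F] [NormedSpace ℝ F]
  {E : M → Type*} [∀ x, AddCommGroup (E x)] [∀ x, Module ℝ (E x)]
  [∀ x, TopologicalSpace (E x)] [TopologicalSpace (TotalSpace F E)]
  [FiberBundle F E] [VectorBundle ℝ F E] [IsManifold 𝓘(ℝ, EM) ∞ M]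
  {EN HN : Type*} [NormedAddCommGroup EN] [NormedSpace ℝ EN] [TopologicalSpace HN]
  (J : ModelWithCorners ℝ EN HN) {N : Type*} [TopologicalSpace N] [ChartedSpace HN N]

variable (EM F) in
/-- The section `ξ` of `E` along the map `f` is smooth at `n₀`. -/
def SmoothAlongAt (f : N → M) (ξ : ∀ n, E (f n)) (n₀ : N) : Prop :=
  ContMDiffAt J (𝓘(ℝ, EM).prod 𝓘(ℝ, F)) ∞ (fun n => TotalSpace.mk' F (f n) (ξ n)) n₀

variable {J} {f : N → M} {n₀ : N}

lemma SmoothAlongAt.base {ξ : ∀ n, E (f n)} (h : SmoothAlongAt EM F J f ξ n₀) :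
    ContMDiffAt J 𝓘(ℝ, EM) ∞ f n₀ := (contMDiffAt_totalSpace.1 h).1

lemma SmoothAlongAt.sum {ι : Type*} {s : Finset ι} (hf : ContMDiffAt J 𝓘(ℝ, EM) ∞ f n₀)
    {c : ι → N → ℝ} {ξ : ι → ∀ n, E (f n)} (hc : ∀ i ∈ s, ContMDiffAt J 𝓘(ℝ, ℝ) ∞ (c i) n₀)
    (hξ : ∀ i ∈ s, SmoothAlongAt EM F J f (ξ i) n₀) :
    SmoothAlongAt EM F J f (fun n => ∑ i ∈ s, c i n • ξ i n) n₀ := by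
  refine contMDiffAt_totalSpace.2 ⟨hf, ?_⟩
  have h1 : ContMDiffAt J 𝓘(ℝ, F) ∞ (fun n => ∑ i ∈ s, c i n •
      (trivializationAt F E (f n₀) (TotalSpace.mk' F (f n) (ξ i n))).2) n₀ :=
    ContMDiffAt.sum fun i hi => (hc i hi).smul (contMDiffAt_totalSpace.1 (hξ i hi)).2
  refine h1.congr_of_eventuallyEq ?_
  have h2 : ∀ᶠ n in 𝓝 n₀, f n ∈ (trivializationAt F E (f n₀)).baseSet :=
    hf.continuousAt.eventually_mem ((trivializationAt F E (f n₀)).open_baseSet.mem_nhds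
      (FiberBundle.mem_baseSet_trivializationAt F E _))
  filter_upwards [h2] with n hn
  have hl : ∀ v : E (f n), (trivializationAt F E (f n₀) (TotalSpace.mk' F (f n) v)).2 =
      (trivializationAt F E (f n₀)).linearEquivAt ℝ (f n) hn v := fun v => rfl
  simp only [hl, map_sum, map_smul]

lemma SmoothAlongAt.smul {c : N → ℝ} {ξ : ∀ n, E (f n)} (hc : ContMDiffAt J 𝓘(ℝ, ℝ) ∞ c n₀)
    (hξ : SmoothAlongAt EM F J f ξ n₀) : SmoothAlongAt EM F J f (fun n => c n • ξ n) n₀ := by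
  have := SmoothAlongAt.sum (s := (Finset.univ : Finset Unit)) hξ.base (c := fun _ => c)
    (ξ := fun _ => ξ) (fun _ _ => hc) (fun _ _ => hξ)
  simpa using this

lemma SmoothAlongAt.of_section (hf : ContMDiffAt J 𝓘(ℝ, EM) ∞ f n₀) (u : Sec EM F E) :
    SmoothAlongAt EM F J f (fun n => u (f n)) n₀ :=
  (u.contMDiff (f n₀)).comp n₀ hf

lemma SmoothAlongAt.congr {ξ η : ∀ n, E (f n)} (h : SmoothAlongAt EM F J f ξ n₀)
    (heq : ∀ᶠ n in 𝓝 n₀, η n = ξ n) : SmoothAlongAt EM F J f η n₀ := by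
  refine ContMDiffAt.congr_of_eventuallyEq h ?_
  filter_upwards [heq] with n hn
  rw [hn]

lemma SmoothAlongAt.comp {EN' HN' : Type*} [NormedAddCommGroup EN'] [NormedSpace ℝ EN']
    [TopologicalSpace HN'] {J' : ModelWithCorners ℝ EN' HN'} {N' : Type*} [TopologicalSpace N']
    [ChartedSpace HN' N'] {ξ : ∀ n, E (f n)} {g : N' → N} {n' : N'}
    (h : SmoothAlongAt EM F J f ξ (g n')) (hg : ContMDiffAt J' J ∞ g n') :
    SmoothAlongAt EM F J' (fun n => f (g n)) (fun n => ξ (g n)) n' :=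
  ContMDiffAt.comp n' (g := fun n => TotalSpace.mk' F (f n) (ξ n)) h hg

variable (C : CourantAlgebroid EM F E) [FiniteDimensional ℝ EM] [T2Space M]
  [FiniteDimensional ℝ F] [ContMDiffVectorBundle ∞ F E 𝓘(ℝ, EM)]

/-- The axiom `pairing_smooth` concerns sections over `M`. Expanding `ξ` in a local frame of a
trivialization, with coefficients smooth in `n`, reduces the claim to it. -/
lemma SmoothAlongAt.pairing_section {ξ : ∀ n, E (f n)} (h : SmoothAlongAt EM F J f ξ n₀)
    (u : Sec EM F E) :
    ContMDiffAt J 𝓘(ℝ, ℝ) ∞ (fun n => C.pairing (f n) (ξ n) (u (f n))) n₀ := by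
  let t := trivializationAt F E (f n₀)
  let b := Module.finBasis ℝ F
  have hx : f n₀ ∈ t.baseSet := FiberBundle.mem_baseSet_trivializationAt F E (f n₀)
  have hbase : ∀ᶠ n in 𝓝 n₀, f n ∈ t.baseSet :=
    h.base.continuousAt.eventually_mem (t.open_baseSet.mem_nhds hx)
  have h1 : ∀ i, ContMDiffAt J 𝓘(ℝ, ℝ) ∞
      (fun n => b.repr (t (TotalSpace.mk' F (f n) (ξ n))).2 i) n₀ := fun i =>
    ContMDiffAt.comp n₀ ((b.coord i).toContinuousLinearMap.contMDiff.contMDiffAt)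
      (contMDiffAt_totalSpace.1 h).2
  have h2 : ∀ i, ContMDiffAt J 𝓘(ℝ, ℝ) ∞
      (fun n => C.pairing (f n) (t.localFrame b i (f n)) (u (f n))) n₀ := fun i =>
    ContMDiffAt.comp n₀ (C.pairing_smooth _ _ (f n₀)
      (contMDiffAt_localFrame_of_mem ∞ t b i hx) (u.contMDiff _)) h.base
  have h3 : ContMDiffAt J 𝓘(ℝ, ℝ) ∞ (fun n => ∑ i, b.repr (t (TotalSpace.mk' F (f n) (ξ n))).2 i *
      C.pairing (f n) (t.localFrame b i (f n)) (u (f n))) n₀ :=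
    ContMDiffAt.sum fun i _ => (h1 i).mul (h2 i)
  refine h3.congr_of_eventuallyEq ?_
  filter_upwards [hbase] with n hn
  have h4 : ξ n = ∑ i, b.repr (t (TotalSpace.mk' F (f n) (ξ n))).2 i • t.localFrame b i (f n) := by
    have h5 := (t.basisAt b hn).sum_repr (ξ n)
    conv_lhs => rw [← h5]
    refine Finset.sum_congr rfl fun i _ => ?_
    rw [t.localFrame_apply_of_mem_baseSet b hn]
    rfl
  conv_lhs => rw [h4]
  simp [map_sum]

/-- A section along a map is smooth if its pairings with sections are smooth. -/
lemma smoothAlongAt_of_pairing {ξ : ∀ n, E (f n)} (hf : ContMDiffAt J 𝓘(ℝ, EM) ∞ f n₀)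
    (h : ∀ u : Sec EM F E,
      ContMDiffAt J 𝓘(ℝ, ℝ) ∞ (fun n => C.pairing (f n) (ξ n) (u (f n))) n₀) :
    SmoothAlongAt EM F J f ξ n₀ := by
  let B := dualFrame C (f n₀)
  refine (SmoothAlongAt.sum (s := Finset.univ) hf (fun i _ => h (B.t i))
    (fun i _ => SmoothAlongAt.of_section hf (B.e i))).congr ?_
  filter_upwards [hf.continuousAt.eventually B.p_one] with n hn
  exact B.sum_of_p_one hn _

lemma SmoothAlongAt.pairing {ξ η : ∀ n, E (f n)} (h : SmoothAlongAt EM F J f ξ n₀)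
    (h' : SmoothAlongAt EM F J f η n₀) :
    ContMDiffAt J 𝓘(ℝ, ℝ) ∞ (fun n => C.pairing (f n) (ξ n) (η n)) n₀ := by
  let B := dualFrame C (f n₀)
  have h1 : ContMDiffAt J 𝓘(ℝ, ℝ) ∞ (fun n => ∑ i, C.pairing (f n) (ξ n) (B.t i (f n)) *
      C.pairing (f n) (η n) (B.e i (f n))) n₀ :=
    ContMDiffAt.sum fun i _ => (h.pairing_section C (B.t i)).mul (h'.pairing_section C (B.e i))
  refine h1.congr_of_eventuallyEq ?_
  filter_upwards [h.base.continuousAt.eventually B.p_one] with n hn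
  conv_lhs => rw [B.sum_of_p_one hn (ξ n)]
  simp only [map_sum, map_smul, LinearMap.sum_apply, LinearMap.smul_apply, smul_eq_mul]
  exact Finset.sum_congr rfl fun i _ => by rw [C.pairing_symm _ (B.e i (f n))]

/-- A fibrewise linear map that preserves smoothness of sections preserves smoothness along
maps. -/
lemma SmoothAlongAt.map (C : CourantAlgebroid EM F E) {ξ : ∀ n, E (f n)} (h : SmoothAlongAt EM F J f ξ n₀)
    (T : ∀ x, E x →ₗ[ℝ] E x)
    (hT : ∀ u : Sec EM F E, ∃ v : Sec EM F E, ∀ x, v x = T x (u x)) :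
    SmoothAlongAt EM F J f (fun n => T (f n) (ξ n)) n₀ := by
  let B := dualFrame C (f n₀)
  choose S hS using hT
  refine (SmoothAlongAt.sum (s := Finset.univ) h.base (fun i _ => h.pairing_section C (B.t i))
    (fun i _ => SmoothAlongAt.of_section h.base (S (B.e i)))).congr ?_
  filter_upwards [h.base.continuousAt.eventually B.p_one] with n hn
  conv_lhs => rw [B.sum_of_p_one hn (ξ n), map_sum]
  simp only [map_smul, hS]

end Along

/-! ### The generalized Ricci tensor: traces, tensoriality and invariance -/

section Ricci

variable {EM : Type*} [NormedAddCommGroup EM] [NormedSpace ℝ EM]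
  {M : Type*} [TopologicalSpace M] [ChartedSpace EM M]
  {F : Type*} [NormedAddCommGroup F] [NormedSpace ℝ F]
  {E : M → Type*} [∀ x, AddCommGroup (E x)] [∀ x, Module ℝ (E x)]
  [∀ x, TopologicalSpace (E x)] [TopologicalSpace (TotalSpace F E)]
  [FiberBundle F E] [VectorBundle ℝ F E] [IsManifold 𝓘(ℝ, EM) ∞ M]
  {C : CourantAlgebroid EM F E}
  [FiniteDimensional ℝ EM] [T2Space M] [FiniteDimensional ℝ F]
  [ContMDiffVectorBundle ∞ F E 𝓘(ℝ, EM)]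

/-! ### Traces of tensorial operators -/

section Trace

/-- The trace of a tensorial operator on sections, as a function on `M`. -/
def trS (C : CourantAlgebroid EM F E) (Φ : Sec EM F E →ₗ[ℝ] Sec EM F E)
    (hΦ : ∀ (f : Fn EM M) (u : Sec EM F E), Φ (fsmul f u) = fsmul f (Φ u)) : Fn EM M :=
  ⟨fun x => LinearMap.trace ℝ (E x) (pointwise Φ hΦ x), fun x₀ => by
    let B := dualFrame C x₀
    have h : ContMDiffAt 𝓘(ℝ, EM) 𝓘(ℝ, ℝ) ∞
        (∑ i, C.pairS (Φ (B.e i)) (B.t i) : Fn EM M) x₀ := ContMDiffMap.contMDiff _ x₀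
    refine h.congr_of_eventuallyEq ?_
    filter_upwards [B.p_one] with x hx
    rw [trace_pointwise Φ hΦ B hx, Fn.sum_apply]
    rfl⟩

lemma trS_eventuallyEq (Φ : Sec EM F E →ₗ[ℝ] Sec EM F E)
    (hΦ : ∀ (f : Fn EM M) (u : Sec EM F E), Φ (fsmul f u) = fsmul f (Φ u)) {x₀ : M}
    {ι : Type*} [Fintype ι] [DecidableEq ι] (B : DualFrame C x₀ ι) :
    trS C Φ hΦ =ᶠ[𝓝 x₀] (∑ i, C.pairS (Φ (B.e i)) (B.t i) : Fn EM M) := by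
  filter_upwards [B.p_one] with x hx
  rw [Fn.sum_apply]
  exact trace_pointwise Φ hΦ B hx

lemma trS_apply_sum (Φ : Sec EM F E →ₗ[ℝ] Sec EM F E)
    (hΦ : ∀ (f : Fn EM M) (u : Sec EM F E), Φ (fsmul f u) = fsmul f (Φ u)) {x₀ : M}
    {ι : Type*} [Fintype ι] [DecidableEq ι] (B : DualFrame C x₀ ι) :
    trS C Φ hΦ x₀ = ∑ i, C.pairing x₀ (Φ (B.e i) x₀) (B.t i x₀) :=
  trace_pointwise Φ hΦ B B.p_one_self

lemma trS_add {Φ Φ₁ Φ₂ : Sec EM F E →ₗ[ℝ] Sec EM F E}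
    {hΦ : ∀ (f : Fn EM M) (u : Sec EM F E), Φ (fsmul f u) = fsmul f (Φ u)}
    {hΦ₁ : ∀ (f : Fn EM M) (u : Sec EM F E), Φ₁ (fsmul f u) = fsmul f (Φ₁ u)}
    {hΦ₂ : ∀ (f : Fn EM M) (u : Sec EM F E), Φ₂ (fsmul f u) = fsmul f (Φ₂ u)}
    (h : Φ = Φ₁ + Φ₂) : trS C Φ hΦ = trS C Φ₁ hΦ₁ + trS C Φ₂ hΦ₂ := by
  ext x
  change _ = trS C Φ₁ hΦ₁ x + trS C Φ₂ hΦ₂ x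
  rw [trS_apply_sum _ _ (dualFrame C x), trS_apply_sum _ _ (dualFrame C x),
    trS_apply_sum _ _ (dualFrame C x), ← Finset.sum_add_distrib, h]
  refine Finset.sum_congr rfl fun i _ => ?_
  rw [LinearMap.add_apply, add_sec, map_add, LinearMap.add_apply]

lemma trS_smul {Φ Φ₁ : Sec EM F E →ₗ[ℝ] Sec EM F E} {c : ℝ}
    {hΦ : ∀ (f : Fn EM M) (u : Sec EM F E), Φ (fsmul f u) = fsmul f (Φ u)}
    {hΦ₁ : ∀ (f : Fn EM M) (u : Sec EM F E), Φ₁ (fsmul f u) = fsmul f (Φ₁ u)}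
    (h : Φ = c • Φ₁) : trS C Φ hΦ = c • trS C Φ₁ hΦ₁ := by
  ext x
  change _ = c * trS C Φ₁ hΦ₁ x
  rw [trS_apply_sum _ _ (dualFrame C x), trS_apply_sum _ _ (dualFrame C x), Finset.mul_sum, h]
  refine Finset.sum_congr rfl fun i _ => ?_
  rw [LinearMap.smul_apply, smul_sec, map_smul, LinearMap.smul_apply, smul_eq_mul]

/-- The trace of `g Φ' + ℓ ⊗ z` is `g Tr Φ' + ℓ(z)`. -/
lemma trS_rankOne {Φ Φ' : Sec EM F E →ₗ[ℝ] Sec EM F E}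
    {hΦ : ∀ (f : Fn EM M) (u : Sec EM F E), Φ (fsmul f u) = fsmul f (Φ u)}
    {hΦ' : ∀ (f : Fn EM M) (u : Sec EM F E), Φ' (fsmul f u) = fsmul f (Φ' u)}
    (g : Fn EM M) (ℓ : Sec EM F E →ₗ[ℝ] Fn EM M)
    (hℓ : ∀ (f : Fn EM M) (u : Sec EM F E) (x : M), ℓ (fsmul f u) x = f x * ℓ u x)
    (z : Sec EM F E) (h : ∀ u, Φ u = fsmul g (Φ' u) + fsmul (ℓ u) z) :
    trS C Φ hΦ = g * trS C Φ' hΦ' + ℓ z := by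
  ext x
  change _ = g x * trS C Φ' hΦ' x + ℓ z x
  let B := dualFrame C x
  -- The rank one term contributes `∑ ℓ(e_i) ⟨z, t_i⟩`, which is `ℓ(z)` by the expansion of `z` in
  -- the frame.
  have h1 := congrArg (fun w => ℓ w x) (B.fsmul_p z)
  simp only [map_sum, Fn.sum_apply, hℓ, B.p_one_self, one_mul, CourantAlgebroid.pairS_apply] at h1
  rw [trS_apply_sum _ _ B, trS_apply_sum _ _ B, h1, Finset.mul_sum, ← Finset.sum_add_distrib]
  refine Finset.sum_congr rfl fun i _ => ?_
  rw [h, add_sec, fsmul_apply, fsmul_apply, map_add, LinearMap.add_apply, map_smul, map_smul,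
    LinearMap.smul_apply, LinearMap.smul_apply, smul_eq_mul, smul_eq_mul]
  ring

/-- The derivative of the trace of `Φ` is the trace of the derivative of `Φ`. -/
lemma lieS_trS {Φ Φ' : Sec EM F E →ₗ[ℝ] Sec EM F E}
    {hΦ : ∀ (f : Fn EM M) (u : Sec EM F E), Φ (fsmul f u) = fsmul f (Φ u)}
    {hΦ' : ∀ (f : Fn EM M) (u : Sec EM F E), Φ' (fsmul f u) = fsmul f (Φ' u)}
    (k : Sec EM F E) (h : ∀ u, C.bracket k (Φ u) = Φ (C.bracket k u) + Φ' u) :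
    C.lieS k (trS C Φ hΦ) = trS C Φ' hΦ' := by
  ext x
  let B := dualFrame C x
  have h0 : C.lieS k (trS C Φ hΦ) x = C.lieS k (∑ i, C.pairS (Φ (B.e i)) (B.t i)) x :=
    dirDeriv_congr (trS_eventuallyEq Φ hΦ B) _
  rw [h0, C.lieS_sum, Fn.sum_apply, trS_apply_sum Φ' hΦ' B]
  have h1 : ∀ i, C.lieS k (C.pairS (Φ (B.e i)) (B.t i)) x =
      C.pairing x (Φ' (B.e i) x) (B.t i x) +
      ((∑ j, C.pairing x (C.bracket k (B.e i) x) (B.t j x) * C.pairing x (Φ (B.e j) x) (B.t i x)) +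
      ∑ j, C.pairing x (Φ (B.e i) x) (B.t j x) * C.pairing x (B.e j x) (C.bracket k (B.t i) x)) := by
    intro i
    rw [C.lieS_pairS]
    change C.pairing x (C.bracket k (Φ (B.e i)) x) (B.t i x) +
      C.pairing x (Φ (B.e i) x) (C.bracket k (B.t i) x) = _
    have h2 : Φ (C.bracket k (B.e i)) x =
        ∑ j, C.pairing x (C.bracket k (B.e i) x) (B.t j x) • Φ (B.e j) x := by
      rw [← pointwise_apply Φ hΦ, B.sum_of_p_one B.p_one_self (C.bracket k (B.e i) x), map_sum]
      simp only [map_smul, pointwise_apply]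
      exact Finset.sum_congr rfl fun j _ => by rw [← B.sum_of_p_one B.p_one_self]
    have h3 : C.pairing x (Φ (B.e i) x) (C.bracket k (B.t i) x) =
        ∑ j, C.pairing x (Φ (B.e i) x) (B.t j x) * C.pairing x (B.e j x) (C.bracket k (B.t i) x) := by
      conv_lhs => rw [B.sum_of_p_one B.p_one_self (Φ (B.e i) x)]
      simp [map_sum]
    rw [h3, h, add_sec, h2]
    simp only [map_add, map_sum, map_smul, LinearMap.add_apply, LinearMap.sum_apply,
      LinearMap.smul_apply, smul_eq_mul]
    ring
  simp only [h1, Finset.sum_add_distrib]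
  rw [add_eq_left]
  rw [Finset.sum_comm (f := fun i j => C.pairing x (Φ (B.e i) x) (B.t j x) *
    C.pairing x (B.e j x) (C.bracket k (B.t i) x)), ← Finset.sum_add_distrib]
  refine Finset.sum_eq_zero fun i _ => ?_
  rw [← Finset.sum_add_distrib]
  refine Finset.sum_eq_zero fun j _ => ?_
  -- The frame itself is not invariant under `k`. Its variation cancels against that of the dual
  -- frame because `⟨e_i, t_j⟩` is constant near `x`.
  have h4 : C.lieS k (C.pairS (B.e i) (B.t j)) x = 0 :=
    dirDeriv_of_eventuallyEq_const (c := if i = j then 1 else 0) (B.dual.mono fun y hy => hy i j) _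
  rw [C.lieS_pairS] at h4
  change C.pairing x (C.bracket k (B.e i) x) (B.t j x) +
    C.pairing x (B.e i x) (C.bracket k (B.t j) x) = 0 at h4
  linear_combination C.pairing x (Φ (B.e j) x) (B.t i x) * h4

end Trace

/-! ### The generalized Ricci tensor is a tensor -/

lemma CourantAlgebroid.bracket_fsmul_left (f : Fn EM M) (u b : Sec EM F E)
    (h : ∀ x, C.pairing x (u x) (b x) = 0) :
    C.bracket (fsmul f u) b = fsmul f (C.bracket u b) - fsmul (C.lieS b f) u := by
  ext x
  exact GenPseudometric.bracket_fsmul_of_orthogonal f u b h x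

variable (C) in
/-- The derivative of `f`, as a linear map on sections. -/
def CourantAlgebroid.lieL (f : Fn EM M) : Sec EM F E →ₗ[ℝ] Fn EM M where
  toFun u := C.lieS u f
  map_add' u v := by
    ext x
    change dirDeriv f x (C.anchor x (u x + v x)) = dirDeriv f x _ + dirDeriv f x _
    rw [map_add, dirDeriv_map_add]
  map_smul' c u := by
    ext x
    change dirDeriv f x (C.anchor x (c • u x)) = c * dirDeriv f x _
    rw [map_smul, dirDeriv_map_smul]

@[simp] lemma CourantAlgebroid.lieL_apply (f : Fn EM M) (u : Sec EM F E) :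
    C.lieL f u = C.lieS u f := rfl

lemma CourantAlgebroid.lieS_fsmul_apply (f g : Fn EM M) (u : Sec EM F E) (x : M) :
    C.lieS (fsmul g u) f x = g x * C.lieS u f x := by
  change dirDeriv f x (C.anchor x (g x • u x)) = _
  rw [map_smul, dirDeriv_map_smul]
  rfl

lemma CourantAlgebroid.lieS_add_left (u v : Sec EM F E) (f : Fn EM M) :
    C.lieS (u + v) f = C.lieS u f + C.lieS v f := map_add (C.lieL f) u v

lemma CourantAlgebroid.lieS_neg_left (u : Sec EM F E) (f : Fn EM M) :
    C.lieS (-u) f = - C.lieS u f := map_neg (C.lieL f) u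

lemma Divergence.map_fsmul' (div : Divergence C) (f : Fn EM M) (u : Sec EM F E) :
    div.toFun (fsmul f u) = f * div.toFun u + C.lieS u f := by
  ext x; exact div.map_fsmul f u x

namespace GenPseudometric

variable (V : GenPseudometric C)

lemma projPlus_mem (u : Sec EM F E) : V.projPlus u ∈ V.sectionsPlus := fun x => V.proj_mem x (u x)

lemma projMinus_mem (u : Sec EM F E) : V.projMinus u ∈ V.sectionsMinus :=
  fun x => V.sub_proj_mem x (u x)

lemma projPlus_of_mem {u : Sec EM F E} (hu : u ∈ V.sectionsPlus) : V.projPlus u = u := by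
  ext x; exact V.proj_of_mem (hu x)

lemma proj_of_mem_minus {x : M} {a : E x} (ha : a ∈ V.minus x) : V.proj x a = 0 :=
  V.proj_eq (Submodule.zero_mem _) (by rwa [sub_zero])

lemma projPlus_of_mem_minus {u : Sec EM F E} (hu : u ∈ V.sectionsMinus) : V.projPlus u = 0 := by
  ext x; exact V.proj_of_mem_minus (hu x)

lemma projMinus_eq (u : Sec EM F E) : V.projMinus u = u - V.projPlus u := rfl

lemma projMinus_of_mem {u : Sec EM F E} (hu : u ∈ V.sectionsMinus) : V.projMinus u = u := by
  rw [projMinus_eq, V.projPlus_of_mem_minus hu, sub_zero]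

lemma projMinus_of_mem_plus {u : Sec EM F E} (hu : u ∈ V.sectionsPlus) : V.projMinus u = 0 := by
  rw [projMinus_eq, V.projPlus_of_mem hu, sub_self]

lemma pairing_plus_minus {a b : Sec EM F E} (ha : a ∈ V.sectionsPlus) (hb : b ∈ V.sectionsMinus)
    (x : M) : C.pairing x (a x) (b x) = 0 := V.mem_minus.1 (hb x) _ (ha x)

lemma pairing_minus_plus {a b : Sec EM F E} (ha : a ∈ V.sectionsPlus) (hb : b ∈ V.sectionsMinus)
    (x : M) : C.pairing x (b x) (a x) = 0 := by
  rw [C.pairing_symm]; exact V.pairing_plus_minus ha hb x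

lemma fsmul_mem_plus (f : Fn EM M) {a : Sec EM F E} (ha : a ∈ V.sectionsPlus) :
    fsmul f a ∈ V.sectionsPlus := fun x => (V.plus x).smul_mem _ (ha x)

lemma fsmul_mem_minus (f : Fn EM M) {b : Sec EM F E} (hb : b ∈ V.sectionsMinus) :
    fsmul f b ∈ V.sectionsMinus := fun x => (V.minus x).smul_mem _ (hb x)

variable (div : Divergence C)

/-- The generalized Ricci tensor as a smooth function. -/
def gricS (a : V.sectionsPlus) (b : V.sectionsMinus) : Fn EM M :=
  div.toFun (V.projPlus (C.bracket b.1 a.1)) - C.lieS b.1 (div.toFun a.1) -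
    trS C (V.ricciOp a b) (V.ricciOp_fsmul a b)

/-- The operator on all of `E` has image in `V₊`, so its trace is the trace of its restriction to
`V₊`. Working on `E` makes the frames of `E` available and avoids choosing frames of `V₊`. -/
lemma gricS_apply (a : V.sectionsPlus) (b : V.sectionsMinus) (x : M) :
    V.gricS div a b x = V.GRic div a b x := by
  have : FiniteDimensional ℝ (E x) := VectorBundle.finiteDimensional ℝ F E x
  have h : LinearMap.trace ℝ (V.plus x) (V.ricciEnd a b x) =
      trS C (V.ricciOp a b) (V.ricciOp_fsmul a b) x := by
    refine LinearMap.trace_restrict_eq_of_forall_mem _ _ fun v => ?_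
    obtain ⟨u, rfl⟩ := exists_section (EM := EM) (F := F) x v
    rw [pointwise_apply]
    exact V.proj_mem x _
  unfold GRic
  rw [h]
  rfl

lemma gricS_add_left (a a' : V.sectionsPlus) (b : V.sectionsMinus) :
    V.gricS div (a + a') b = V.gricS div a b + V.gricS div a' b := by
  have h : V.ricciOp (a + a') b = V.ricciOp a b + V.ricciOp a' b := by
    ext1 u
    simp only [LinearMap.add_apply, ricciOp_apply, Submodule.coe_add, map_add]
  unfold gricS
  rw [trS_add h (hΦ₁ := V.ricciOp_fsmul a b) (hΦ₂ := V.ricciOp_fsmul a' b)]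
  simp only [Submodule.coe_add, map_add, C.lieS_add]
  abel

lemma gricS_smul_left (c : ℝ) (a : V.sectionsPlus) (b : V.sectionsMinus) :
    V.gricS div (c • a) b = c • V.gricS div a b := by
  have h : V.ricciOp (c • a) b = c • V.ricciOp a b := by
    ext1 u
    simp only [LinearMap.smul_apply, ricciOp_apply, Submodule.coe_smul, map_smul]
  unfold gricS
  rw [trS_smul h (hΦ₁ := V.ricciOp_fsmul a b)]
  simp only [Submodule.coe_smul, map_smul, C.lieS_smul, smul_sub]

lemma gricS_add_right (a : V.sectionsPlus) (b b' : V.sectionsMinus) :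
    V.gricS div a (b + b') = V.gricS div a b + V.gricS div a b' := by
  have h : V.ricciOp a (b + b') = V.ricciOp a b + V.ricciOp a b' := by
    ext1 u
    simp only [LinearMap.add_apply, ricciOp_apply, Submodule.coe_add, map_add]
  unfold gricS
  rw [trS_add h (hΦ₁ := V.ricciOp_fsmul a b) (hΦ₂ := V.ricciOp_fsmul a b')]
  simp only [Submodule.coe_add, map_add, LinearMap.add_apply, C.lieS_add_left]
  abel

lemma gricS_smul_right (c : ℝ) (a : V.sectionsPlus) (b : V.sectionsMinus) :
    V.gricS div a (c • b) = c • V.gricS div a b := by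
  have h : V.ricciOp a (c • b) = c • V.ricciOp a b := by
    ext1 u
    simp only [LinearMap.smul_apply, ricciOp_apply, Submodule.coe_smul, map_smul]
  have h2 : ∀ f, C.lieS (c • b.1) f = c • C.lieS b.1 f := fun f => map_smul (C.lieL f) c b.1
  unfold gricS
  rw [trS_smul h (hΦ₁ := V.ricciOp_fsmul a b)]
  simp only [Submodule.coe_smul, map_smul, LinearMap.smul_apply, h2, smul_sub]

/-- The divergence term produces the extra summand `[b, a]₊·f`. In the trace, `[u₊, fb]` adds
`(u₊·f) b`, hence the rank one operator `u ↦ (u₊·f) [b, a]₊`, whose trace is the same summand. The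
middle term is linear in `b` already. -/
lemma gricS_fsmul_right (f : Fn EM M) (a : V.sectionsPlus) (b : V.sectionsMinus) :
    V.gricS div a ⟨fsmul f b.1, V.fsmul_mem_minus f b.2⟩ = f * V.gricS div a b := by
  set fb : V.sectionsMinus := ⟨fsmul f b.1, V.fsmul_mem_minus f b.2⟩
  have hfb : fb.1 = fsmul f b.1 := rfl
  have h1 : V.projPlus (C.bracket fb.1 a.1) = fsmul f (V.projPlus (C.bracket b.1 a.1)) := by
    rw [hfb, C.bracket_fsmul_left f b.1 a.1 (V.pairing_minus_plus a.2 b.2), map_sub,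
      V.projPlus_of_mem_minus (V.fsmul_mem_minus _ b.2), projPlus_fsmul, sub_zero]
  have h2 : trS C (V.ricciOp a fb) (V.ricciOp_fsmul a fb) =
      f * trS C (V.ricciOp a b) (V.ricciOp_fsmul a b) +
        (C.lieL f ∘ₗ V.projPlus) (V.projPlus (C.bracket b.1 a.1)) := by
    refine trS_rankOne f _ (fun g u x => ?_) _ fun u => ?_
    · simp only [LinearMap.comp_apply, projPlus_fsmul, C.lieL_apply, C.lieS_fsmul_apply]
    · rw [ricciOp_apply, ricciOp_apply, hfb, C.bracket_fsmul, map_add,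
        V.projMinus_of_mem (V.fsmul_mem_minus _ b.2), projMinus_fsmul, map_add,
        LinearMap.add_apply, C.bracket_fsmul_left _ _ _
          (V.pairing_minus_plus a.2 (V.projMinus_mem _)),
        C.bracket_fsmul_left _ _ _ (V.pairing_minus_plus a.2 b.2), map_add, map_sub, map_sub,
        V.projPlus_of_mem_minus (V.fsmul_mem_minus _ (V.projMinus_mem _)),
        V.projPlus_of_mem_minus (V.fsmul_mem_minus _ b.2), projPlus_fsmul, projPlus_fsmul,
        sub_zero, sub_zero]
      rfl
  unfold gricS
  rw [h1, h2, div.map_fsmul', hfb, LinearMap.comp_apply, V.projPlus_of_mem (V.projPlus_mem _),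
    C.lieL_apply]
  ext x
  have h3 := C.lieS_fsmul_apply (div.toFun a.1) f b.1 x
  change f x * _ + _ - C.lieS (fsmul f b.1) (div.toFun a.1) x - (f x * _ + _) =
    f x * (_ - _ - _)
  rw [h3]
  ring

/-- The extra summands are `[b, a]₊·f + a·(b·f)` from the divergence term (next to a `(b·f) div a`
that cancels), `-b·(a·f)` from the middle term, and `[b, a]₋·f` from the trace. The first and the
last add up to `[b, a]·f`, and the total vanishes because the anchor is a morphism of brackets. -/
lemma gricS_fsmul_left (f : Fn EM M) (a : V.sectionsPlus) (b : V.sectionsMinus) :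
    V.gricS div ⟨fsmul f a.1, V.fsmul_mem_plus f a.2⟩ b = f * V.gricS div a b := by
  set fa : V.sectionsPlus := ⟨fsmul f a.1, V.fsmul_mem_plus f a.2⟩
  have hfa : fa.1 = fsmul f a.1 := rfl
  -- The inner operator `u ↦ [u₊, b]₋` is tensorial by itself, since the anomaly `(b·g) u₊` is
  -- killed by the projection to `V₋`.
  let W : Sec EM F E →ₗ[ℝ] Sec EM F E := V.projMinus ∘ₗ C.bracket.flip b.1 ∘ₗ V.projPlus
  have hW : ∀ (g : Fn EM M) (u : Sec EM F E), W (fsmul g u) = fsmul g (W u) := by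
    intro g u
    change V.projMinus (C.bracket (V.projPlus (fsmul g u)) b.1) =
      fsmul g (V.projMinus (C.bracket (V.projPlus u) b.1))
    rw [projPlus_fsmul, C.bracket_fsmul_left _ _ _ (V.pairing_plus_minus (V.projPlus_mem _) b.2),
      map_sub, projMinus_fsmul, V.projMinus_of_mem_plus (V.fsmul_mem_plus _ (V.projPlus_mem _)),
      sub_zero]
  have h1 : V.projPlus (C.bracket b.1 fa.1) =
      fsmul f (V.projPlus (C.bracket b.1 a.1)) + fsmul (C.lieS b.1 f) a.1 := by
    rw [hfa, C.bracket_fsmul, map_add, projPlus_fsmul,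
      V.projPlus_of_mem (V.fsmul_mem_plus _ a.2)]
  have h2 : trS C (V.ricciOp fa b) (V.ricciOp_fsmul fa b) =
      f * trS C (V.ricciOp a b) (V.ricciOp_fsmul a b) + (C.lieL f ∘ₗ W) a.1 := by
    refine trS_rankOne f _ (fun g u x => ?_) _ fun u => ?_
    · rw [LinearMap.comp_apply, hW, C.lieL_apply, C.lieS_fsmul_apply]
      rfl
    · rw [ricciOp_apply, ricciOp_apply, hfa, C.bracket_fsmul, map_add, projPlus_fsmul,
        V.projPlus_of_mem (V.fsmul_mem_plus _ a.2)]
      rfl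
  have h3 : C.lieL f (W a.1) = - C.lieS (V.projMinus (C.bracket b.1 a.1)) f := by
    change C.lieS (V.projMinus (C.bracket (V.projPlus a.1) b.1)) f = _
    rw [V.projPlus_of_mem a.2, C.bracket_skew (V.pairing_plus_minus a.2 b.2), map_neg,
      C.lieS_neg_left]
  have h4 := C.lieS_bracket b.1 a.1 f
  have h5 : C.lieS (C.bracket b.1 a.1) f = C.lieS (V.projPlus (C.bracket b.1 a.1)) f +
      C.lieS (V.projMinus (C.bracket b.1 a.1)) f := by
    rw [← C.lieS_add_left, projMinus_eq, add_sub_cancel]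
  unfold gricS
  rw [h1, h2, map_add, div.map_fsmul', div.map_fsmul', LinearMap.comp_apply, h3, hfa,
    div.map_fsmul', C.lieS_add, C.lieS_mul]
  linear_combination h4 - h5

/-- `GRic(u₊, v₋)` as a bilinear form on sections. -/
def gricForm : Sec EM F E →ₗ[ℝ] Sec EM F E →ₗ[ℝ] Fn EM M :=
  LinearMap.mk₂ ℝ (fun u v => V.gricS div ⟨V.projPlus u, V.projPlus_mem u⟩
      ⟨V.projMinus v, V.projMinus_mem v⟩)
    (fun u u' v => by
      rw [← V.gricS_add_left]; congr 1; ext1; exact map_add _ _ _)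
    (fun c u v => by
      rw [← V.gricS_smul_left]; congr 1; ext1; exact map_smul _ _ _)
    (fun u v v' => by
      rw [← V.gricS_add_right]; congr 1; ext1; exact map_add _ _ _)
    (fun c u v => by
      rw [← V.gricS_smul_right]; congr 1; ext1; exact map_smul _ _ _)

lemma gricForm_apply (u v : Sec EM F E) : V.gricForm div u v =
    V.gricS div ⟨V.projPlus u, V.projPlus_mem u⟩ ⟨V.projMinus v, V.projMinus_mem v⟩ := rfl

lemma gricForm_fsmul_left (f : Fn EM M) (u v : Sec EM F E) :
    V.gricForm div (fsmul f u) v = f * V.gricForm div u v := by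
  rw [gricForm_apply, gricForm_apply, ← V.gricS_fsmul_left]
  congr 1
  ext1
  exact V.projPlus_fsmul f u

lemma gricForm_fsmul_right (f : Fn EM M) (u v : Sec EM F E) :
    V.gricForm div u (fsmul f v) = f * V.gricForm div u v := by
  rw [gricForm_apply, gricForm_apply, ← V.gricS_fsmul_right]
  congr 1
  ext1
  exact V.projMinus_fsmul f v

lemma gricForm_of_mem (a : V.sectionsPlus) (b : V.sectionsMinus) :
    V.gricForm div a.1 b.1 = V.gricS div a b := by
  rw [gricForm_apply]
  congr 1
  · ext1; exact V.projPlus_of_mem a.2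
  · ext1; exact V.projMinus_of_mem b.2

/-- The generalized Ricci tensor at `x` depends only on the values at `x`. -/
lemma GRic_congr {a a' : V.sectionsPlus} {b b' : V.sectionsMinus} {x : M}
    (ha : a.1 x = a'.1 x) (hb : b.1 x = b'.1 x) : V.GRic div a b x = V.GRic div a' b' x := by
  rw [← gricS_apply, ← gricS_apply, ← gricForm_of_mem, ← gricForm_of_mem]
  have h1 := tensorial_fn C (V.gricForm div a.1)
    (fun f u y => by rw [gricForm_fsmul_right]; rfl) hb
  have h2 := tensorial_fn C ((V.gricForm div).flip b'.1)
    (fun f u y => by rw [LinearMap.flip_apply, gricForm_fsmul_left]; rfl) ha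
  exact h1.trans h2

/-! ### Invariance -/

section Invariance

variable {k : Sec EM F E}

/-- The derivation `[k, ·]` preserves `V₊`. -/
def Preserves (k : Sec EM F E) : Prop := ∀ a ∈ V.sectionsPlus, C.bracket k a ∈ V.sectionsPlus

variable {V}

/-- The bracket is a derivation of the pairing, so the orthogonal complement of a preserved
subbundle is preserved. -/
lemma Preserves.minus (hk : V.Preserves k) {b : Sec EM F E} (hb : b ∈ V.sectionsMinus) :
    C.bracket k b ∈ V.sectionsMinus := by
  intro x
  rw [V.mem_minus]
  intro a ha
  obtain ⟨u, rfl⟩ := exists_section (EM := EM) (F := F) x a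
  have hu := V.projPlus_mem u
  have hux : V.projPlus u x = u x := V.proj_of_mem ha
  rw [← hux]
  have h1 : C.lieS k (C.pairS (V.projPlus u) b) x = 0 :=
    dirDeriv_of_eventuallyEq_const (c := 0) (Eventually.of_forall (V.pairing_plus_minus hu hb)) _
  rw [C.lieS_pairS] at h1
  change C.pairing x (C.bracket k (V.projPlus u) x) (b x) +
    C.pairing x (V.projPlus u x) (C.bracket k b x) = 0 at h1
  rwa [V.pairing_plus_minus (hk _ hu) hb, zero_add] at h1

lemma Preserves.projPlus (hk : V.Preserves k) (u : Sec EM F E) :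
    V.projPlus (C.bracket k u) = C.bracket k (V.projPlus u) := by
  have h : u = V.projPlus u + V.projMinus u := by rw [projMinus_eq, add_sub_cancel]
  conv_lhs => rw [h]
  rw [map_add, map_add, V.projPlus_of_mem (hk _ (V.projPlus_mem u)),
    V.projPlus_of_mem_minus (hk.minus (V.projMinus_mem u)), add_zero]

lemma Preserves.projMinus (hk : V.Preserves k) (u : Sec EM F E) :
    V.projMinus (C.bracket k u) = C.bracket k (V.projMinus u) := by
  rw [projMinus_eq, projMinus_eq, hk.projPlus, map_sub]

/-- The derivation `[k, ·]` satisfies the product rule with the bracket (Jacobi), commutes with the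
projections and, by hypothesis, with the divergence, and it passes through traces. Applying it to
each term gives one summand for `a` and one for `b`. -/
lemma Preserves.lieS_gricS (hk : V.Preserves k)
    (hdiv : ∀ u, C.lieS k (div.toFun u) = div.toFun (C.bracket k u))
    (a : V.sectionsPlus) (b : V.sectionsMinus) :
    C.lieS k (V.gricS div a b) = V.gricS div ⟨C.bracket k a.1, hk _ a.2⟩ b +
      V.gricS div a ⟨C.bracket k b.1, hk.minus b.2⟩ := by
  set a' : V.sectionsPlus := ⟨C.bracket k a.1, hk _ a.2⟩
  set b' : V.sectionsMinus := ⟨C.bracket k b.1, hk.minus b.2⟩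
  have hlsub : ∀ f g : Fn EM M, C.lieS k (f - g) = C.lieS k f - C.lieS k g := by
    intro f g
    have := C.lieS_add k (f - g) g
    rw [sub_add_cancel] at this
    rw [this, add_sub_cancel_right]
  have h1 : C.lieS k (trS C (V.ricciOp a b) (V.ricciOp_fsmul a b)) =
      trS C (V.ricciOp a' b) (V.ricciOp_fsmul a' b) +
        trS C (V.ricciOp a b') (V.ricciOp_fsmul a b') := by
    have ht : ∀ (f : Fn EM M) (u : Sec EM F E), (V.ricciOp a' b + V.ricciOp a b') (fsmul f u) =
        fsmul f ((V.ricciOp a' b + V.ricciOp a b') u) := by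
      intro f u
      rw [LinearMap.add_apply, LinearMap.add_apply, ricciOp_fsmul, ricciOp_fsmul, fsmul_add]
    rw [← trS_add (Φ := V.ricciOp a' b + V.ricciOp a b') (hΦ := ht) rfl]
    refine lieS_trS k fun u => ?_
    simp only [LinearMap.add_apply, ricciOp_apply]
    change _ = _ + (V.projPlus (C.bracket _ (C.bracket k a.1)) +
      V.projPlus (C.bracket (V.projMinus (C.bracket _ (C.bracket k b.1))) a.1))
    rw [← hk.projPlus, C.jacobi, ← hk.projMinus, C.jacobi, hk.projPlus u]
    simp only [map_add, LinearMap.add_apply]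
    abel
  unfold gricS
  rw [hlsub, hlsub, h1, hdiv, ← hk.projPlus, C.jacobi, map_add, map_add]
  have h2 := C.lieS_bracket k b.1 (div.toFun a.1)
  rw [hdiv] at h2
  change _ = (div.toFun (V.projPlus (C.bracket b.1 (C.bracket k a.1))) -
      C.lieS b.1 (div.toFun (C.bracket k a.1)) - _) +
    (div.toFun (V.projPlus (C.bracket (C.bracket k b.1) a.1)) -
      C.lieS (C.bracket k b.1) (div.toFun a.1) - _)
  rw [h2]
  abel

/-- The generalized Ricci tensor vanishes on `k ∈ V₋` if `k` preserves all the structure. -/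
lemma Preserves.gricS_eq_zero (hk : V.Preserves k)
    (hdiv : ∀ u, C.lieS k (div.toFun u) = div.toFun (C.bracket k u))
    (a : V.sectionsPlus) (hk' : k ∈ V.sectionsMinus) : V.gricS div a ⟨k, hk'⟩ = 0 := by
  -- Here `[u₊, k] = -[k, u₊]` lies in `V₊`, so its `V₋` part is zero. The two divergence terms
  -- cancel because `[k, a]` is already in `V₊` and `k` commutes with the divergence.
  have h1 : trS C (V.ricciOp a ⟨k, hk'⟩) (V.ricciOp_fsmul a ⟨k, hk'⟩) = 0 := by
    ext x
    rw [trS_apply_sum _ _ (dualFrame C x)]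
    refine Finset.sum_eq_zero fun i _ => ?_
    rw [ricciOp_apply, C.bracket_skew (V.pairing_plus_minus (V.projPlus_mem _) hk'), map_neg,
      V.projMinus_of_mem_plus (hk _ (V.projPlus_mem _))]
    simp
  unfold gricS
  rw [h1, V.projPlus_of_mem (hk _ a.2), hdiv, sub_self, sub_zero]

lemma Preserves.lieS_gricForm (hk : V.Preserves k)
    (hdiv : ∀ u, C.lieS k (div.toFun u) = div.toFun (C.bracket k u)) (u v : Sec EM F E) :
    C.lieS k (V.gricForm div u v) =
      V.gricForm div (C.bracket k u) v + V.gricForm div u (C.bracket k v) := by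
  rw [gricForm_apply, hk.lieS_gricS div hdiv, gricForm_apply, gricForm_apply]
  congr 2
  · ext1; exact (hk.projPlus u).symm
  · ext1; exact (hk.projMinus v).symm

end Invariance

end GenPseudometric

end Ricci

/-! ### The exponential of an endomorphism -/

section ExpEnd

/-- The derivative of the exponential at `a` in the direction `[a, g]` is `[exp a, g]`. -/
lemma fderiv_exp_commutator {A : Type*} [NormedRing A] [NormedAlgebra ℝ A] [CompleteSpace A]
    (a g : A) : fderiv ℝ (NormedSpace.exp : A → A) a (a * g - g * a) =
      NormedSpace.exp a * g - g * NormedSpace.exp a := by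
  let _ : NormedAlgebra ℚ A := NormedAlgebra.restrictScalars ℚ ℝ A
  have hexp : ∀ t : ℝ, NormedSpace.exp (t • (-g)) * NormedSpace.exp (t • g) = 1 ∧
      NormedSpace.exp (t • g) * NormedSpace.exp (t • (-g)) = 1 := by
    intro t
    have h1 : Commute (t • (-g)) (t • g) := by
      rw [smul_neg]; exact (Commute.refl _).neg_left
    constructor
    · rw [← NormedSpace.exp_add_of_commute h1, smul_neg, neg_add_cancel, NormedSpace.exp_zero]
    · rw [← NormedSpace.exp_add_of_commute h1.symm, smul_neg, add_neg_cancel, NormedSpace.exp_zero]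
  have hd : ∀ b : A, HasDerivAt (fun t : ℝ => NormedSpace.exp (t • (-g)) * b * NormedSpace.exp (t • g))
      (b * g - g * b) 0 := by
    intro b
    have h1 := hasDerivAt_exp_smul_const (𝕂 := ℝ) (-g) 0
    have h2 := hasDerivAt_exp_smul_const (𝕂 := ℝ) g 0
    have h3 := (h1.mul_const b).mul h2
    simp only [zero_smul, NormedSpace.exp_zero, one_mul, mul_one] at h3
    refine h3.congr_deriv ?_
    noncomm_ring
  -- The exponential commutes with conjugation. Differentiating this identity at `t = 0`, through
  -- the inner argument on one side and directly on the other, gives the claim.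
  have hconj : (fun t : ℝ => NormedSpace.exp (NormedSpace.exp (t • (-g)) * a *
      NormedSpace.exp (t • g))) = fun t : ℝ => NormedSpace.exp (t • (-g)) * NormedSpace.exp a *
      NormedSpace.exp (t • g) := by
    funext t
    let y : Aˣ := ⟨NormedSpace.exp (t • (-g)), NormedSpace.exp (t • g), (hexp t).1, (hexp t).2⟩
    exact NormedSpace.exp_units_conj y a
  have hc := hd a
  have h4 : HasFDerivAt (NormedSpace.exp : A → A) (fderiv ℝ NormedSpace.exp a)
      (NormedSpace.exp ((0 : ℝ) • (-g)) * a * NormedSpace.exp ((0 : ℝ) • g)) := by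
    simp only [zero_smul, NormedSpace.exp_zero, one_mul, mul_one]
    exact (NormedSpace.exp_analytic (𝕂 := ℝ) a).differentiableAt.hasFDerivAt
  have h5 := h4.comp_hasDerivAt (0 : ℝ) hc
  change HasDerivAt (fun t : ℝ => NormedSpace.exp (NormedSpace.exp (t • (-g)) * a *
      NormedSpace.exp (t • g))) _ _ at h5
  rw [hconj] at h5
  exact h5.unique (hd _)

variable {V : Type*} [AddCommGroup V] [Module ℝ V] [FiniteDimensional ℝ V]
  {G : Type*} [NormedAddCommGroup G] [NormedSpace ℝ G] [FiniteDimensional ℝ G]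

/-- The endomorphism of `G` corresponding to an endomorphism of `V ≃ G`. -/
def conjCLM (φ : V ≃ₗ[ℝ] G) (T : V →ₗ[ℝ] V) : G →L[ℝ] G :=
  LinearMap.toContinuousLinearMap (φ.toLinearMap ∘ₗ T ∘ₗ φ.symm.toLinearMap)

omit [FiniteDimensional ℝ V] in
lemma conjCLM_apply (φ : V ≃ₗ[ℝ] G) (T : V →ₗ[ℝ] V) (v : V) : conjCLM φ T (φ v) = φ (T v) := by
  simp [conjCLM]

omit [FiniteDimensional ℝ V] in
lemma conjCLM_smul (φ : V ≃ₗ[ℝ] G) (c : ℝ) (T : V →ₗ[ℝ] V) :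
    conjCLM φ (c • T) = c • conjCLM φ T := by
  ext x
  simp [conjCLM]

/-- The exponential of an endomorphism of a finite dimensional space. -/
def expEnd (T : V →ₗ[ℝ] V) : V →ₗ[ℝ] V :=
  (Module.finBasis ℝ V).equivFun.symm.toLinearMap ∘ₗ
    (NormedSpace.exp (conjCLM (Module.finBasis ℝ V).equivFun T)).toLinearMap ∘ₗ
    (Module.finBasis ℝ V).equivFun.toLinearMap

/-- The exponential is natural under isomorphisms of algebras, so the basis chosen in the definition
is irrelevant and the exponential may be computed in any coordinates, in particular those of a
smooth frame. -/
lemma expEnd_apply (φ : V ≃ₗ[ℝ] G) (T : V →ₗ[ℝ] V) (v : V) :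
    φ (expEnd T v) = NormedSpace.exp (conjCLM φ T) (φ v) := by
  let φ₀ := (Module.finBasis ℝ V).equivFun
  let g : (Fin (Module.finrank ℝ V) → ℝ) ≃L[ℝ] G := (φ₀.symm.trans φ).toContinuousLinearEquiv
  let _ : NormedAlgebra ℚ ((Fin (Module.finrank ℝ V) → ℝ) →L[ℝ] (Fin (Module.finrank ℝ V) → ℝ)) :=
    NormedAlgebra.restrictScalars ℚ ℝ _
  let _ : NormedAlgebra ℚ (G →L[ℝ] G) := NormedAlgebra.restrictScalars ℚ ℝ _
  have h1 := NormedSpace.map_exp g.conjContinuousAlgEquiv g.conjContinuousAlgEquiv.continuous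
    (conjCLM φ₀ T)
  have h2 : g.conjContinuousAlgEquiv (conjCLM φ₀ T) = conjCLM φ T := by
    ext x
    simp [g, conjCLM]
  rw [h2] at h1
  rw [← h1]
  simp [g, expEnd, φ₀]

lemma expEnd_zero : expEnd (0 : V →ₗ[ℝ] V) = LinearMap.id := by
  ext v
  apply (Module.finBasis ℝ V).equivFun.injective
  rw [expEnd_apply, show conjCLM (Module.finBasis ℝ V).equivFun (0 : V →ₗ[ℝ] V) = 0 by
    ext; simp [conjCLM], NormedSpace.exp_zero]
  rfl

lemma expEnd_neg_apply (T : V →ₗ[ℝ] V) (v : V) : expEnd (-T) (expEnd T v) = v := by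
  let φ₀ := (Module.finBasis ℝ V).equivFun
  let _ : NormedAlgebra ℚ ((Fin (Module.finrank ℝ V) → ℝ) →L[ℝ] (Fin (Module.finrank ℝ V) → ℝ)) :=
    NormedAlgebra.restrictScalars ℚ ℝ _
  apply φ₀.injective
  have h : conjCLM φ₀ (-T) = - conjCLM φ₀ T := by
    ext; simp [conjCLM]
  have hc : Commute (-conjCLM φ₀ T) (conjCLM φ₀ T) := (Commute.refl (conjCLM φ₀ T)).neg_left
  have h1 := NormedSpace.exp_add_of_commute hc
  rw [neg_add_cancel, NormedSpace.exp_zero] at h1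
  rw [expEnd_apply, expEnd_apply, h]
  exact (congrArg (fun A : (Fin (Module.finrank ℝ V) → ℝ) →L[ℝ] (Fin (Module.finrank ℝ V) → ℝ) =>
    A (φ₀ v)) h1).symm

lemma hasDerivAt_expEnd (T : V →ₗ[ℝ] V) (v : V) (ℓ : V →ₗ[ℝ] ℝ) (t : ℝ) :
    HasDerivAt (fun t : ℝ => ℓ (expEnd (t • T) v)) (ℓ (T (expEnd (t • T) v))) t := by
  let φ := (Module.finBasis ℝ V).equivFun
  have h1 := (hasDerivAt_exp_smul_const' (𝕂 := ℝ) (conjCLM φ T) t).clm_apply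
    (hasDerivAt_const t (φ v))
  have h2 := ((ℓ ∘ₗ φ.symm.toLinearMap).toContinuousLinearMap.hasFDerivAt).comp_hasDerivAt t h1
  have h3 : ∀ s : ℝ, NormedSpace.exp (s • conjCLM φ T) (φ v) = φ (expEnd (s • T) v) := fun s => by
    rw [← conjCLM_smul, ← expEnd_apply]
  refine (h2.congr_deriv ?_).congr_of_eventuallyEq (Eventually.of_forall fun s => ?_)
  · rw [map_zero, add_zero]
    change ℓ (φ.symm (conjCLM φ T (NormedSpace.exp (t • conjCLM φ T) (φ v)))) = _
    rw [h3, conjCLM_apply, LinearEquiv.symm_apply_apply]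
  · change _ = ℓ (φ.symm (NormedSpace.exp (s • conjCLM φ T) (φ v)))
    rw [h3, LinearEquiv.symm_apply_apply]

/-- The function `t ↦ ℓ(exp(tT) v)` has derivative `ℓ(T exp(tT) v) = 0`. With `ℓ = ⟨χ(s), ·⟩` this
keeps the deformed subbundle inside `𝔰_E^⊥`. -/
lemma apply_expEnd_eq (T : V →ₗ[ℝ] V) (v : V) (ℓ : V →ₗ[ℝ] ℝ) (h : ∀ w, ℓ (T w) = 0) :
    ℓ (expEnd T v) = ℓ v := by
  have h1 : ∀ t, HasDerivAt (fun t : ℝ => ℓ (expEnd (t • T) v)) 0 t := fun t => by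
    have := hasDerivAt_expEnd T v ℓ t
    rwa [h] at this
  have h2 := is_const_of_deriv_eq_zero (fun t => (h1 t).differentiableAt) (fun t => (h1 t).deriv) 1 0
  simpa [expEnd_zero] using h2

lemma expEnd_orthogonal (T : V →ₗ[ℝ] V) (β : LinearMap.BilinForm ℝ V)
    (h : ∀ a b, β (T a) b + β a (T b) = 0) (a b : V) : β (expEnd T a) (expEnd T b) = β a b := by
  let B := Module.finBasis ℝ V
  have hβ : ∀ v w, β v w = ∑ i, B.coord i v * β (B i) w := by
    intro v w
    conv_lhs => rw [← B.sum_repr v, map_sum, LinearMap.sum_apply]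
    simp
  have h1 : ∀ t, HasDerivAt (fun t : ℝ => β (expEnd (t • T) a) (expEnd (t • T) b)) 0 t := by
    intro t
    have h2 := HasDerivAt.fun_sum (u := Finset.univ) fun i _ =>
      (hasDerivAt_expEnd T a (B.coord i) t).mul (hasDerivAt_expEnd T b (β (B i)) t)
    refine (h2.congr_deriv ?_).congr_of_eventuallyEq (Eventually.of_forall fun s => hβ _ _)
    rw [Finset.sum_add_distrib, ← hβ, ← hβ, h]
  have h2 := is_const_of_deriv_eq_zero (fun t => (h1 t).differentiableAt) (fun t => (h1 t).deriv) 1 0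
  simpa [expEnd_zero] using h2

end ExpEnd

/-! ### Exponentials of bundle endomorphisms and their commutation with brackets -/

section Flow

variable {EM : Type*} [NormedAddCommGroup EM] [NormedSpace ℝ EM]
  {M : Type*} [TopologicalSpace M] [ChartedSpace EM M]

lemma dirDeriv_comp {W : Type*} [NormedAddCommGroup W] [NormedSpace ℝ W] {G : W → ℝ} {h : M → W}
    {x : M} (hG : DifferentiableAt ℝ G (h x)) (hh : MDifferentiableAt 𝓘(ℝ, EM) 𝓘(ℝ, W) h x)
    (X : TangentSpace 𝓘(ℝ, EM) x) :
    dirDeriv (fun y => G (h y)) x X = fderiv ℝ G (h x) (mfderiv 𝓘(ℝ, EM) 𝓘(ℝ, W) h x X) := by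
  have h1 := HasMFDerivAt.comp x hG.hasFDerivAt.hasMFDerivAt hh.hasMFDerivAt
  unfold dirDeriv
  rw [show (fun y => G (h y)) = G ∘ h from rfl, h1.mfderiv]
  rfl

lemma dirDeriv_clm_comp {W : Type*} [NormedAddCommGroup W] [NormedSpace ℝ W] (G : W →L[ℝ] ℝ)
    {h : M → W} {x : M} (hh : MDifferentiableAt 𝓘(ℝ, EM) 𝓘(ℝ, W) h x)
    (X : TangentSpace 𝓘(ℝ, EM) x) :
    dirDeriv (fun y => G (h y)) x X = G (mfderiv 𝓘(ℝ, EM) 𝓘(ℝ, W) h x X) := by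
  rw [dirDeriv_comp G.differentiableAt hh, G.fderiv]

variable {F : Type*} [NormedAddCommGroup F] [NormedSpace ℝ F]
  {E : M → Type*} [∀ x, AddCommGroup (E x)] [∀ x, Module ℝ (E x)]
  [∀ x, TopologicalSpace (E x)] [TopologicalSpace (TotalSpace F E)]
  [FiberBundle F E] [VectorBundle ℝ F E] [IsManifold 𝓘(ℝ, EM) ∞ M]
  {C : CourantAlgebroid EM F E}
  {x₀ : M} {ι : Type*} [Fintype ι] [DecidableEq ι]

/-- The points at which a dual frame is not cut off. -/
def DualFrame.Good (B : DualFrame C x₀ ι) (y : M) : Prop :=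
  B.p y = 1 ∧ ∀ i j, C.pairing y (B.e i y) (B.t j y) = if i = j then 1 else 0

lemma DualFrame.eventually_good (B : DualFrame C x₀ ι) : ∀ᶠ y in 𝓝 x₀, B.Good y :=
  B.p_one.and B.dual

lemma DualFrame.good_self (B : DualFrame C x₀ ι) : B.Good x₀ := B.eventually_good.self_of_nhds

/-- The coordinates given by a dual frame. -/
def DualFrame.coords (B : DualFrame C x₀ ι) {y : M} (hy : B.Good y) : E y ≃ₗ[ℝ] (ι → ℝ) where
  toFun v i := C.pairing y v (B.t i y)
  map_add' v w := by ext i; simp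
  map_smul' c v := by ext i; simp
  invFun c := ∑ i, c i • B.e i y
  left_inv v := (B.sum_of_p_one hy.1 v).symm
  right_inv c := by ext i; simp [map_sum, hy.2]

lemma DualFrame.coords_apply (B : DualFrame C x₀ ι) {y : M} (hy : B.Good y) (v : E y) (i : ι) :
    B.coords hy v i = C.pairing y v (B.t i y) := rfl

lemma DualFrame.coords_symm_apply (B : DualFrame C x₀ ι) {y : M} (hy : B.Good y) (c : ι → ℝ) :
    (B.coords hy).symm c = ∑ i, c i • B.e i y := rfl

lemma DualFrame.coords_e (B : DualFrame C x₀ ι) {y : M} (hy : B.Good y) (j : ι) :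
    B.coords hy (B.e j y) = Pi.single j 1 := by
  ext i
  rw [B.coords_apply, hy.2, Pi.single_apply]
  simp [eq_comm]

/-- The expansion in the dual frame `t`. -/
lemma DualFrame.pairing_eq_sum (B : DualFrame C x₀ ι) {y : M} (hy : B.p y = 1) (v w : E y) :
    C.pairing y v w = ∑ i, C.pairing y v (B.t i y) * C.pairing y (B.e i y) w := by
  conv_lhs => rw [B.sum_of_p_one hy v]
  simp

/-- The endomorphism of `ℝ^ι` with a given matrix, as a continuous linear function of the
matrix. -/
def matCLM (ι : Type*) [Fintype ι] [DecidableEq ι] : (ι → ι → ℝ) →L[ℝ] ((ι → ℝ) →L[ℝ] (ι → ℝ)) :=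
  LinearMap.toContinuousLinearMap
    { toFun := fun m => LinearMap.toContinuousLinearMap (Matrix.toLin' (Matrix.of m))
      map_add' := fun m m' => by
        rw [← map_add, ← map_add]; rfl
      map_smul' := fun c m => by
        rw [RingHom.id_apply, ← map_smul, ← map_smul]; rfl }

lemma matCLM_apply (m : ι → ι → ℝ) (c : ι → ℝ) (i : ι) : matCLM ι m c i = ∑ j, m i j * c j := by
  simp [matCLM, Matrix.mulVec, dotProduct]

lemma clm_ext_single {A A' : (ι → ℝ) →L[ℝ] (ι → ℝ)}
    (h : ∀ i j, A (Pi.single j 1) i = A' (Pi.single j 1) i) : A = A' := by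
  refine ContinuousLinearMap.coe_injective (LinearMap.pi_ext' fun j =>
    LinearMap.ext_ring (funext fun i => ?_))
  simpa using h i j

variable [FiniteDimensional ℝ EM] [T2Space M] [FiniteDimensional ℝ F]
  [ContMDiffVectorBundle ∞ F E 𝓘(ℝ, EM)]

/-- A tensorial bilinear form on sections is represented by an operator. -/
lemma exists_operator (C : CourantAlgebroid EM F E) (β : Sec EM F E →ₗ[ℝ] Sec EM F E →ₗ[ℝ] Fn EM M)
    (hβ : ∀ (f : Fn EM M) (u v : Sec EM F E) (x : M), β u (fsmul f v) x = f x * β u v x) :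
    ∃ Φ : Sec EM F E →ₗ[ℝ] Sec EM F E, ∀ u v, C.pairS (Φ u) v = β u v := by
  have h1 : ∀ (u : Sec EM F E) (x : M), ∃ w : E x, ∀ v : Sec EM F E,
      C.pairing x w (v x) = β u v x := by
    intro u x
    let B := dualFrame C x
    -- The vector representing `β(u, ·)` at `x`: if `v = ∑ ⟨v, e_i⟩ t_i` then `β(u, v) = ∑ ⟨v, e_i⟩
    -- β(u, t_i)`, which uses linearity over functions in the second entry only.
    refine ⟨∑ i, β u (B.t i) x • B.e i x, fun v => ?_⟩
    have h2 : β u v x = β u (∑ i, fsmul (C.pairS v (B.e i)) (B.t i)) x := by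
      refine tensorial_fn C (β u) (fun f w y => hβ f u w y) ?_
      refine C.ext_pairing fun w => ?_
      rw [sum_apply, C.pairing_symm, B.pairing_eq_sum B.p_one_self]
      simp only [fsmul_apply, map_sum, map_smul, LinearMap.sum_apply, LinearMap.smul_apply,
        smul_eq_mul, CourantAlgebroid.pairS_apply]
      refine Finset.sum_congr rfl fun i _ => ?_
      rw [C.pairing_symm x (v x), C.pairing_symm x (B.t i x), mul_comm]
    rw [h2, map_sum (β u), Fn.sum_apply]
    simp only [hβ, CourantAlgebroid.pairS_apply, map_sum, map_smul, LinearMap.sum_apply,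
      LinearMap.smul_apply, smul_eq_mul]
    refine Finset.sum_congr rfl fun i _ => ?_
    rw [C.pairing_symm x (v x), mul_comm]
  choose w hw using h1
  have hsm : ∀ u, ContMDiff 𝓘(ℝ, EM) (𝓘(ℝ, EM).prod 𝓘(ℝ, F)) ∞
      (fun x => TotalSpace.mk' F x (w u x)) := by
    intro u x
    refine smoothAlongAt_of_pairing (f := fun y : M => y) C contMDiffAt_id fun v => ?_
    simp only [hw]
    exact (β u v).contMDiff x
  refine ⟨⟨⟨fun u => ⟨w u, hsm u⟩, fun u u' => ?_⟩, fun c u => ?_⟩, fun u v => ?_⟩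
  · ext x
    refine C.ext_pairing fun v => ?_
    change C.pairing x (w (u + u') x) (v x) = C.pairing x (w u x + w u' x) (v x)
    rw [map_add, LinearMap.add_apply, hw, hw, hw, map_add]
    rfl
  · ext x
    refine C.ext_pairing fun v => ?_
    change C.pairing x (w (c • u) x) (v x) = C.pairing x (c • w u x) (v x)
    rw [map_smul, LinearMap.smul_apply, hw, hw, map_smul]
    rfl
  · ext x
    exact hw u x v

variable (Φ : Sec EM F E →ₗ[ℝ] Sec EM F E)
  (hΦ : ∀ (f : Fn EM M) (u : Sec EM F E), Φ (fsmul f u) = fsmul f (Φ u))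

/-- The exponential of `t Φ` on the fibre at `x`. -/
def flow (t : ℝ) (x : M) : E x →ₗ[ℝ] E x :=
  haveI : FiniteDimensional ℝ (E x) := VectorBundle.finiteDimensional ℝ F E x
  expEnd (t • pointwise Φ hΦ x)

/-- The matrix of `Φ` in a frame. -/
def DualFrame.mat (B : DualFrame C x₀ ι) (y : M) : (ι → ℝ) →L[ℝ] (ι → ℝ) :=
  matCLM ι fun i j => C.pairS (Φ (B.e j)) (B.t i) y

lemma DualFrame.mat_smooth (B : DualFrame C x₀ ι) :
    ContMDiff 𝓘(ℝ, EM) 𝓘(ℝ, (ι → ℝ) →L[ℝ] (ι → ℝ)) ∞ (B.mat Φ) := by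
  refine (matCLM ι).contMDiff.comp ?_
  refine contMDiff_pi_space.2 fun i => contMDiff_pi_space.2 fun j => ?_
  exact (C.pairS (Φ (B.e j)) (B.t i)).contMDiff

lemma DualFrame.mat_single (B : DualFrame C x₀ ι) (y : M) (i j : ι) :
    B.mat Φ y (Pi.single j 1) i = C.pairing y (Φ (B.e j) y) (B.t i y) := by
  rw [DualFrame.mat, matCLM_apply]
  simp [Pi.single_apply]

lemma DualFrame.mat_coords (hΦ : ∀ (f : Fn EM M) (u : Sec EM F E), Φ (fsmul f u) = fsmul f (Φ u))
    (B : DualFrame C x₀ ι) {y : M} (hy : B.Good y) (u : Sec EM F E) :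
    B.mat Φ y (B.coords hy (u y)) = B.coords hy (Φ u y) := by
  ext i
  rw [DualFrame.mat, matCLM_apply, B.coords_apply, ← pointwise_apply Φ hΦ]
  conv_rhs => rw [B.sum_of_p_one hy.1 (u y), map_sum, map_sum, LinearMap.sum_apply]
  refine Finset.sum_congr rfl fun j _ => ?_
  rw [map_smul, pointwise_apply, map_smul, LinearMap.smul_apply, smul_eq_mul, mul_comm]
  rfl

lemma DualFrame.conjCLM_coords (B : DualFrame C x₀ ι) {y : M} (hy : B.Good y) (t : ℝ) :
    conjCLM (B.coords hy) (t • pointwise Φ hΦ y) = t • B.mat Φ y := by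
  rw [conjCLM_smul]
  congr 1
  refine clm_ext_single fun i j => ?_
  rw [← B.coords_e hy, conjCLM_apply, pointwise_apply, B.mat_coords Φ hΦ hy]

lemma DualFrame.coords_flow (B : DualFrame C x₀ ι) {y : M} (hy : B.Good y) (t : ℝ) (v : E y) :
    B.coords hy (flow Φ hΦ t y v) = NormedSpace.exp (t • B.mat Φ y) (B.coords hy v) := by
  have : FiniteDimensional ℝ (E y) := VectorBundle.finiteDimensional ℝ F E y
  rw [← B.conjCLM_coords Φ hΦ hy]
  exact expEnd_apply (B.coords hy) _ v

variable {EN HN : Type*} [NormedAddCommGroup EN] [NormedSpace ℝ EN] [TopologicalSpace HN]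
  {J : ModelWithCorners ℝ EN HN} {N : Type*} [TopologicalSpace N] [ChartedSpace HN N]

/-- In a dual frame the flow is the exponential of a smooth matrix-valued function, and the
exponential is analytic. The form along maps allows time to be one of the variables, as joint
smoothness of the curve requires. -/
lemma SmoothAlongAt.flow (C : CourantAlgebroid EM F E) {f : N → M} {n₀ : N} {ξ : ∀ n, E (f n)}
    (h : SmoothAlongAt EM F J f ξ n₀) {s : N → ℝ} (hs : ContMDiffAt J 𝓘(ℝ, ℝ) ∞ s n₀) :
    SmoothAlongAt EM F J f (fun n => Courant.flow Φ hΦ (s n) (f n) (ξ n)) n₀ := by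
  let B := dualFrame C (f n₀)
  let κ := Fin (Module.finrank ℝ F)
  have h1 : ContMDiffAt J 𝓘(ℝ, (κ → ℝ) →L[ℝ] (κ → ℝ)) ∞
      (fun n => NormedSpace.exp (s n • B.mat Φ (f n))) n₀ := by
    have h2 : ContMDiffAt J 𝓘(ℝ, (κ → ℝ) →L[ℝ] (κ → ℝ)) ∞ (fun n => s n • B.mat Φ (f n)) n₀ :=
      hs.smul (ContMDiffAt.comp n₀ (g := B.mat Φ) (B.mat_smooth Φ (f n₀)) h.base)
    exact ContMDiffAt.comp n₀ (g := NormedSpace.exp)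
      (NormedSpace.exp_analytic (𝕂 := ℝ) _).contDiffAt.contMDiffAt h2
  have h3 : ContMDiffAt J 𝓘(ℝ, κ → ℝ) ∞
      (fun n => fun i => C.pairing (f n) (ξ n) (B.t i (f n))) n₀ :=
    contMDiffAt_pi_space.2 fun i => h.pairing_section C (B.t i)
  have h4 := contMDiffAt_pi_space.1 (h1.clm_apply h3)
  refine (SmoothAlongAt.sum (s := Finset.univ) h.base (fun i _ => h4 i)
    (fun i _ => SmoothAlongAt.of_section h.base (B.e i))).congr ?_
  filter_upwards [h.base.continuousAt.eventually B.eventually_good] with n hn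
  have h5 := B.coords_flow Φ hΦ hn (s n) (ξ n)
  rw [← LinearEquiv.eq_symm_apply, B.coords_symm_apply] at h5
  exact h5

/-- The exponential of `t Φ` on sections. -/
def flowS (C : CourantAlgebroid EM F E) (t : ℝ) (u : Sec EM F E) : Sec EM F E :=
  ⟨fun x => flow Φ hΦ t x (u x), fun x =>
    SmoothAlongAt.flow Φ hΦ C (f := fun y : M => y) (u.contMDiff x) contMDiffAt_const⟩

lemma flowS_apply (t : ℝ) (u : Sec EM F E) (x : M) :
    flowS Φ hΦ C t u x = flow Φ hΦ t x (u x) := rfl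

lemma flow_neg_apply (t : ℝ) (x : M) (v : E x) : flow Φ hΦ (-t) x (flow Φ hΦ t x v) = v := by
  have : FiniteDimensional ℝ (E x) := VectorBundle.finiteDimensional ℝ F E x
  unfold flow
  rw [neg_smul, expEnd_neg_apply]

lemma flow_apply_neg (t : ℝ) (x : M) (v : E x) : flow Φ hΦ t x (flow Φ hΦ (-t) x v) = v := by
  have := flow_neg_apply Φ hΦ (-t) x v
  rwa [neg_neg] at this

lemma flow_zero (x : M) (v : E x) : flow Φ hΦ 0 x v = v := by
  have : FiniteDimensional ℝ (E x) := VectorBundle.finiteDimensional ℝ F E x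
  unfold flow
  rw [zero_smul, expEnd_zero]
  rfl

lemma hasDerivAt_flow (x : M) (v : E x) (ℓ : E x →ₗ[ℝ] ℝ) (t : ℝ) :
    HasDerivAt (fun t => ℓ (flow Φ hΦ t x v)) (ℓ (pointwise Φ hΦ x (flow Φ hΦ t x v))) t := by
  have : FiniteDimensional ℝ (E x) := VectorBundle.finiteDimensional ℝ F E x
  exact hasDerivAt_expEnd (pointwise Φ hΦ x) v ℓ t

lemma flow_orthogonal (hskew : ∀ (u v : Sec EM F E) (x : M),
      C.pairing x (Φ u x) (v x) + C.pairing x (u x) (Φ v x) = 0) (t : ℝ) (x : M) (a b : E x) :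
    C.pairing x (flow Φ hΦ t x a) (flow Φ hΦ t x b) = C.pairing x a b := by
  have : FiniteDimensional ℝ (E x) := VectorBundle.finiteDimensional ℝ F E x
  refine expEnd_orthogonal _ _ (fun a b => ?_) a b
  obtain ⟨u, rfl⟩ := exists_section (EM := EM) (F := F) x a
  obtain ⟨v, rfl⟩ := exists_section (EM := EM) (F := F) x b
  simp only [LinearMap.smul_apply, pointwise_apply, map_smul]
  rw [← smul_add, hskew, smul_zero]

lemma apply_flow_eq (x : M) (ℓ : E x →ₗ[ℝ] ℝ) (h : ∀ u, ℓ (Φ u x) = 0) (t : ℝ) (v : E x) :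
    ℓ (flow Φ hΦ t x v) = ℓ v := by
  have : FiniteDimensional ℝ (E x) := VectorBundle.finiteDimensional ℝ F E x
  refine apply_expEnd_eq _ _ ℓ fun w => ?_
  obtain ⟨u, rfl⟩ := exists_section (EM := EM) (F := F) x w
  rw [LinearMap.smul_apply, pointwise_apply, map_smul, h, smul_zero]

/-- The derivation `[k, ·]` in the coordinates given by a frame. -/
lemma DualFrame.pairing_bracket (B : DualFrame C x₀ ι) (k u : Sec EM F E) (i : ι) :
    C.pairing x₀ (C.bracket k u x₀) (B.t i x₀) = C.lieS k (C.pairS u (B.t i)) x₀ +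
      matCLM ι (fun i j => C.pairing x₀ (C.bracket k (B.e j) x₀) (B.t i x₀))
        (B.coords B.good_self (u x₀)) i := by
  have hp : C.lieS k B.p x₀ = 0 := dirDeriv_of_eventuallyEq_const (c := 1) B.p_one _
  have h1 := congrArg (fun w => C.bracket k w x₀) (B.fsmul_p u)
  simp only [C.bracket_fsmul, map_sum, sum_apply, add_sec, fsmul_apply, hp, B.p_one_self, one_smul,
    zero_smul, add_zero] at h1
  rw [h1, matCLM_apply]
  simp only [map_sum, map_add, map_smul, LinearMap.sum_apply, LinearMap.add_apply,
    LinearMap.smul_apply, smul_eq_mul, Finset.sum_add_distrib, B.good_self.2, mul_ite, mul_one,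
    mul_zero, Finset.sum_ite_eq', Finset.mem_univ, if_true]
  rw [add_comm]
  congr 1
  exact Finset.sum_congr rfl fun j _ => mul_comm _ _

/-- If `[k, ·]` commutes with `Φ` then it commutes with `exp(tΦ)`. -/
lemma bracket_flowS (k : Sec EM F E) (hk : ∀ u, C.bracket k (Φ u) = Φ (C.bracket k u)) (t : ℝ)
    (u : Sec EM F E) : C.bracket k (flowS Φ hΦ C t u) = flowS Φ hΦ C t (C.bracket k u) := by
  ext x₀
  let B := dualFrame C x₀
  let κ := Fin (Module.finrank ℝ F)
  let A := (κ → ℝ) →L[ℝ] (κ → ℝ)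
  have hg := B.good_self
  set X := C.anchor x₀ (k x₀) with hX
  -- In frame coordinates at `x₀` the derivation `[k, ·]` is the derivative along the anchor of `k`
  -- plus the matrix `Γ`, like a covariant derivative.
  let Γ : A := matCLM κ (fun i j => C.pairing x₀ (C.bracket k (B.e j) x₀) (B.t i x₀))
  have hD : ∀ w : Sec EM F E, B.coords hg (C.bracket k w x₀) =
      (fun i => C.lieS k (C.pairS w (B.t i)) x₀) + Γ (B.coords hg (w x₀)) := fun w => by
    ext i
    exact B.pairing_bracket k w i
  let c : M → κ → ℝ := fun y i => C.pairS u (B.t i) y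
  have hc : ContMDiff 𝓘(ℝ, EM) 𝓘(ℝ, κ → ℝ) ∞ c :=
    contMDiff_pi_space.2 fun i => (C.pairS u (B.t i)).contMDiff
  let m : A := B.mat Φ x₀
  have hmd : MDifferentiableAt 𝓘(ℝ, EM) 𝓘(ℝ, A) (B.mat Φ) x₀ :=
    (B.mat_smooth Φ).mdifferentiableAt (by simp)
  have hcd : MDifferentiableAt 𝓘(ℝ, EM) 𝓘(ℝ, κ → ℝ) c x₀ := hc.mdifferentiableAt (by simp)
  let Y₁ : A := mfderiv 𝓘(ℝ, EM) 𝓘(ℝ, A) (B.mat Φ) x₀ X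
  let Y₂ : κ → ℝ := mfderiv 𝓘(ℝ, EM) 𝓘(ℝ, κ → ℝ) c x₀ X
  have hY₂ : Y₂ = fun i => C.lieS k (C.pairS u (B.t i)) x₀ := by
    ext i
    exact (dirDeriv_clm_comp (ContinuousLinearMap.proj (R := ℝ) (φ := fun _ : κ => ℝ) i) hcd X).symm
  -- The hypothesis that `[k, ·]` commutes with `Φ`, in coordinates: the derivative of the matrix
  -- `m` of `Φ` is a commutator.
  have hY₁ : Y₁ = m * Γ - Γ * m := by
    refine clm_ext_single fun i j => ?_
    have h1 := dirDeriv_clm_comp ((ContinuousLinearMap.proj (R := ℝ) (φ := fun _ : κ => ℝ) i).comp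
      (ContinuousLinearMap.apply ℝ (κ → ℝ) (Pi.single j (1 : ℝ)))) hmd X
    have h2 : Y₁ (Pi.single j 1) i = C.lieS k (C.pairS (Φ (B.e j)) (B.t i)) x₀ := by
      refine h1.symm.trans ?_
      refine dirDeriv_congr (Eventually.of_forall fun y => ?_) _
      exact B.mat_single Φ y i j
    have h3 := congrFun (hD (Φ (B.e j))) i
    rw [hk, Pi.add_apply, ← h2, ← B.mat_coords Φ hΦ hg, ← B.mat_coords Φ hΦ hg, B.coords_e hg] at h3
    have h4 : B.coords hg (C.bracket k (B.e j) x₀) = Γ (Pi.single j 1) := by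
      ext l
      rw [matCLM_apply]
      simp [Pi.single_apply, B.coords_apply]
    rw [h4] at h3
    change _ = m (Γ (Pi.single j 1)) i - Γ (m (Pi.single j 1)) i
    rw [eq_sub_iff_add_eq]
    exact h3.symm
  let R : A := NormedSpace.exp (t • m)
  have hR : ∀ i, C.lieS k (C.pairS (flowS Φ hΦ C t u) (B.t i)) x₀ =
      (((R * Γ - Γ * R) (c x₀)) + R Y₂) i := by
    intro i
    let G : A × (κ → ℝ) → ℝ := fun q => (NormedSpace.exp (t • q.1) q.2) i
    have hGd : HasFDerivAt G ((ContinuousLinearMap.proj (R := ℝ) (φ := fun _ : κ => ℝ) i).comp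
        ((NormedSpace.exp (t • m)).comp (ContinuousLinearMap.snd ℝ A (κ → ℝ)) +
          ((((fderiv ℝ NormedSpace.exp (t • m)).comp
            (t • ContinuousLinearMap.fst ℝ A (κ → ℝ)))).flip (c x₀)))) (m, c x₀) := by
      have h1 : HasFDerivAt (fun q : A × (κ → ℝ) => t • q.1)
          (t • ContinuousLinearMap.fst ℝ A (κ → ℝ)) (m, c x₀) :=
        (ContinuousLinearMap.fst ℝ A (κ → ℝ)).hasFDerivAt.const_smul t
      have h2 : HasFDerivAt (NormedSpace.exp : A → A) (fderiv ℝ NormedSpace.exp (t • m)) (t • m) :=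
        (NormedSpace.exp_analytic (𝕂 := ℝ) _).differentiableAt.hasFDerivAt
      have h3 := HasFDerivAt.clm_apply (h2.comp (m, c x₀) h1)
        (ContinuousLinearMap.snd ℝ A (κ → ℝ)).hasFDerivAt
      exact (ContinuousLinearMap.proj (R := ℝ) (φ := fun _ : κ => ℝ) i).hasFDerivAt.comp _ h3
    have h1 : C.lieS k (C.pairS (flowS Φ hΦ C t u) (B.t i)) x₀ =
        dirDeriv (fun y => G (B.mat Φ y, c y)) x₀ X := by
      refine dirDeriv_congr ?_ _
      filter_upwards [B.eventually_good] with y hy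
      exact congrFun (B.coords_flow Φ hΦ hy t (u y)) i
    have h2 := dirDeriv_comp (G := G) (h := fun y => (B.mat Φ y, c y)) hGd.differentiableAt
      (hmd.prodMk_space hcd) X
    rw [h1, h2, hGd.fderiv]
    have h3 : mfderiv 𝓘(ℝ, EM) 𝓘(ℝ, A × (κ → ℝ)) (fun y => (B.mat Φ y, c y)) x₀ X = (Y₁, Y₂) := by
      have : HasMFDerivAt 𝓘(ℝ, EM) 𝓘(ℝ, A × (κ → ℝ)) (fun y => (B.mat Φ y, c y)) x₀
          ((mfderiv 𝓘(ℝ, EM) 𝓘(ℝ, A) (B.mat Φ) x₀).prod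
            (mfderiv 𝓘(ℝ, EM) 𝓘(ℝ, κ → ℝ) c x₀)) := by
        rw [modelWithCornersSelf_prod, ← chartedSpaceSelf_prod]
        exact HasMFDerivAt.prodMk hmd.hasMFDerivAt hcd.hasMFDerivAt
      rw [this.mfderiv]
      rfl
    rw [h3]
    change ((R Y₂) + (fderiv ℝ NormedSpace.exp (t • m) (t • Y₁)) (c x₀)) i = _
    -- A commutator is exactly the direction in which the derivative of the exponential is explicit
    -- even though the matrices at different points need not commute.
    have h4 : t • Y₁ = (t • m) * Γ - Γ * (t • m) := by
      rw [hY₁, smul_sub, smul_mul_assoc, mul_smul_comm]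
    rw [h4, fderiv_exp_commutator, add_comm]
  apply (B.coords hg).injective
  rw [flowS_apply, B.coords_flow Φ hΦ hg, hD, hD, flowS_apply, B.coords_flow Φ hΦ hg, ← hY₂,
    funext hR]
  change (R (Γ (c x₀)) - Γ (R (c x₀)) + R Y₂) + Γ (R (c x₀)) = R (Y₂ + Γ (c x₀))
  rw [map_add]
  abel

end Flow

/-! ### Tangency of the generalized Ricci tensor to the admissible generalized pseudometrics -/

section Curve

variable {EM : Type*} [NormedAddCommGroup EM] [NormedSpace ℝ EM]
  {M : Type*} [TopologicalSpace M] [ChartedSpace EM M]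
  {F : Type*} [NormedAddCommGroup F] [NormedSpace ℝ F]
  {E : M → Type*} [∀ x, AddCommGroup (E x)] [∀ x, Module ℝ (E x)]
  [∀ x, TopologicalSpace (E x)] [TopologicalSpace (TotalSpace F E)]
  [FiberBundle F E] [VectorBundle ℝ F E] [IsManifold 𝓘(ℝ, EM) ∞ M]
  {C : CourantAlgebroid EM F E}

lemma GenPseudometric.ext_plus {V W : GenPseudometric C} (h : ∀ x, V.plus x = W.plus x) :
    V = W := by
  cases V; cases W
  congr
  exact funext h

variable [FiniteDimensional ℝ EM] [T2Space M] [FiniteDimensional ℝ F]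
  [ContMDiffVectorBundle ∞ F E 𝓘(ℝ, EM)]

lemma GenPseudometric.gricForm_of_mem_minus (V : GenPseudometric C) (div : Divergence C)
    {u : Sec EM F E} (hu : u ∈ V.sectionsMinus) (v : Sec EM F E) : V.gricForm div u v = 0 := by
  rw [gricForm_apply]
  have h : (⟨V.projPlus u, V.projPlus_mem u⟩ : V.sectionsPlus) = 0 := by
    ext1; exact V.projPlus_of_mem_minus hu
  rw [h]
  have := V.gricS_smul_left div 0 0 ⟨V.projMinus v, V.projMinus_mem v⟩
  rwa [zero_smul, zero_smul] at this

section Rotate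

variable (V : GenPseudometric C) (Φ : Sec EM F E →ₗ[ℝ] Sec EM F E)
  (hΦ : ∀ (f : Fn EM M) (u : Sec EM F E), Φ (fsmul f u) = fsmul f (Φ u))
  (hskew : ∀ (u v : Sec EM F E) (x : M),
    C.pairing x (Φ u x) (v x) + C.pairing x (u x) (Φ v x) = 0)

lemma flow_injective (t : ℝ) (x : M) : Function.Injective (flow Φ hΦ t x) := by
  intro v w h
  rw [← flow_neg_apply Φ hΦ t x v, h, flow_neg_apply]

/-- The image of a generalized pseudometric under the exponential of a skew-symmetric operator. -/
def GenPseudometric.rotate (t : ℝ) : GenPseudometric C where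
  plus x := (V.plus x).map (flow Φ hΦ t x)
  exists_frame x₀ := by
    obtain ⟨U, n, e, hU, hx₀, he, hspan⟩ := V.exists_frame x₀
    refine ⟨U, n, fun i x => flow Φ hΦ t x (e i x), hU, hx₀, fun i x hx => ?_, fun x hx => ⟨?_, ?_⟩⟩
    · exact (SmoothAlongAt.flow Φ hΦ C (f := fun y : M => y)
        ((he i).contMDiffAt (hU.mem_nhds hx)) contMDiffAt_const).contMDiffWithinAt
    · exact (hspan x hx).1.map' _ (LinearMap.ker_eq_bot.2 (flow_injective Φ hΦ t x))
    · rw [← (hspan x hx).2, Submodule.map_span, ← range_comp]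
      rfl
  nondegenerate x := by
    rintro _ ⟨a, ha, rfl⟩ h
    rw [V.nondegenerate x a ha fun b hb => ?_, map_zero]
    rw [← flow_orthogonal Φ hΦ hskew t x]
    exact h _ ⟨b, hb, rfl⟩

lemma GenPseudometric.rotate_plus (t : ℝ) (x : M) :
    (V.rotate Φ hΦ hskew t).plus x = (V.plus x).map (flow Φ hΦ t x) := rfl

lemma GenPseudometric.rotate_zero : V.rotate Φ hΦ hskew 0 = V := by
  refine ext_plus fun x => ?_
  rw [rotate_plus, show flow Φ hΦ 0 x = LinearMap.id from LinearMap.ext (flow_zero Φ hΦ x),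
    Submodule.map_id]

lemma GenPseudometric.rotate_smooth : IsSmoothCurve (V.rotate Φ hΦ hskew) := by
  intro p₀
  obtain ⟨U, n, e, hU, hx₀, he, hspan⟩ := V.exists_frame p₀.2
  refine ⟨Prod.snd ⁻¹' U, n, fun i p => flow Φ hΦ p.1 p.2 (e i p.2), hU.preimage continuous_snd,
    hx₀, fun i p hp => ?_, fun p hp => ⟨?_, ?_⟩⟩
  · have h1 : SmoothAlongAt EM F 𝓘(ℝ, EM) (fun y : M => y) (e i) p.2 :=
      (he i).contMDiffAt (hU.mem_nhds hp)
    exact (SmoothAlongAt.flow Φ hΦ C (h1.comp (g := (Prod.snd : ℝ × M → M)) (n' := p)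
      contMDiffAt_snd) contMDiffAt_fst).contMDiffWithinAt
  · exact (hspan p.2 hp).1.map' _ (LinearMap.ker_eq_bot.2 (flow_injective Φ hΦ p.1 p.2))
  · rw [rotate_plus, ← (hspan p.2 hp).2, Submodule.map_span, ← range_comp]
    rfl

/-- The flow is an isometry, so the projection to the image of `V₊` is the conjugate of the
projection to `V₊`. -/
lemma GenPseudometric.rotate_proj (t : ℝ) (x : M) (a : E x) :
    (V.rotate Φ hΦ hskew t).proj x a = flow Φ hΦ t x (V.proj x (flow Φ hΦ (-t) x a)) := by
  refine proj_eq _ ⟨_, V.proj_mem x _, rfl⟩ ?_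
  rw [mem_minus]
  rintro _ ⟨b, hb, rfl⟩
  have h1 : a = flow Φ hΦ t x (flow Φ hΦ (-t) x a) := (flow_apply_neg Φ hΦ t x a).symm
  conv_lhs => rw [h1, ← map_sub, flow_orthogonal Φ hΦ hskew, flow_neg_apply]
  exact V.mem_minus.1 (V.sub_proj_mem x _) b hb

/-- By isometry `⟨P_s a, b⟩ = ⟨P e^{-sΦ} a, e^{-sΦ} b⟩`, with derivative `-⟨PΦa, b⟩ - ⟨a, Φb⟩` at
`0`. The first term vanishes since `b` is in `V₋`, and the second is `⟨Φa, b⟩` by skewness. -/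
lemma GenPseudometric.rotate_velocity (a : V.sectionsPlus) (b : V.sectionsMinus) (x : M) :
    HasDerivAt (fun s => C.pairing x ((V.rotate Φ hΦ hskew s).proj x (a.1 x)) (b.1 x))
      (C.pairing x (Φ a.1 x) (b.1 x)) 0 := by
  have : FiniteDimensional ℝ (E x) := VectorBundle.finiteDimensional ℝ F E x
  let B := Module.finBasis ℝ (E x)
  have h1 : ∀ s, C.pairing x ((V.rotate Φ hΦ hskew s).proj x (a.1 x)) (b.1 x) =
      C.pairing x (V.proj x (flow Φ hΦ (-s) x (a.1 x))) (flow Φ hΦ (-s) x (b.1 x)) := by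
    intro s
    rw [rotate_proj, ← flow_orthogonal Φ hΦ hskew (-s) x, flow_neg_apply]
  have hβ : ∀ v w, C.pairing x (V.proj x v) w = ∑ i, B.coord i v * C.pairing x (V.proj x (B i)) w := by
    intro v w
    conv_lhs => rw [← B.sum_repr v, map_sum, map_sum, LinearMap.sum_apply]
    simp
  have hd : ∀ (v : E x) (ℓ : E x →ₗ[ℝ] ℝ), HasDerivAt (fun s => ℓ (flow Φ hΦ (-s) x v))
      (- ℓ (pointwise Φ hΦ x v)) 0 := by
    intro v ℓ
    have h2 := hasDerivAt_flow Φ hΦ x v ℓ (-0)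
    have h3 := h2.comp (0 : ℝ) (hasDerivAt_neg (0 : ℝ))
    rw [neg_zero, flow_zero] at h3
    exact h3.congr_deriv (mul_neg_one _)
  have h2 := HasDerivAt.fun_sum (u := Finset.univ) fun i _ =>
    (hd (a.1 x) (B.coord i)).mul (hd (b.1 x) (C.pairing x (V.proj x (B i))))
  refine (h2.congr_deriv ?_).congr_of_eventuallyEq
    (Eventually.of_forall fun s => (h1 s).trans (hβ _ _))
  simp only [neg_zero, flow_zero, Finset.sum_add_distrib, neg_mul, mul_neg,
    Finset.sum_neg_distrib]
  rw [← hβ, ← hβ, pointwise_apply, pointwise_apply, V.proj_of_mem (a.2 x)]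
  have h3 := hskew a.1 b.1 x
  have h4 := V.mem_minus.1 (b.2 x) _ (V.proj_mem x (Φ a.1 x))
  linear_combination -h4 - h3

end Rotate

variable {𝔰 : Type*} [LieRing 𝔰] [LieAlgebra ℝ 𝔰] {K : EquivariantStructure C 𝔰}

lemma EquivariantStructure.IsEquivariantDivergence.lieS {div : Divergence C}
    (h : K.IsEquivariantDivergence div) (s : 𝔰) (u : Sec EM F E) :
    C.lieS (K.χ s) (div.toFun u) = div.toFun (C.bracket (K.χ s) u) := by
  ext x; exact h.equivariant s u x

lemma EquivariantStructure.IsAdmissible.preserves {V : GenPseudometric C} (h : K.IsAdmissible V)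
    (s : 𝔰) : V.Preserves (K.χ s) := h.invariant s

lemma EquivariantStructure.IsAdmissible.χ_mem_minus {V : GenPseudometric C} (h : K.IsAdmissible V)
    (s : 𝔰) : K.χ s ∈ V.sectionsMinus := by
  intro x
  rw [V.mem_minus]
  intro a ha
  rw [C.pairing_symm]
  exact h.le_perp x ha s

/-- The generalized Ricci tensor is tangent to the space of admissible generalized
pseudometrics. -/
lemma exists_curve_gric (div : Divergence C) (hdiv : K.IsEquivariantDivergence div)
    (V : {V : GenPseudometric C // K.IsAdmissible V}) :
    ∃ γ : ℝ → {V : GenPseudometric C // K.IsAdmissible V},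
      γ 0 = V ∧ GenPseudometric.IsSmoothCurve (fun t => (γ t).1) ∧
      GenPseudometric.HasVelocityAt (fun t => (γ t).1) 0 ((γ 0).1.GRic div) := by
  obtain ⟨V, hV⟩ := V
  -- Antisymmetrizing makes the resulting operator skew, hence its flow isometric. On `V₊ × V₋` the
  -- flipped term is zero, so the velocity is still `GRic`.
  let β : Sec EM F E →ₗ[ℝ] Sec EM F E →ₗ[ℝ] Fn EM M := V.gricForm div - (V.gricForm div).flip
  have hβ : ∀ u v, β u v = V.gricForm div u v - V.gricForm div v u := fun _ _ => rfl
  obtain ⟨Φ, hβΦ⟩ := exists_operator C β fun f u v x => by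
    rw [hβ, V.gricForm_fsmul_right, V.gricForm_fsmul_left, ← mul_sub]
    rfl
  have hpair : ∀ u v x, C.pairing x (Φ u x) (v x) = β u v x := fun u v x =>
    congrArg (fun f : Fn EM M => f x) (hβΦ u v)
  have hΦ : ∀ (f : Fn EM M) (u : Sec EM F E), Φ (fsmul f u) = fsmul f (Φ u) := by
    intro f u
    ext x
    refine C.ext_pairing fun w => ?_
    rw [fsmul_apply, map_smul, LinearMap.smul_apply, hpair, hpair, hβ, hβ,
      V.gricForm_fsmul_left, V.gricForm_fsmul_right, ← mul_sub]
    rfl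
  have hskew : ∀ (u v : Sec EM F E) (x : M),
      C.pairing x (Φ u x) (v x) + C.pairing x (u x) (Φ v x) = 0 := by
    intro u v x
    rw [C.pairing_symm x (u x), hpair, hpair, hβ, hβ, ← neg_sub (V.gricForm div u v)]
    exact add_neg_cancel _
  -- `Φ` has values in `𝔰_E^⊥`: of the two terms of `β(u, χ(s))`, one vanishes by invariance of all
  -- the data, the other because `χ(s)` has no `V₊` part.
  have hχ : ∀ s u x, C.pairing x (K.χ s x) (Φ u x) = 0 := by
    intro s u x
    rw [C.pairing_symm, hpair, hβ]
    have h1 : V.gricForm div u (K.χ s) = 0 := by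
      rw [GenPseudometric.gricForm_apply,
        ← (hV.preserves s).gricS_eq_zero div (hdiv.lieS s) ⟨V.projPlus u, V.projPlus_mem u⟩
          (hV.χ_mem_minus s)]
      congr 1
      ext1
      exact V.projMinus_of_mem (hV.χ_mem_minus s)
    have h2 : V.gricForm div (K.χ s) u = 0 := V.gricForm_of_mem_minus div (hV.χ_mem_minus s) u
    rw [h1, h2, sub_zero]
    rfl
  -- Both the pairing and `β` obey the product rule under `[χ(s), ·]`, hence so does the operator
  -- that relates them.
  have hcomm : ∀ s u, C.bracket (K.χ s) (Φ u) = Φ (C.bracket (K.χ s) u) := by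
    intro s u
    ext x
    refine C.ext_pairing fun v => ?_
    have h1 := congrArg (fun f : Fn EM M => f x) (C.lieS_pairS (K.χ s) (Φ u) v)
    have h2 : C.lieS (K.χ s) (β u v) = β (C.bracket (K.χ s) u) v + β u (C.bracket (K.χ s) v) := by
      have h3 := (hV.preserves s).lieS_gricForm div (hdiv.lieS s) u v
      have h4 := (hV.preserves s).lieS_gricForm div (hdiv.lieS s) v u
      have h5 := C.lieS_add (K.χ s) (β u v) (V.gricForm div v u)
      rw [hβ, sub_add_cancel] at h5
      rw [hβ, hβ, hβ]
      linear_combination h3 - h4 - h5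
    rw [hβΦ, h2] at h1
    change β (C.bracket (K.χ s) u) v x + β u (C.bracket (K.χ s) v) x =
      C.pairing x (C.bracket (K.χ s) (Φ u) x) (v x) +
        C.pairing x (Φ u x) (C.bracket (K.χ s) v x) at h1
    rw [hpair] at h1 ⊢
    linarith
  have hadm : ∀ t, K.IsAdmissible (V.rotate Φ hΦ hskew t) := by
    intro t
    refine ⟨fun s a ha => ?_, fun x => ?_⟩
    · have ha' : flowS Φ hΦ C (-t) a ∈ V.sectionsPlus := by
        intro x
        obtain ⟨b, hb, hba⟩ := ha x
        rw [flowS_apply, ← hba, flow_neg_apply]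
        exact hb
      have h1 : a = flowS Φ hΦ C t (flowS Φ hΦ C (-t) a) := by
        ext x
        rw [flowS_apply, flowS_apply, flow_apply_neg]
      rw [h1, bracket_flowS Φ hΦ _ (hcomm s)]
      exact fun x => ⟨_, hV.invariant s _ ha' x, rfl⟩
    · rintro _ ⟨b, hb, rfl⟩ s
      rw [apply_flow_eq Φ hΦ x (C.pairing x (K.χ s x)) (fun u => hχ s u x)]
      exact hV.le_perp x hb s
  refine ⟨fun t => ⟨V.rotate Φ hΦ hskew t, hadm t⟩, ?_, V.rotate_smooth Φ hΦ hskew, ?_⟩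
  · exact Subtype.ext (V.rotate_zero Φ hΦ hskew)
  -- The arguments of the velocity are sections for the curve at time `0`, which equals `V` only
  -- propositionally; hence the generalization over `V'`.
  · have key : ∀ V', V' = V → ∀ (a : V'.sectionsPlus) (b : V'.sectionsMinus) (x : M),
        HasDerivAt (fun s => C.pairing x ((V.rotate Φ hΦ hskew s).proj x (a.1 x)) (b.1 x))
          (V'.GRic div a b x) 0 := by
      rintro _ rfl a b x
      refine (GenPseudometric.rotate_velocity _ Φ hΦ hskew a b x).congr_deriv ?_
      rw [hpair, hβ, ← GenPseudometric.gricS_apply, ← GenPseudometric.gricForm_of_mem]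
      have h1 := GenPseudometric.gricForm_of_mem_minus _ div b.2 a.1
      rw [h1, sub_zero]
    exact key _ (V.rotate_zero Φ hΦ hskew)

end Curve

/-! ### Constructing divergences from values on spanning sections -/

section LocalDivergence

variable {EM : Type*} [NormedAddCommGroup EM] [NormedSpace ℝ EM]
  {M : Type*} [TopologicalSpace M] [ChartedSpace EM M]
  {F : Type*} [NormedAddCommGroup F] [NormedSpace ℝ F]
  {E : M → Type*} [∀ x, AddCommGroup (E x)] [∀ x, Module ℝ (E x)]
  [∀ x, TopologicalSpace (E x)] [TopologicalSpace (TotalSpace F E)]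
  [FiberBundle F E] [VectorBundle ℝ F E] [IsManifold 𝓘(ℝ, EM) ∞ M]
  {C : CourantAlgebroid EM F E}

lemma CourantAlgebroid.pairS_fsmul_left (f : Fn EM M) (u v : Sec EM F E) :
    C.pairS (fsmul f u) v = f * C.pairS u v := by
  ext x
  simp

lemma CourantAlgebroid.pairS_add_left (u u' v : Sec EM F E) :
    C.pairS (u + u') v = C.pairS u v + C.pairS u' v := by
  ext x
  simp

lemma CourantAlgebroid.pairS_smul_left (c : ℝ) (u v : Sec EM F E) :
    C.pairS (c • u) v = c • C.pairS u v := by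
  ext x
  simp

/-- The divergence near `x₀` for which the divergences of the sections of a frame are `δ i`. -/
def DualFrame.localDiv {x₀ : M} {ι : Type*} [Fintype ι] [DecidableEq ι] (B : DualFrame C x₀ ι)
    (δ : ι → Fn EM M) : Sec EM F E →ₗ[ℝ] Fn EM M where
  toFun u := ∑ i, (C.pairS u (B.t i) * δ i + C.lieS (B.e i) (C.pairS u (B.t i)))
  map_add' u v := by
    rw [← Finset.sum_add_distrib]
    refine Finset.sum_congr rfl fun i _ => ?_
    rw [C.pairS_add_left, C.lieS_add]
    ring
  map_smul' c u := by
    rw [RingHom.id_apply, Finset.smul_sum]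
    refine Finset.sum_congr rfl fun i _ => ?_
    rw [C.pairS_smul_left, C.lieS_smul, smul_add, smul_mul_assoc]

lemma DualFrame.localDiv_apply {x₀ : M} {ι : Type*} [Fintype ι] [DecidableEq ι]
    (B : DualFrame C x₀ ι) (δ : ι → Fn EM M) (u : Sec EM F E) : B.localDiv δ u =
      ∑ i, (C.pairS u (B.t i) * δ i + C.lieS (B.e i) (C.pairS u (B.t i))) := rfl

variable [FiniteDimensional ℝ EM] [T2Space M] [FiniteDimensional ℝ F]
  [ContMDiffVectorBundle ∞ F E 𝓘(ℝ, EM)]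

/-- A functional on sections that is linear over functions at the point `x` depends only on the
value at `x`. -/
lemma tensorial_at (C : CourantAlgebroid EM F E) (x : M) (φ : Sec EM F E →ₗ[ℝ] ℝ)
    (hφ : ∀ (f : Fn EM M) (u : Sec EM F E), φ (fsmul f u) = f x * φ u)
    {u v : Sec EM F E} (huv : u x = v x) : φ u = φ v := by
  have key : ∀ w : Sec EM F E, w x = 0 → φ w = 0 := by
    intro w hw
    have h1 := congrArg (fun z => φ z) ((dualFrame C x).fsmul_p w)
    simpa [hφ, hw, (dualFrame C x).p_one_self] using h1
  have := key (u - v) (by rw [sub_sec, huv, sub_self])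
  rw [map_sub] at this
  exact sub_eq_zero.1 this

/-- The formula is the one forced by Leibniz on `u = ∑ c_i e_i`, namely `∑ (c_i div e_i + e_i·c_i)`.
Only the value `p x = 1` enters, not the germ of `p`: the anomaly is `∑ c_i (e_i·f)`, which is
pointwise in the frame. -/
lemma DualFrame.localDiv_fsmul {x₀ : M} {ι : Type*} [Fintype ι] [DecidableEq ι]
    (B : DualFrame C x₀ ι) (δ : ι → Fn EM M) (f : Fn EM M) (u : Sec EM F E) {x : M}
    (hx : B.p x = 1) :
    B.localDiv δ (fsmul f u) x = f x * B.localDiv δ u x + C.lieS u f x := by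
  have h1 : C.lieS u f x = ∑ i, C.pairS u (B.t i) x * C.lieS (B.e i) f x := by
    have h2 : C.lieL f (fsmul B.p u) x =
        C.lieL f (∑ i, fsmul (C.pairS u (B.t i)) (B.e i)) x := by rw [B.fsmul_p u]
    rw [map_sum (C.lieL f), Fn.sum_apply] at h2
    simpa only [C.lieL_apply, C.lieS_fsmul_apply, hx, one_mul] using h2
  rw [B.localDiv_apply, B.localDiv_apply, Fn.sum_apply, Fn.sum_apply, Finset.mul_sum, h1,
    ← Finset.sum_add_distrib]
  refine Finset.sum_congr rfl fun i _ => ?_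
  rw [C.pairS_fsmul_left, C.lieS_mul]
  change (f x * _) * _ + (f x * _ + _ * _) = f x * (_ * _ + _) + _
  ring

lemma Divergence.ext_toFun {d d' : Divergence C} (h : ∀ u x, d.toFun u x = d'.toFun u x) :
    d = d' := by
  obtain ⟨d, hd⟩ := d
  obtain ⟨d', hd'⟩ := d'
  congr
  ext u x
  exact h u x

/-- A divergence is determined by its values on sections that span every fibre. -/
lemma Divergence.unique_of_span {S : Set (Sec EM F E)} (hspan : ∀ x (v : E x), ∃ s ∈ S, s x = v)
    {d d' : Divergence C} (h : ∀ s ∈ S, ∀ x, d.toFun s x = d'.toFun s x) : d = d' := by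
  refine ext_toFun fun u x => ?_
  obtain ⟨s, hs, hsu⟩ := hspan x (u x)
  -- The derivative terms cancel in the difference, which is therefore a tensor and is tested at `x`
  -- on the member of `S` with the value `u x`.
  have h1 := tensorial_fn C (d.toFun - d'.toFun) (fun f u y => by
    change d.toFun (fsmul f u) y - d'.toFun (fsmul f u) y = f y * (d.toFun u y - d'.toFun u y)
    rw [d.map_fsmul, d'.map_fsmul]
    ring) hsu
  change d.toFun s x - d'.toFun s x = d.toFun u x - d'.toFun u x at h1
  rw [h s hs, sub_self] at h1
  exact sub_eq_zero.1 h1.symm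

/-- A divergence may be prescribed on sections that span every fibre, if this is possible
locally. -/
lemma exists_divergence (C : CourantAlgebroid EM F E) (S : Set (Sec EM F E × (M → ℝ)))
    (hspan : ∀ x (v : E x), ∃ s ∈ S, s.1 x = v)
    (hloc : ∀ x₀, ∃ (B : DualFrame C x₀ (Fin (Module.finrank ℝ F)))
      (δ : Fin (Module.finrank ℝ F) → Fn EM M),
      ∀ᶠ x in 𝓝 x₀, ∀ s ∈ S, B.localDiv δ s.1 x = s.2 x) :
    ∃ d : Divergence C, ∀ s ∈ S, ∀ x, d.toFun s.1 x = s.2 x := by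
  choose B δ hB using hloc
  -- Two local divergences that agree at `x` on the members of `S` agree at `x` on all sections,
  -- since their difference is tensorial there. So the local solutions fit together, and the glued
  -- divergence may use the frame chosen at each point while still being smooth.
  have key : ∀ x₀ x, (B x₀).p x = 1 → (∀ s ∈ S, (B x₀).localDiv (δ x₀) s.1 x = s.2 x) →
      ∀ u, (B x).localDiv (δ x) u x = (B x₀).localDiv (δ x₀) u x := by
    intro x₀ x hx hS u
    obtain ⟨s, hs, hsu⟩ := hspan x (u x)
    let φ : Sec EM F E →ₗ[ℝ] ℝ :=
      { toFun := fun u => (B x).localDiv (δ x) u x - (B x₀).localDiv (δ x₀) u x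
        map_add' := fun u v => by
          rw [map_add, map_add]
          change ((B x).localDiv (δ x) u x + (B x).localDiv (δ x) v x) -
            ((B x₀).localDiv (δ x₀) u x + (B x₀).localDiv (δ x₀) v x) = _
          ring
        map_smul' := fun c u => by
          rw [map_smul, map_smul]
          change c * (B x).localDiv (δ x) u x - c * (B x₀).localDiv (δ x₀) u x =
            c * ((B x).localDiv (δ x) u x - (B x₀).localDiv (δ x₀) u x)
          ring }
    have h1 := tensorial_at C x φ (fun f u => by
      change (B x).localDiv (δ x) (fsmul f u) x - (B x₀).localDiv (δ x₀) (fsmul f u) x =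
        f x * ((B x).localDiv (δ x) u x - (B x₀).localDiv (δ x₀) u x)
      rw [DualFrame.localDiv_fsmul _ _ _ _ hx, DualFrame.localDiv_fsmul _ _ _ _ (B x).p_one_self]
      ring) hsu
    change (B x).localDiv (δ x) s.1 x - (B x₀).localDiv (δ x₀) s.1 x =
      (B x).localDiv (δ x) u x - (B x₀).localDiv (δ x₀) u x at h1
    rw [hS s hs, (hB x).self_of_nhds s hs, sub_self] at h1
    exact sub_eq_zero.1 h1.symm
  have hsm : ∀ u, ContMDiff 𝓘(ℝ, EM) 𝓘(ℝ, ℝ) ∞ (fun x => (B x).localDiv (δ x) u x) := by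
    intro u x₀
    refine (((B x₀).localDiv (δ x₀) u).contMDiff x₀).congr_of_eventuallyEq ?_
    filter_upwards [(B x₀).p_one, hB x₀] with x hx hS
    exact key x₀ x hx hS u
  refine ⟨⟨⟨⟨fun u => ⟨_, hsm u⟩, fun u v => ?_⟩, fun c u => ?_⟩, fun f u x => ?_⟩, fun s hs x => ?_⟩
  · ext x
    change (B x).localDiv (δ x) (u + v) x = _
    rw [map_add]
    rfl
  · ext x
    change (B x).localDiv (δ x) (c • u) x = _
    rw [map_smul]
    rfl
  · exact (B x).localDiv_fsmul (δ x) f u (B x).p_one_self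
  · exact (hB x).self_of_nhds s hs

/-- A divergence is given near `x₀` by the divergences of the sections of a frame. -/
lemma DualFrame.localDiv_eq {x₀ : M} {ι : Type*} [Fintype ι] [DecidableEq ι]
    (B : DualFrame C x₀ ι) (d : Divergence C) {x : M} (hx : ∀ᶠ y in 𝓝 x, B.p y = 1)
    (u : Sec EM F E) : B.localDiv (fun i => d.toFun (B.e i)) u x = d.toFun u x := by
  have h1 := congrArg (fun w => d.toFun w x) (B.fsmul_p u)
  -- Here `p = 1` is needed near `x`, since applying the divergence to `p u` produces the derivative
  -- of `p`.
  have h2 : C.lieS u B.p x = 0 := dirDeriv_of_eventuallyEq_const hx _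
  simp only [map_sum, Fn.sum_apply, d.map_fsmul] at h1
  rw [hx.self_of_nhds, one_mul] at h1
  change d.toFun u x + C.lieS u B.p x = _ at h1
  rw [h2, add_zero] at h1
  rw [h1, B.localDiv_apply, Fn.sum_apply]
  rfl

end LocalDivergence

/-! ### Pullback of divergences, admissibility and the generalized Ricci tensor -/

section PullbackDiv

variable {EM : Type*} [NormedAddCommGroup EM] [NormedSpace ℝ EM] [FiniteDimensional ℝ EM]
  {M : Type*} [TopologicalSpace M] [ChartedSpace EM M] [IsManifold 𝓘(ℝ, EM) ∞ M] [T2Space M]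
  {F : Type*} [NormedAddCommGroup F] [NormedSpace ℝ F] [FiniteDimensional ℝ F]
  {E : M → Type*} [∀ x, AddCommGroup (E x)] [∀ x, Module ℝ (E x)]
  [∀ x, TopologicalSpace (E x)] [TopologicalSpace (TotalSpace F E)]
  [FiberBundle F E] [VectorBundle ℝ F E] [ContMDiffVectorBundle ∞ F E 𝓘(ℝ, EM)]
  {EM' : Type*} [NormedAddCommGroup EM'] [NormedSpace ℝ EM'] [FiniteDimensional ℝ EM']
  {M' : Type*} [TopologicalSpace M'] [ChartedSpace EM' M'] [IsManifold 𝓘(ℝ, EM') ∞ M']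
  [T2Space M']
  {τ : C^∞⟮𝓘(ℝ, EM'), M'; 𝓘(ℝ, EM), M⟯}
  {C : CourantAlgebroid EM F E} {C' : CourantAlgebroid EM' F (τ *ᵖ E)}

variable (τ) in
/-- The pullback of a smooth function. -/
def pullbackFn (f : Fn EM M) : Fn EM' M' := f.comp τ

namespace IsCAPullback

variable (h : IsCAPullback τ C C')

include h

lemma lieS (u : Sec EM F E) (f : Fn EM M) :
    C'.lieS (pullbackSection τ u) (pullbackFn τ f) = pullbackFn τ (C.lieS u f) := by
  ext x
  have h1 : mfderiv 𝓘(ℝ, EM') 𝓘(ℝ, ℝ) (f ∘ τ) x =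
      (mfderiv 𝓘(ℝ, EM) 𝓘(ℝ, ℝ) f (τ x)).comp (mfderiv 𝓘(ℝ, EM') 𝓘(ℝ, EM) τ x) :=
    mfderiv_comp x (Fn.mdiff f (τ x)) (τ.contMDiff.mdifferentiableAt (by simp))
  have h2 := h.anchor x (u (τ x))
  change mfderiv 𝓘(ℝ, EM') 𝓘(ℝ, ℝ) (f ∘ τ) x (C'.anchor x (u (τ x))) =
    mfderiv 𝓘(ℝ, EM) 𝓘(ℝ, ℝ) f (τ x) (C.anchor (τ x) (u (τ x)))
  rw [h1, ← h2]
  rfl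

lemma pairS (u v : Sec EM F E) :
    C'.pairS (pullbackSection τ u) (pullbackSection τ v) = pullbackFn τ (C.pairS u v) := by
  ext x
  exact h.pairing x _ _

/-- The pullback of a dual frame. -/
def dualFrame {x₀ : M'} {ι : Type*} [Fintype ι] [DecidableEq ι] (B : DualFrame C (τ x₀) ι) :
    DualFrame C' x₀ ι where
  e i := pullbackSection τ (B.e i)
  t i := pullbackSection τ (B.t i)
  p := pullbackFn τ B.p
  p_one := τ.contMDiff.continuous.continuousAt.eventually B.p_one
  sum y v := by
    refine (B.sum (τ y) v).trans (Finset.sum_congr rfl fun i _ => ?_)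
    exact congrArg (fun c : ℝ => c • (B.e i (τ y) : E (τ y))) (h.pairing y v (B.t i (τ y))).symm
  dual := by
    filter_upwards [τ.contMDiff.continuous.continuousAt.eventually B.dual] with y hy i j
    exact (h.pairing y _ _).trans (hy i j)

/-- The pullback of a divergence. -/
lemma exists_pullback_divergence (d : Divergence C) :
    ∃ d' : Divergence C', ∀ d'', IsPullbackDivergence d d'' ↔ d'' = d' := by
  let S : Set (Sec EM' F (τ *ᵖ E) × (M' → ℝ)) :=
    Set.range fun u : Sec EM F E => (pullbackSection τ u, fun x => d.toFun u (τ x))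
  have hspan : ∀ x (v : (τ *ᵖ E) x), ∃ s ∈ S, s.1 x = v := by
    intro x v
    obtain ⟨u, hu⟩ := exists_section (EM := EM) (F := F) (E := E) (τ x) v
    exact ⟨_, ⟨u, rfl⟩, hu⟩
  obtain ⟨d', hd'⟩ := exists_divergence C' S hspan fun x₀ => by
    let B := Courant.dualFrame C (τ x₀)
    -- In the pulled-back frame, with the pulled-back divergences of its members, the local formula
    -- on `τ^*u` is the pullback of the local formula on `u`.
    refine ⟨h.dualFrame B, fun i => pullbackFn τ (d.toFun (B.e i)), ?_⟩
    have h1 := τ.contMDiff.continuous.continuousAt.eventually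
      (eventually_eventually_nhds.2 B.p_one)
    filter_upwards [h1] with x hx
    rintro _ ⟨u, rfl⟩
    change (h.dualFrame B).localDiv _ (pullbackSection τ u) x = d.toFun u (τ x)
    rw [← B.localDiv_eq d hx u, DualFrame.localDiv_apply, DualFrame.localDiv_apply, Fn.sum_apply,
      Fn.sum_apply]
    refine Finset.sum_congr rfl fun i _ => ?_
    change (C'.pairS (pullbackSection τ u) (pullbackSection τ (B.t i)) * _ +
      C'.lieS (pullbackSection τ (B.e i))
        (C'.pairS (pullbackSection τ u) (pullbackSection τ (B.t i)))) x = _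
    rw [h.pairS, h.lieS]
    rfl
  refine ⟨d', fun d'' => ⟨fun hd'' => ?_, fun hd'' => ?_⟩⟩
  · refine Divergence.unique_of_span (S := Prod.fst '' S) (fun x v => ?_) ?_
    · obtain ⟨s, hs, hsv⟩ := hspan x v
      exact ⟨s.1, ⟨s, hs, rfl⟩, hsv⟩
    · rintro _ ⟨_, ⟨u, rfl⟩, rfl⟩ x
      exact (hd'' u x).trans (hd' _ ⟨u, rfl⟩ x).symm
  · subst hd''
    exact fun u x => hd' _ ⟨u, rfl⟩ x

variable {d : Divergence C} {d' : Divergence C'} {𝔰 : Type*} [LieRing 𝔰] [LieAlgebra ℝ 𝔰]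
  {K : EquivariantStructure C 𝔰}

/-- The defect `k·div' u - div' [k, u]` is `C^∞`-linear in `u`, because the anchor is a morphism of
brackets. It vanishes on pulled-back sections, and these span every fibre. -/
lemma equivariantDivergence (hd : K.IsEquivariantDivergence d) (hd' : IsPullbackDivergence d d') :
    (K.pullback h).IsEquivariantDivergence d' := by
  refine ⟨fun s u x => ?_, fun s x => ?_⟩
  · let k := (K.pullback h).χ s
    let φ : Sec EM' F (τ *ᵖ E) →ₗ[ℝ] Fn EM' M' :=
      { toFun := fun u => C'.lieS k (d'.toFun u) - d'.toFun (C'.bracket k u)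
        map_add' := fun u v => by
          simp only [map_add, C'.lieS_add]; abel
        map_smul' := fun c u => by
          simp only [map_smul, C'.lieS_smul, RingHom.id_apply, smul_sub] }
    have hφ : ∀ (f : Fn EM' M') (u : Sec EM' F (τ *ᵖ E)) (x : M'), φ (fsmul f u) x = f x * φ u x := by
      intro f u x
      have h1 : φ (fsmul f u) = f * φ u := by
        change C'.lieS k (d'.toFun (fsmul f u)) - d'.toFun (C'.bracket k (fsmul f u)) =
          f * (C'.lieS k (d'.toFun u) - d'.toFun (C'.bracket k u))
        rw [C'.bracket_fsmul, map_add, d'.map_fsmul', d'.map_fsmul', d'.map_fsmul', C'.lieS_add,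
          C'.lieS_mul]
        linear_combination -C'.lieS_bracket k u f
      rw [h1]
      rfl
    obtain ⟨w, hw⟩ := exists_section (EM := EM) (F := F) (E := E) (τ x) (u x)
    have h1 : φ u x = φ (pullbackSection τ w) x := tensorial_fn C' φ hφ hw.symm
    have h2 : d'.toFun (pullbackSection τ w) = pullbackFn τ (d.toFun w) := by
      ext y; exact hd' w y
    have h3 : d'.toFun (C'.bracket k (pullbackSection τ w)) =
        pullbackFn τ (d.toFun (C.bracket (K.χ s) w)) := by
      change d'.toFun (C'.bracket (pullbackSection τ (K.χ s)) (pullbackSection τ w)) = _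
      rw [h.bracket]
      ext y; exact hd' _ y
    have h4 : φ (pullbackSection τ w) = 0 := by
      change C'.lieS (pullbackSection τ (K.χ s)) _ - _ = 0
      rw [h2, h3, h.lieS, hd.lieS, sub_self]
    rw [h4] at h1
    exact sub_eq_zero.1 h1
  · exact (hd' (K.χ s) x).trans (hd.div_χ s (τ x))

omit [FiniteDimensional ℝ EM] [FiniteDimensional ℝ EM'] [T2Space M] [T2Space M'] in
lemma proj_pullback (V : GenPseudometric C) (x : M') (a : E (τ x)) :
    (V.pullback h).proj x a = V.proj (τ x) a := by
  refine GenPseudometric.proj_eq _ (V.proj_mem (τ x) a) ?_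
  rw [GenPseudometric.mem_minus]
  intro b hb
  exact (h.pairing x _ _).trans (V.mem_minus.1 (V.sub_proj_mem (τ x) a) b hb)

omit [FiniteDimensional ℝ EM] [FiniteDimensional ℝ EM'] [T2Space M] [T2Space M'] in
lemma projPlus_pullback (V : GenPseudometric C) (u : Sec EM F E) :
    (V.pullback h).projPlus (pullbackSection τ u) = pullbackSection τ (V.projPlus u) := by
  ext x
  exact h.proj_pullback V x _

omit [FiniteDimensional ℝ EM] [FiniteDimensional ℝ EM'] [T2Space M] [T2Space M'] in
lemma projMinus_pullback (V : GenPseudometric C) (u : Sec EM F E) :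
    (V.pullback h).projMinus (pullbackSection τ u) = pullbackSection τ (V.projMinus u) := by
  ext x
  have := h.proj_pullback V x (u (τ x))
  exact congrArg (fun w => u (τ x) - w) this

/-- Near a point, sections of `τ^*V₊` are combinations of the sections `τ^*(e_i)₊` with function
coefficients. The bracket with `χ'(s)` preserves such combinations by Leibniz and by the invariance
of `V₊`. -/
lemma admissible {V : GenPseudometric C} (hV : K.IsAdmissible V) :
    (K.pullback h).IsAdmissible (V.pullback h) := by
  refine ⟨fun s a ha x => ?_, fun x a ha s => ?_⟩
  · let B := Courant.dualFrame C (τ x)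
    let B' := h.dualFrame B
    let V' := V.pullback h
    have h1 : fsmul B'.p a = ∑ i, fsmul (C'.pairS a (B'.t i)) (pullbackSection τ (V.projPlus (B.e i))) := by
      have h2 := congrArg V'.projPlus (B'.fsmul_p a)
      rw [V'.projPlus_fsmul, V'.projPlus_of_mem ha, map_sum] at h2
      rw [h2]
      refine Finset.sum_congr rfl fun i _ => ?_
      rw [V'.projPlus_fsmul]
      congr 1
      exact h.projPlus_pullback V _
    have h2 := congrArg (fun w => C'.bracket ((K.pullback h).χ s) w x) h1
    have hp : C'.lieS ((K.pullback h).χ s) B'.p x = 0 :=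
      dirDeriv_of_eventuallyEq_const (c := 1) B'.p_one _
    simp only [C'.bracket_fsmul, map_sum, sum_apply, add_sec, fsmul_apply, hp, B'.p_one_self,
      one_smul, zero_smul, add_zero] at h2
    rw [h2]
    refine Submodule.sum_mem _ fun i _ => Submodule.add_mem _ (Submodule.smul_mem _ _ ?_)
      (Submodule.smul_mem _ _ (V.proj_mem (τ x) _))
    change C'.bracket (pullbackSection τ (K.χ s)) (pullbackSection τ (V.projPlus (B.e i))) x ∈ _
    rw [h.bracket]
    exact hV.invariant s _ (V.projPlus_mem _) (τ x)
  · exact (h.pairing x _ _).trans (hV.le_perp (τ x) ha s)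

/-- The generalized Ricci tensor of a pullback. -/
lemma gricS_pullback (V : GenPseudometric C) (hd' : IsPullbackDivergence d d')
    (a : V.sectionsPlus) (b : V.sectionsMinus)
    (a' : (V.pullback h).sectionsPlus) (b' : (V.pullback h).sectionsMinus)
    (ha : a'.1 = pullbackSection τ a.1) (hb : b'.1 = pullbackSection τ b.1) (x : M') :
    (V.pullback h).gricS d' a' b' x = V.gricS d a b (τ x) := by
  have hd'' : ∀ u, d'.toFun (pullbackSection τ u) = pullbackFn τ (d.toFun u) := fun u => by
    ext y; exact hd' u y
  have h1 : trS C' ((V.pullback h).ricciOp a' b') ((V.pullback h).ricciOp_fsmul a' b') x =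
      trS C (V.ricciOp a b) (V.ricciOp_fsmul a b) (τ x) := by
    let B := Courant.dualFrame C (τ x)
    rw [trS_apply_sum _ _ (h.dualFrame B), trS_apply_sum _ _ B]
    refine Finset.sum_congr rfl fun i _ => ?_
    have h2 : (V.pullback h).ricciOp a' b' (pullbackSection τ (B.e i)) =
        pullbackSection τ (V.ricciOp a b (B.e i)) := by
      rw [GenPseudometric.ricciOp_apply, GenPseudometric.ricciOp_apply, ha, hb,
        h.projPlus_pullback, h.bracket, h.projMinus_pullback, h.bracket, h.projPlus_pullback]
    change C'.pairing x ((V.pullback h).ricciOp a' b' (pullbackSection τ (B.e i)) x) _ = _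
    rw [h2]
    exact h.pairing x _ _
  unfold GenPseudometric.gricS
  change _ - _ - trS C' _ _ x = _ - _ - trS C _ _ (τ x)
  rw [h1, ha, hb, h.bracket, h.projPlus_pullback, hd'', hd'', h.lieS]
  rfl

end IsCAPullback

end PullbackDiv

/-! ### Functions with vanishing derivative -/

section LocallyConstant

variable {EN : Type*} [NormedAddCommGroup EN] [NormedSpace ℝ EN]
  {N : Type*} [TopologicalSpace N] [ChartedSpace EN N] [IsManifold 𝓘(ℝ, EN) ∞ N]
  {W : Type*} [NormedAddCommGroup W] [NormedSpace ℝ W]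

/-- A function with vanishing derivative is locally constant. -/
lemma eventually_eq_of_hasMFDerivAt_zero {f : N → W} {x : N}
    (h : ∀ᶠ y in 𝓝 x, HasMFDerivAt 𝓘(ℝ, EN) 𝓘(ℝ, W) f y 0) : ∀ᶠ y in 𝓝 x, f y = f x := by
  set φ := extChartAt 𝓘(ℝ, EN) x
  have h1 : ∀ᶠ z in 𝓝 (φ x), HasMFDerivAt 𝓘(ℝ, EN) 𝓘(ℝ, W) f (φ.symm z) 0 ∧ z ∈ φ.target :=
    ((by
      have h0 := continuousAt_extChartAt_symm (I := 𝓘(ℝ, EN)) x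
      rwa [ContinuousAt, extChartAt_to_inv] at h0 :
      Tendsto φ.symm (𝓝 (φ x)) (𝓝 x)).eventually h).and (extChartAt_target_mem_nhds x)
  obtain ⟨ε, hε, hball⟩ := Metric.eventually_nhds_iff_ball.1 h1
  have h2 : ∀ z ∈ Metric.ball (φ x) ε, HasFDerivAt (f ∘ φ.symm) (0 : EN →L[ℝ] W) z := by
    intro z hz
    obtain ⟨hz1, hz2⟩ := hball z hz
    have h3 : MDifferentiableAt 𝓘(ℝ, EN) 𝓘(ℝ, EN) φ.symm z :=
      ((contMDiffOn_extChartAt_symm (n := ∞) x).contMDiffAt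
        ((isOpen_extChartAt_target x).mem_nhds hz2)).mdifferentiableAt (by simp)
    have h4 := hz1.comp z h3.hasMFDerivAt
    have h5 := hasMFDerivAt_iff_hasFDerivAt.1 h4
    rwa [show ((0 : TangentSpace 𝓘(ℝ, EN) (φ.symm z) →L[ℝ] TangentSpace 𝓘(ℝ, W) (f (φ.symm z))).comp
      (mfderiv 𝓘(ℝ, EN) 𝓘(ℝ, EN) φ.symm z)) = 0 from ContinuousLinearMap.zero_comp _] at h5
  have h6 : ∀ z ∈ Metric.ball (φ x) ε, f (φ.symm z) = f x := by
    intro z hz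
    have := (convex_ball (φ x) ε).is_const_of_fderivWithin_eq_zero (𝕜 := ℝ)
      (fun z hz => (h2 z hz).differentiableAt.differentiableWithinAt)
      (fun z hz => by
        rw [fderivWithin_of_isOpen Metric.isOpen_ball hz]; exact (h2 z hz).fderiv)
      hz (Metric.mem_ball_self hε)
    simpa [φ] using this
  filter_upwards [(continuousAt_extChartAt (I := 𝓘(ℝ, EN)) x).eventually
    (Metric.ball_mem_nhds _ hε), extChartAt_source_mem_nhds (I := 𝓘(ℝ, EN)) x] with y hy hy'
  rw [← h6 _ hy]
  exact congrArg f (φ.left_inv hy').symm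

lemma eq_of_hasMFDerivAt_zero [PreconnectedSpace N] {f : N → W}
    (h : ∀ y, HasMFDerivAt 𝓘(ℝ, EN) 𝓘(ℝ, W) f y 0) (x y : N) : f x = f y := by
  have : IsLocallyConstant f := (IsLocallyConstant.iff_eventually_eq f).2 fun x =>
    eventually_eq_of_hasMFDerivAt_zero (Eventually.of_forall h)
  exact this.apply_eq_of_preconnectedSpace x y

end LocallyConstant

/-! ### Uniqueness for invariant differential equations on a connected Lie group -/

section GroupLemmas

variable {ES : Type*} [NormedAddCommGroup ES] [NormedSpace ℝ ES]
  {S : Type*} [TopologicalSpace S] [ChartedSpace ES S] [Group S] [LieGroup 𝓘(ℝ, ES) ∞ S]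

lemma hasMFDerivAt_zero_of_dirDeriv_mul {φ : S → ℝ} {g : S}
    (hφ : MDifferentiableAt 𝓘(ℝ, ES) 𝓘(ℝ, ℝ) φ g)
    (h : ∀ s : TangentSpace 𝓘(ℝ, ES) (1 : S), dirDeriv (fun k => φ (g * k)) 1 s = 0) :
    HasMFDerivAt 𝓘(ℝ, ES) 𝓘(ℝ, ℝ) φ g 0 := by
  have h1 : φ = (fun k => φ (g * k)) ∘ (fun k => g⁻¹ * k) := by
    funext k; simp
  have h2 : HasMFDerivAt 𝓘(ℝ, ES) 𝓘(ℝ, ES) (fun k => g⁻¹ * k) g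
      (mfderiv 𝓘(ℝ, ES) 𝓘(ℝ, ES) (fun k => g⁻¹ * k) g) :=
    ((contMDiff_mul_left (I := 𝓘(ℝ, ES)) (n := ∞) (a := g⁻¹)).mdifferentiableAt (by simp)).hasMFDerivAt
  have h3 : HasMFDerivAt 𝓘(ℝ, ES) 𝓘(ℝ, ℝ) (fun k => φ (g * k)) (g⁻¹ * g) 0 := by
    have h4 : MDifferentiableAt 𝓘(ℝ, ES) 𝓘(ℝ, ℝ) (fun k => φ (g * k)) 1 :=
      MDifferentiableAt.comp (g := φ) (1 : S) (by rwa [mul_one])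
        ((contMDiff_mul_left (I := 𝓘(ℝ, ES)) (n := ∞) (a := g)).mdifferentiableAt (by simp))
    rw [inv_mul_cancel]
    have h5 : mfderiv 𝓘(ℝ, ES) 𝓘(ℝ, ℝ) (fun k => φ (g * k)) 1 = 0 :=
      ContinuousLinearMap.ext fun s => h s
    rw [← h5]
    exact h4.hasMFDerivAt
  have h6 := HasMFDerivAt.comp g h3 h2
  rw [← h1] at h6
  exact h6.congr_mfderiv (ContinuousLinearMap.zero_comp _)

/-- Left-invariant fields span every tangent space, so the derivative of `φ` vanishes, and the group
is connected. This is how infinitesimal invariance becomes invariance under the whole group. -/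
lemma eq_one_of_dirDeriv_mul [ConnectedSpace S] {φ : S → ℝ} (hφ : ContMDiff 𝓘(ℝ, ES) 𝓘(ℝ, ℝ) ∞ φ)
    (h : ∀ (g : S) (s : TangentSpace 𝓘(ℝ, ES) (1 : S)), dirDeriv (fun k => φ (g * k)) 1 s = 0)
    (g : S) : φ g = φ 1 :=
  eq_of_hasMFDerivAt_zero (EN := ES)
    (fun g => hasMFDerivAt_zero_of_dirDeriv_mul (hφ.mdifferentiableAt (by simp)) (h g)) g 1

/-- Uniqueness for a linear system of equations along the left-invariant vector fields, in the
presence of fundamental systems of solutions. -/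
lemma eq_zero_of_linear_system [ConnectedSpace S] {n : ℕ}
    (c : TangentSpace 𝓘(ℝ, ES) (1 : S) → Fin n → Fin n → ℝ)
    {Sol : Set (Fin n → S → ℝ)}
    (hsm : ∀ F ∈ Sol, ∀ i, ContMDiff 𝓘(ℝ, ES) 𝓘(ℝ, ℝ) ∞ (F i))
    (hder : ∀ F ∈ Sol, ∀ (g : S) (t : TangentSpace 𝓘(ℝ, ES) (1 : S)) (i : Fin n),
      dirDeriv (fun k => F i (g * k)) 1 t = ∑ l, c t i l * F l g)
    (hfund : ∀ g : S, ∃ m : Fin n → Fin n → S → ℝ, (∀ j, m j ∈ Sol) ∧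
      ∀ i j, m j i g = if i = j then 1 else 0)
    {F : Fin n → S → ℝ} (hF : F ∈ Sol) (h1 : ∀ i, F i 1 = 0) (g : S) (i : Fin n) : F i g = 0 := by
  let Z : Set S := {g | ∀ i, F i g = 0}
  have hclosed : IsClosed Z := by
    have : Z = ⋂ i, F i ⁻¹' {0} := by ext g; simp [Z]
    rw [this]
    exact isClosed_iInter fun i => isClosed_singleton.preimage (hsm F hF i).continuous
  have hopen : IsOpen Z := by
    rw [isOpen_iff_mem_nhds]
    intro g₀ hg₀
    obtain ⟨m, hm, hm₀⟩ := hfund g₀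
    let G : S → Matrix (Fin n) (Fin n) ℝ := fun g => Matrix.of fun i j => m j i g
    have hG : ∀ g i j, ContMDiffAt 𝓘(ℝ, ES) 𝓘(ℝ, ℝ) ∞ (fun g => G g i j) g :=
      fun g i j => hsm _ (hm j) i g
    have hG₀ : G g₀ = 1 := by
      ext i j
      simp [G, hm₀, Matrix.one_apply]
    have hdetc : Continuous fun g => (G g).det :=
      continuous_iff_continuousAt.2 fun g =>
        (GenPseudometric.contMDiffAt_det (EM := ES) (hG g)).continuousAt
    have hdet : ∀ᶠ g in 𝓝 g₀, (G g).det ≠ 0 :=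
      hdetc.continuousAt.eventually_ne (by rw [hG₀, Matrix.det_one]; exact one_ne_zero)
    -- Variation of constants: near `g₀` the solution `F` is written as `∑ y_j m_j` in the
    -- fundamental system that is the identity at `g₀`. As `F` and all `m_j` solve the same linear
    -- system, the coefficients `y_j` have zero derivative, and they vanish at `g₀` if `F` does. So
    -- the zero set is open as well as closed.
    let y : Fin n → S → ℝ := fun i g => ((G g).det)⁻¹ * ((G g).cramer (fun j => F j g) i)
    have hy : ∀ g, (G g).det ≠ 0 → ∀ i, ContMDiffAt 𝓘(ℝ, ES) 𝓘(ℝ, ℝ) ∞ (y i) g := by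
      intro g hg i
      refine ContMDiffAt.mul
        ((GenPseudometric.contMDiffAt_det (EM := ES) (hG g)).inv₀ hg) ?_
      have : (fun g => (G g).cramer (fun j => F j g) i) =
          fun g => ((G g).updateCol i (fun j => F j g)).det := by
        funext x; exact Matrix.cramer_apply _ _ _
      rw [this]
      refine GenPseudometric.contMDiffAt_det (EM := ES) fun k l => ?_
      by_cases hl : l = i
      · subst hl
        simpa using hsm F hF k g
      · simpa [Matrix.updateCol_apply, hl] using hG g k l
    have hmul : ∀ g, (G g).det ≠ 0 → ∀ i, F i g = ∑ j, m j i g * y j g := by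
      intro g hg i
      have h2 := congrFun (Matrix.mulVec_cramer (G g) (fun j => F j g)) i
      simp only [Matrix.mulVec, dotProduct, Pi.smul_apply, smul_eq_mul] at h2
      rw [← mul_right_inj' hg, ← h2, Finset.mul_sum]
      refine Finset.sum_congr rfl fun j _ => ?_
      change G g i j * (G g).cramer (fun j => F j g) j =
        (G g).det * (G g i j * (((G g).det)⁻¹ * (G g).cramer (fun j => F j g) j))
      field_simp
    have hconst : ∀ j, ∀ᶠ g in 𝓝 g₀, y j g = y j g₀ := by
      intro j
      refine eventually_eq_of_hasMFDerivAt_zero (EN := ES) ?_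
      filter_upwards [hdet, eventually_eventually_nhds.2 hdet] with g hg hg'
      refine hasMFDerivAt_zero_of_dirDeriv_mul ((hy g hg j).mdifferentiableAt (by simp)) fun t => ?_
      have hL : ContMDiff 𝓘(ℝ, ES) 𝓘(ℝ, ES) ∞ (fun k : S => g * k) :=
        contMDiff_mul_left (I := 𝓘(ℝ, ES)) (n := ∞) (a := g)
      have e1 : ∀ j, MDifferentiableAt 𝓘(ℝ, ES) 𝓘(ℝ, ℝ) (fun k => y j (g * k)) 1 := fun j =>
        MDifferentiableAt.comp (g := y j) (1 : S)
          (by rw [mul_one]; exact (hy g hg j).mdifferentiableAt (by simp))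
          (hL.mdifferentiableAt (by simp))
      have e2 : ∀ i j, MDifferentiableAt 𝓘(ℝ, ES) 𝓘(ℝ, ℝ) (fun k => m j i (g * k)) 1 := fun i j =>
        ((hsm _ (hm j) i).comp hL).mdifferentiableAt (by simp)
      have e3 : ∀ᶠ k in 𝓝 (1 : S), (G (g * k)).det ≠ 0 := by
        have := hL.continuous.tendsto (1 : S)
        rw [mul_one] at this
        exact this.eventually hg'
      let d : Fin n → ℝ := fun j => dirDeriv (fun k => y j (g * k)) 1 t
      have e4 : ∀ i, ∑ j, m j i g * d j = 0 := by
        intro i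
        have e5 : dirDeriv (fun k => F i (g * k)) 1 t =
            dirDeriv (fun k => ∑ j, m j i (g * k) * y j (g * k)) 1 t := by
          refine dirDeriv_congr ?_ t
          filter_upwards [e3] with k hk
          exact hmul _ hk i
        rw [dirDeriv_sum' (f := fun j k => m j i (g * k) * y j (g * k)) _
          (fun j => (e2 i j).mul (e1 j)), hder F hF] at e5
        simp only [fun j => dirDeriv_mul' (e2 i j) (e1 j) t, hder _ (hm _), mul_one,
          Finset.sum_add_distrib] at e5
        have e6 : ∑ l, c t i l * F l g = ∑ j, y j g * ∑ l, c t i l * m j l g := by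
          simp only [hmul g hg, Finset.mul_sum]
          rw [Finset.sum_comm]
          refine Finset.sum_congr rfl fun j _ => Finset.sum_congr rfl fun l _ => ?_
          ring
        rw [e6] at e5
        linarith
      have e7 : d = 0 := by
        by_contra hd
        exact hg (Matrix.exists_mulVec_eq_zero_iff.1 ⟨d, hd, funext fun i => e4 i⟩)
      exact congrFun e7 j
    have hy₀ : ∀ j, y j g₀ = 0 := by
      intro j
      have : (fun j => F j g₀) = 0 := funext fun j => hg₀ j
      simp only [y, this, map_zero, Pi.zero_apply, mul_zero]
    filter_upwards [hdet, eventually_all.2 hconst] with g hg hc i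
    rw [hmul g hg]
    refine Finset.sum_eq_zero fun j _ => ?_
    rw [hc j, hy₀, mul_zero]
  have hZ : Z = univ := IsClopen.eq_univ ⟨hclosed, hopen⟩ ⟨1, h1⟩
  have : g ∈ Z := by rw [hZ]; trivial
  exact this i

end GroupLemmas

/-! ### Integrated actions: from infinitesimal to group invariance -/

section Integr

variable {EM : Type*} [NormedAddCommGroup EM] [NormedSpace ℝ EM]
  {M : Type*} [TopologicalSpace M] [ChartedSpace EM M]
  {F : Type*} [NormedAddCommGroup F] [NormedSpace ℝ F]
  {E : M → Type*} [∀ x, AddCommGroup (E x)] [∀ x, Module ℝ (E x)]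
  [∀ x, TopologicalSpace (E x)] [TopologicalSpace (TotalSpace F E)]
  [FiberBundle F E] [VectorBundle ℝ F E] [IsManifold 𝓘(ℝ, EM) ∞ M]
  {C : CourantAlgebroid EM F E}
  {ES : Type*} [NormedAddCommGroup ES] [NormedSpace ℝ ES] [CompleteSpace ES]
  {S : Type*} [TopologicalSpace S] [ChartedSpace ES S] [Group S] [LieGroup 𝓘(ℝ, ES) ∞ S]
  [MulAction S M]
  {K : EquivariantStructure C (GroupLieAlgebra 𝓘(ℝ, ES) S)} (L : Integration K)

namespace Integration

/-- The action of `g` as a map from the fibre at `x` to the fibre at `y = gx`. -/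
def actTo (g : S) {x y : M} (h : g • x = y) : E x →ₗ[ℝ] E y := h ▸ L.act g x

lemma mk_actTo (g : S) {x y : M} (h : g • x = y) (a : E x) :
    TotalSpace.mk' F y (L.actTo g h a) = TotalSpace.mk' F (g • x) (L.act g x a) := by
  subst h; rfl

lemma mk_inj {x : M} {a b : E x} (h : TotalSpace.mk' F x a = TotalSpace.mk' F x b) : a = b := by
  have := TotalSpace.mk_inj (F := F) (b := x) (y := a) (y' := b)
  exact this.1 h

@[simp] lemma actTo_one {x : M} (h : (1 : S) • x = x) (a : E x) : L.actTo 1 h a = a :=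
  mk_inj (F := F) ((L.mk_actTo 1 h a).trans (L.act_one x a))

lemma actTo_mul {g k : S} {x y z : M} (h : k • x = y) (h' : g • y = z) (h'' : (g * k) • x = z)
    (a : E x) : L.actTo (g * k) h'' a = L.actTo g h' (L.actTo k h a) := by
  subst h
  subst h'
  exact mk_inj (F := F) ((L.mk_actTo _ _ _).trans (L.act_mul g k x a))

lemma actTo_inv {g : S} {x y : M} (h : g • x = y) (h' : g⁻¹ • y = x) (a : E x) :
    L.actTo g⁻¹ h' (L.actTo g h a) = a := by
  rw [← L.actTo_mul h h' (by rw [inv_mul_cancel, one_smul])]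
  have : ∀ (k : S) (hk : k • x = x), k = 1 → L.actTo k hk a = a := by
    rintro _ hk rfl; exact L.actTo_one hk a
  exact this _ _ (inv_mul_cancel g)

lemma smoothAlong_actTo {EN HN : Type*} [NormedAddCommGroup EN] [NormedSpace ℝ EN]
    [TopologicalSpace HN] {J : ModelWithCorners ℝ EN HN} {N : Type*} [TopologicalSpace N]
    [ChartedSpace HN N] {γ : N → S} {f f' : N → M} {ξ : ∀ n, E (f n)} {n₀ : N}
    (hγ : ContMDiffAt J 𝓘(ℝ, ES) ∞ γ n₀) (hξ : SmoothAlongAt EM F J f ξ n₀)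
    (h : ∀ n, γ n • f n = f' n) :
    SmoothAlongAt EM F J f' (fun n => L.actTo (γ n) (h n) (ξ n)) n₀ := by
  have h1 := (L.act_smooth (γ n₀, TotalSpace.mk' F (f n₀) (ξ n₀))).comp n₀ (hγ.prodMk hξ)
  refine h1.congr_of_eventuallyEq (Eventually.of_forall fun n => ?_)
  exact L.mk_actTo _ _ _

lemma pairing_actTo (g : S) {x y : M} (h : g • x = y) (a : E x) (v : ∀ x, E x) :
    C.pairing (g • x) (L.act g x a) (v (g • x)) = C.pairing y (L.actTo g h a) (v y) := by
  subst h; rfl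

lemma pairing_bracket_χ (s : GroupLieAlgebra 𝓘(ℝ, ES) S) (u v : Sec EM F E) (x : M) :
    C.pairing x (C.bracket (K.χ s) u x) (v x) =
      dirDeriv (fun g : S => C.pairing x (L.actTo g (smul_inv_smul g x) (u (g⁻¹ • x))) (v x)) 1 s := by
  rw [L.bracket_χ]
  congr 1
  funext g
  exact L.pairing_actTo g (smul_inv_smul g x) _ v

section Inv

variable [FiniteDimensional ℝ EM] [T2Space M] [FiniteDimensional ℝ F]
  [ContMDiffVectorBundle ∞ F E 𝓘(ℝ, EM)]

lemma isInvariant_of_actTo {u : Sec EM F E}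
    (h : ∀ (g : S) (x : M), L.actTo g (smul_inv_smul g x) (u (g⁻¹ • x)) = u x) :
    K.IsInvariant u := by
  intro s
  ext x
  refine C.ext_pairing fun w => ?_
  rw [L.pairing_bracket_χ]
  simp only [h]
  rw [dirDeriv_const, zero_sec, map_zero, LinearMap.zero_apply]

variable [ConnectedSpace S] [ContMDiffSMul 𝓘(ℝ, ES) 𝓘(ℝ, EM) ∞ S M]

include L in
lemma dirDeriv_inv_smul (f : Fn EM M) (x : M) (s : GroupLieAlgebra 𝓘(ℝ, ES) S) :
    dirDeriv (fun k : S => f (k⁻¹ • x)) 1 s = C.lieS (K.χ s) f x := by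
  have hsm : ContMDiff 𝓘(ℝ, ES) 𝓘(ℝ, EM) ∞ (fun k : S => k⁻¹ • x) :=
    (contMDiff_inv 𝓘(ℝ, ES) ∞).smul contMDiff_const
  have h2 : HasMFDerivAt 𝓘(ℝ, ES) 𝓘(ℝ, EM) (fun k : S => k⁻¹ • x) 1 _ :=
    (hsm.mdifferentiableAt (by simp)).hasMFDerivAt
  have h3 : HasMFDerivAt 𝓘(ℝ, EM) 𝓘(ℝ, ℝ) f ((1 : S)⁻¹ • x) _ := (Fn.mdiff f _).hasMFDerivAt
  rw [C.lieS_apply]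
  unfold dirDeriv
  rw [show (fun k : S => f (k⁻¹ • x)) = f ∘ fun k : S => k⁻¹ • x from rfl, (h3.comp 1 h2).mfderiv]
  change mfderiv 𝓘(ℝ, EM) 𝓘(ℝ, ℝ) f ((1 : S)⁻¹ • x)
    (mfderiv 𝓘(ℝ, ES) 𝓘(ℝ, EM) (fun k : S => k⁻¹ • x) 1 s) = _
  rw [← L.anchor_χ]
  -- The chain rule lands at `1⁻¹ • x`, which is `x` only propositionally.
  have h5 : ∀ z : M, z = x → mfderiv 𝓘(ℝ, EM) 𝓘(ℝ, ℝ) f z (C.anchor x (K.χ s x) : EM) =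
      (mfderiv 𝓘(ℝ, EM) 𝓘(ℝ, ℝ) f x (C.anchor x (K.χ s x)) : ℝ) := by
    rintro _ rfl; rfl
  exact h5 _ (by simp)

lemma contMDiff_inv_smul (f : Fn EM M) (x : M) :
    ContMDiff 𝓘(ℝ, ES) 𝓘(ℝ, ℝ) ∞ (fun k : S => f (k⁻¹ • x)) := by
  have hsm : ContMDiff 𝓘(ℝ, ES) 𝓘(ℝ, EM) ∞ (fun k : S => k⁻¹ • x) :=
    (contMDiff_inv 𝓘(ℝ, ES) ∞).smul contMDiff_const
  exact f.contMDiff.comp hsm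

include L in
lemma dirDeriv_mul_inv_smul (f : Fn EM M) (g : S) (x : M) (s : GroupLieAlgebra 𝓘(ℝ, ES) S) :
    dirDeriv (fun k : S => f ((g * k)⁻¹ • x)) 1 s = C.lieS (K.χ s) f (g⁻¹ • x) := by
  rw [← L.dirDeriv_inv_smul]
  simp only [mul_inv_rev, mul_smul]

include L in
/-- A smooth function annihilated by the `χ(s)` is invariant. -/
lemma apply_smul_of_lieS {f : Fn EM M} (h : ∀ s, C.lieS (K.χ s) f = 0) (g : S) (x : M) :
    f (g • x) = f x := by
  have key : ∀ g : S, f (g⁻¹ • x) = f ((1 : S)⁻¹ • x) := by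
    refine eq_one_of_dirDeriv_mul (ES := ES) (contMDiff_inv_smul f x) fun g s => ?_
    rw [L.dirDeriv_mul_inv_smul, h]
    rfl
  have h1 := key g⁻¹
  rwa [inv_inv, inv_one, one_smul] at h1

/-- A linear functional on a fibre is a pairing with a vector. -/
lemma _root_.Courant.exists_pairing_eq (C : CourantAlgebroid EM F E) (x : M) (ℓ : E x →ₗ[ℝ] ℝ) :
    ∃ β : E x, ∀ c, ℓ c = C.pairing x c β := by
  have : FiniteDimensional ℝ (E x) := VectorBundle.finiteDimensional ℝ F E _
  have hnd : (C.pairing x).Nondegenerate :=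
    ⟨fun a h => C.pairing_nondegenerate _ a h, fun a h => C.pairing_nondegenerate _ a fun b => by
      rw [C.pairing_symm]; exact h b⟩
  refine ⟨((C.pairing x).toDual hnd).symm ℓ, fun c => ?_⟩
  rw [C.pairing_symm _ c, ← LinearMap.BilinForm.toDual_def hnd, LinearEquiv.apply_symm_apply]

variable (V : GenPseudometric C)

/-- The orthogonal projection to `V₊`, transported by `g`. -/
def conjProj (g : S) (x : M) : E x →ₗ[ℝ] E x :=
  L.actTo g (smul_inv_smul g x) ∘ₗ V.proj (g⁻¹ • x) ∘ₗ L.actTo g⁻¹ rfl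

lemma conjProj_eq {g : S} {x z : M} (h : g • z = x) (h' : g⁻¹ • x = z) (a : E x) :
    L.conjProj V g x a = L.actTo g h (V.proj z (L.actTo g⁻¹ h' a)) := by
  subst h'
  rfl

/-- Along a left-invariant field at `g`, the derivative of the transported projection becomes a
derivative at `1` over the point `g⁻¹x`, where the infinitesimal action is known. -/
lemma conjProj_mul (g k : S) (x : M) (a : E x) : L.conjProj V (g * k) x a =
    L.actTo g (smul_inv_smul g x) (L.conjProj V k (g⁻¹ • x) (L.actTo g⁻¹ rfl a)) := by
  have h1 : (g * k) • k⁻¹ • g⁻¹ • x = x := by simp [mul_smul]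
  have h2 : (g * k)⁻¹ • x = k⁻¹ • g⁻¹ • x := by simp [mul_smul]
  have h3 : L.actTo (g * k)⁻¹ h2 a = L.actTo k⁻¹ rfl (L.actTo g⁻¹ rfl a) := by
    have : ∀ (l : S) (hl : l • x = k⁻¹ • g⁻¹ • x), l = k⁻¹ * g⁻¹ →
        L.actTo l hl a = L.actTo k⁻¹ rfl (L.actTo g⁻¹ rfl a) := by
      rintro _ hl rfl
      exact L.actTo_mul rfl rfl hl a
    exact this _ h2 (mul_inv_rev g k)
  rw [L.conjProj_eq V h1 h2, h3, L.actTo_mul (smul_inv_smul k (g⁻¹ • x)) (smul_inv_smul g x) h1]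
  rfl

lemma conjProj_one (x : M) (a : E x) : L.conjProj V 1 x a = V.proj x a := by
  have h : (1 : S)⁻¹ • x = x := by simp
  rw [L.conjProj_eq V (one_smul S x) h, L.actTo_one]
  have : ∀ (k : S) (hk : k • x = x), k = 1 → L.actTo k hk a = a := by
    rintro _ hk rfl; exact L.actTo_one hk a
  rw [this _ h inv_one]

lemma conjProj_smooth (x : M) (a b : E x) : ContMDiff 𝓘(ℝ, ES) 𝓘(ℝ, ℝ) ∞
    (fun g : S => C.pairing x (L.conjProj V g x a) b) := by
  intro g
  have h1 : SmoothAlongAt EM F 𝓘(ℝ, ES) (fun _ : S => x) (fun _ => a) g := contMDiffAt_const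
  have h2 := L.smoothAlong_actTo (contMDiff_inv 𝓘(ℝ, ES) ∞ g) h1 (f' := fun g => g⁻¹ • x)
    (fun _ => rfl)
  have h3 := SmoothAlongAt.map C h2 V.proj (fun u => ⟨V.projPlus u, fun _ => rfl⟩)
  have h4 := L.smoothAlong_actTo (γ := fun g => g) contMDiffAt_id h3 (f' := fun _ => x)
    (fun g => smul_inv_smul g x)
  have h5 : SmoothAlongAt EM F 𝓘(ℝ, ES) (fun _ : S => x) (fun _ => b) g := contMDiffAt_const
  exact h4.pairing C h5

lemma smooth_actTo_section (x : M) (u : Sec EM F E) (b : E x) : ContMDiff 𝓘(ℝ, ES) 𝓘(ℝ, ℝ) ∞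
    (fun g : S => C.pairing x (L.actTo g (smul_inv_smul g x) (u (g⁻¹ • x))) b) := by
  intro g
  have h1 : ContMDiffAt 𝓘(ℝ, ES) 𝓘(ℝ, EM) ∞ (fun g : S => g⁻¹ • x) g :=
    ((contMDiff_inv 𝓘(ℝ, ES) ∞).smul contMDiff_const) g
  have h4 := L.smoothAlong_actTo (γ := fun g => g) contMDiffAt_id (SmoothAlongAt.of_section h1 u)
    (f' := fun _ => x) (fun g => smul_inv_smul g x)
  have h5 : SmoothAlongAt EM F 𝓘(ℝ, ES) (fun _ : S => x) (fun _ => b) g := contMDiffAt_const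
  exact h4.pairing C h5

/-- Transporting `u₊` by `g` is the same as applying the transported projection to the transport of
`u`. Differentiating at `g = 1` gives `[χ(s), u₊] = (derivative of the projection)(u) + [χ(s), u]₊`,
and the outer terms agree because `[χ(s), ·]` commutes with the projection. -/
lemma dirDeriv_conjProj (hV : ∀ s, V.Preserves (K.χ s)) (x : M) (a b : E x)
    (s : GroupLieAlgebra 𝓘(ℝ, ES) S) :
    dirDeriv (fun g : S => C.pairing x (L.conjProj V g x a) b) 1 s = 0 := by
  obtain ⟨u, rfl⟩ := exists_section (EM := EM) (F := F) x a
  obtain ⟨v, rfl⟩ := exists_section (EM := EM) (F := F) x b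
  let B := dualFrame C x
  have one_sm : ∀ w : Sec EM F E, L.actTo (1 : S) (smul_inv_smul 1 x) (w ((1 : S)⁻¹ • x)) = w x := by
    intro w
    have : ∀ (y : M) (hy : (1 : S) • y = x), y = x → L.actTo (1 : S) hy (w y) = w x := by
      rintro _ hy rfl; exact L.actTo_one hy _
    exact this _ _ (by simp)
  let A : Sec EM F E → S → E x := fun w g => L.actTo g (smul_inv_smul g x) (w (g⁻¹ • x))
  have hA : ∀ (w : Sec EM F E) (b : E x), dirDeriv (fun g : S => C.pairing x (A w g) b) 1 s =
      C.pairing x (C.bracket (K.χ s) w x) b := by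
    intro w b
    obtain ⟨v, rfl⟩ := exists_section (EM := EM) (F := F) x b
    exact (L.pairing_bracket_χ s w v x).symm
  -- Expanding in a fixed basis of the fibre at `x` turns the product of an operator and a vector,
  -- both depending on `g`, into sums of products of real functions, to which the product rule
  -- applies.
  have h1 : ∀ g, C.pairing x (A (V.projPlus u) g) (v x) = ∑ i,
      C.pairing x (A u g) (B.t i x) * C.pairing x (L.conjProj V g x (B.e i x)) (v x) := by
    intro g
    have h2 : A (V.projPlus u) g = L.conjProj V g x (A u g) := by
      change _ = L.actTo g _ (V.proj _ (L.actTo g⁻¹ rfl (L.actTo g _ _)))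
      rw [L.actTo_inv (smul_inv_smul g x) rfl]
      rfl
    rw [h2]
    conv_lhs => rw [B.sum_of_p_one B.p_one_self (A u g)]
    simp [map_sum]
  have h2 := hA (V.projPlus u) (v x)
  simp only [h1] at h2
  rw [dirDeriv_sum' (f := fun i g => C.pairing x (A u g) (B.t i x) *
    C.pairing x (L.conjProj V g x (B.e i x)) (v x)) _
    (fun i => ((L.smooth_actTo_section x u (B.t i x)).mdifferentiableAt
    (by simp)).mul ((L.conjProj_smooth V x (B.e i x) (v x)).mdifferentiableAt (by simp)))] at h2
  have h3 : ∀ i, dirDeriv (fun g : S => C.pairing x (A u g) (B.t i x) *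
      C.pairing x (L.conjProj V g x (B.e i x)) (v x)) 1 s =
      C.pairing x (u x) (B.t i x) *
        dirDeriv (fun g : S => C.pairing x (L.conjProj V g x (B.e i x)) (v x)) 1 s +
      C.pairing x (V.proj x (B.e i x)) (v x) *
        C.pairing x (C.bracket (K.χ s) u x) (B.t i x) := by
    intro i
    rw [dirDeriv_mul' ((L.smooth_actTo_section x u (B.t i x)).mdifferentiableAt (by simp))
      ((L.conjProj_smooth V x (B.e i x) (v x)).mdifferentiableAt (by simp)), hA,
      L.conjProj_one, one_sm u]
  rw [Finset.sum_congr rfl fun i _ => h3 i, Finset.sum_add_distrib] at h2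
  have h4 : ∑ i, C.pairing x (V.proj x (B.e i x)) (v x) *
      C.pairing x (C.bracket (K.χ s) u x) (B.t i x) =
      C.pairing x (V.proj x (C.bracket (K.χ s) u x)) (v x) := by
    conv_rhs => rw [B.sum_of_p_one B.p_one_self (C.bracket (K.χ s) u x)]
    simp [map_sum, mul_comm]
  have h5 : dirDeriv (fun g : S => C.pairing x (L.conjProj V g x (u x)) (v x)) 1 s =
      ∑ i, C.pairing x (u x) (B.t i x) *
        dirDeriv (fun g : S => C.pairing x (L.conjProj V g x (B.e i x)) (v x)) 1 s := by
    have h6 : ∀ g, C.pairing x (L.conjProj V g x (u x)) (v x) = ∑ i, C.pairing x (u x) (B.t i x) *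
        C.pairing x (L.conjProj V g x (B.e i x)) (v x) := by
      intro g
      conv_lhs => rw [B.sum_of_p_one B.p_one_self (u x)]
      simp [map_sum]
    simp only [h6]
    rw [dirDeriv_sum' (f := fun i g => C.pairing x (u x) (B.t i x) *
      C.pairing x (L.conjProj V g x (B.e i x)) (v x)) _ (fun i => mdifferentiableAt_const.mul
      ((L.conjProj_smooth V x (B.e i x) (v x)).mdifferentiableAt (by simp)))]
    refine Finset.sum_congr rfl fun i _ => ?_
    rw [dirDeriv_mul' mdifferentiableAt_const
      ((L.conjProj_smooth V x (B.e i x) (v x)).mdifferentiableAt (by simp)), dirDeriv_const,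
      mul_zero, add_zero]
  rw [h5]
  rw [h4] at h2
  have h7 : C.bracket (K.χ s) (V.projPlus u) x = V.proj x (C.bracket (K.χ s) u x) :=
    congrArg (fun w : Sec EM F E => w x) ((hV s).projPlus u).symm
  rw [h7] at h2
  linarith

/-- The orthogonal projection to an invariant generalized pseudometric is equivariant. -/
lemma proj_actTo (hV : ∀ s, V.Preserves (K.χ s)) {g : S} {x y : M} (h : g • x = y) (a : E x) :
    V.proj y (L.actTo g h a) = L.actTo g h (V.proj x a) := by
  have key : ∀ b : E y, L.conjProj V g y b = V.proj y b := by
    intro b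
    refine C.ext_pairing fun w => ?_
    rw [← L.conjProj_one V y b]
    refine eq_one_of_dirDeriv_mul (L.conjProj_smooth V y b (w y)) (fun g s => ?_) g
    -- Transport by the fixed element `g` followed by a pairing is a linear functional at `g⁻¹y`.
    -- Representing it by a vector there reduces the derivative at `g` to the one at `1`.
    obtain ⟨β, hβ⟩ : ∃ β : E (g⁻¹ • y), ∀ c,
        C.pairing y (L.actTo g (smul_inv_smul g y) c) (w y) = C.pairing (g⁻¹ • y) c β :=
      exists_pairing_eq C (g⁻¹ • y)
        ((C.pairing y).flip (w y) ∘ₗ L.actTo g (smul_inv_smul g y))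
    simp only [L.conjProj_mul, hβ]
    exact L.dirDeriv_conjProj V hV _ _ _ s
  have h' : g⁻¹ • y = x := by rw [← h, inv_smul_smul]
  rw [← key, L.conjProj_eq V h h', L.actTo_inv h h']

lemma actTo_mem_plus (hV : ∀ s, V.Preserves (K.χ s)) {g : S} {x y : M} (h : g • x = y) {a : E x}
    (ha : a ∈ V.plus x) : L.actTo g h a ∈ V.plus y := by
  rw [← V.proj_of_mem ha, ← L.proj_actTo V hV]
  exact V.proj_mem _ _

-- Along the left-invariant field of `t`, the transported section `g u(g⁻¹x)` has derivative equal
-- to the transport of `[χ(t), u]`; this is the defining property of the integration, moved from `1`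
-- to `g`.
omit V in
lemma dirDeriv_actTo_mul (g : S) (x : M) (u : Sec EM F E) (b : E x)
    (t : GroupLieAlgebra 𝓘(ℝ, ES) S) :
    dirDeriv (fun k : S => C.pairing x
      (L.actTo (g * k) (smul_inv_smul (g * k) x) (u ((g * k)⁻¹ • x))) b) 1 t =
    C.pairing x (L.actTo g (smul_inv_smul g x) (C.bracket (K.χ t) u (g⁻¹ • x))) b := by
  obtain ⟨β, hβ⟩ : ∃ β : E (g⁻¹ • x), ∀ c,
      C.pairing x (L.actTo g (smul_inv_smul g x) c) b = C.pairing (g⁻¹ • x) c β :=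
    exists_pairing_eq C (g⁻¹ • x) ((C.pairing x).flip b ∘ₗ L.actTo g (smul_inv_smul g x))
  obtain ⟨v, rfl⟩ := exists_section (EM := EM) (F := F) (g⁻¹ • x) β
  rw [hβ, L.pairing_bracket_χ]
  congr 1
  funext k
  rw [← hβ]
  congr 2
  have : ∀ (z : M) (hz : (g * k) • z = x), z = k⁻¹ • g⁻¹ • x → L.actTo (g * k) hz (u z) =
      L.actTo g (smul_inv_smul g x)
        (L.actTo k (smul_inv_smul k (g⁻¹ • x)) (u (k⁻¹ • g⁻¹ • x))) := by
    rintro _ hz rfl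
    exact L.actTo_mul _ _ hz _
  exact this _ _ (by simp [mul_smul])

variable [FiniteDimensional ℝ ES]

include L in
/-- If an invariant section is orthogonal to the `χ(s)` at `x` then so it is on the orbit of
`x`. -/
lemma mem_perp_smul {u : Sec EM F E} (hu : K.IsInvariant u) {x : M} (hx : u x ∈ K.perp x) (g : S) :
    u (g • x) ∈ K.perp (g • x) := by
  have : FiniteDimensional ℝ (GroupLieAlgebra 𝓘(ℝ, ES) S) := inferInstanceAs (FiniteDimensional ℝ ES)
  let n := Module.finrank ℝ (GroupLieAlgebra 𝓘(ℝ, ES) S)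
  let b := Module.finBasis ℝ (GroupLieAlgebra 𝓘(ℝ, ES) S)
  -- The structure constants. Since `u` is invariant, the functions `g ↦ ⟨χ(b_i), u⟩(g⁻¹x)` satisfy
  -- the linear system with these coefficients, and they vanish at `g = 1`.
  let c : GroupLieAlgebra 𝓘(ℝ, ES) S → Fin n → Fin n → ℝ := fun t i l => b.repr ⁅t, b i⁆ l
  have hc : ∀ t i, K.χ ⁅t, b i⁆ = ∑ l, c t i l • K.χ (b l) := by
    intro t i
    conv_lhs => rw [← b.sum_repr ⁅t, b i⁆, map_sum]
    simp only [map_smul, c]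
    rfl
  let Sol : Set (Fin n → S → ℝ) := {F | (∀ i, ContMDiff 𝓘(ℝ, ES) 𝓘(ℝ, ℝ) ∞ (F i)) ∧
    ∀ (g : S) (t : GroupLieAlgebra 𝓘(ℝ, ES) S) (i : Fin n),
      dirDeriv (fun k => F i (g * k)) 1 t = ∑ l, c t i l * F l g}
  -- Fundamental solutions come from the action itself: the transports of the `χ(b_i)` to the fibre
  -- at `x` solve the same system, and at the given `g` they are independent, so pairing with a
  -- fixed dual system of vectors normalizes them. No formula relating the transport of `χ` to the
  -- adjoint action is needed.
  have hfund : ∀ g : S, ∃ m : Fin n → Fin n → S → ℝ, (∀ j, m j ∈ Sol) ∧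
      ∀ i j, m j i g = if i = j then 1 else 0 := by
    intro g
    let A : Fin n → S → E x := fun i g => L.actTo g (smul_inv_smul g x) (K.χ (b i) (g⁻¹ • x))
    have hA : LinearIndependent ℝ fun i => A i g := by
      rw [Fintype.linearIndependent_iff]
      intro d hd
      have h1 : L.actTo g (smul_inv_smul g x) (K.χ (∑ i, d i • b i) (g⁻¹ • x)) = 0 := by
        rw [← hd, map_sum, sum_apply, map_sum]
        simp [A]
      have h2 := congrArg (L.actTo g⁻¹ rfl) h1
      rw [L.actTo_inv, map_zero] at h2
      exact Fintype.linearIndependent_iff.1 b.linearIndependent d (K.injective _ _ h2)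
    obtain ⟨t, ht⟩ := exists_dual_vectors C _ hA
    refine ⟨fun j i g => C.pairing x (A i g) (t j), fun j => ⟨fun i =>
      L.smooth_actTo_section x _ _, fun g s i => ?_⟩, fun i j => ht i j⟩
    refine (L.dirDeriv_actTo_mul g x (K.χ (b i)) (t j) s).trans ?_
    rw [K.bracket_χ, hc, sum_apply, map_sum, map_sum, LinearMap.sum_apply]
    simp [A]
  have hF : (fun i g => C.pairS (K.χ (b i)) u (g⁻¹ • x)) ∈ Sol := by
    refine ⟨fun i => contMDiff_inv_smul _ x, fun g t i => ?_⟩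
    refine (L.dirDeriv_mul_inv_smul _ g x t).trans ?_
    rw [C.lieS_pairS, hu t, K.bracket_χ, hc]
    change C.pairing (g⁻¹ • x) _ _ + C.pairing (g⁻¹ • x) _ ((0 : Sec EM F E) (g⁻¹ • x)) = _
    rw [zero_sec, map_zero, add_zero, sum_apply, map_sum, LinearMap.sum_apply]
    simp
  have h1 := eq_zero_of_linear_system c (fun F hF => hF.1) (fun F hF => hF.2) hfund hF
    (fun i => by

      rw [inv_one, one_smul]
      exact hx (b i)) g⁻¹
  intro s
  rw [← b.sum_repr s, map_sum, sum_apply, map_sum, LinearMap.sum_apply]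
  refine Finset.sum_eq_zero fun i _ => ?_
  have h2 := h1 i
  simp only [inv_inv] at h2
  rw [map_smul, smul_sec, map_smul, LinearMap.smul_apply]
  change _ • C.pairS (K.χ (b i)) u (g • x) = 0
  rw [h2, smul_zero]

end Inv

end Integration

end Integr

/-! ### Free and proper actions: regularity of the group element along a slice -/

section Slice

variable {EM : Type*} [NormedAddCommGroup EM] [NormedSpace ℝ EM]
  {M : Type*} [TopologicalSpace M] [ChartedSpace EM M] [IsManifold 𝓘(ℝ, EM) ∞ M]
  {ES : Type*} [NormedAddCommGroup ES] [NormedSpace ℝ ES] [CompleteSpace ES]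
  {S : Type*} [TopologicalSpace S] [ChartedSpace ES S] [Group S] [LieGroup 𝓘(ℝ, ES) ∞ S]
  [MulAction S M] [ContMDiffSMul 𝓘(ℝ, ES) 𝓘(ℝ, EM) ∞ S M]

/-- The orbit maps of a free action are immersions at `1`. -/
lemma orbit_immersion (hfree : ∀ (g : S) (x : M), g • x = x → g = 1) (x : M)
    (s : GroupLieAlgebra 𝓘(ℝ, ES) S)
    (hs : mfderiv 𝓘(ℝ, ES) 𝓘(ℝ, EM) (fun g : S => g • x) 1 s = 0) : s = 0 := by
  let o : S → M := fun g => g • x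
  have ho : ContMDiff 𝓘(ℝ, ES) 𝓘(ℝ, EM) ∞ o := contMDiff_id.smul contMDiff_const
  have hod : ∀ g, MDifferentiableAt 𝓘(ℝ, ES) 𝓘(ℝ, EM) o g :=
    fun g => ho.mdifferentiableAt (by simp)
  -- Equivariance of the orbit map spreads the kernel vector at `1` to the whole left-invariant
  -- field.
  have h1 : ∀ g : S, mfderiv 𝓘(ℝ, ES) 𝓘(ℝ, EM) o g (mulInvariantVectorField s g) = 0 := by
    intro g
    have h2 : HasMFDerivAt 𝓘(ℝ, ES) 𝓘(ℝ, ES) (fun k : S => g * k) 1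
        (mfderiv 𝓘(ℝ, ES) 𝓘(ℝ, ES) (fun k : S => g * k) 1) :=
      ((contMDiff_mul_left (I := 𝓘(ℝ, ES)) (n := ∞) (a := g)).mdifferentiableAt
        (by simp)).hasMFDerivAt
    have h3 : HasMFDerivAt 𝓘(ℝ, EM) 𝓘(ℝ, EM) (fun z : M => g • z) (o 1)
        (mfderiv 𝓘(ℝ, EM) 𝓘(ℝ, EM) (fun z : M => g • z) (o 1)) :=
      ((ContMDiffSMul.contMDiff_const_smul (I := 𝓘(ℝ, ES)) (n := ∞) g).mdifferentiableAt
        (by simp)).hasMFDerivAt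
    have h4 := HasMFDerivAt.comp 1 h3 (hod 1).hasMFDerivAt
    have h5 : HasMFDerivAt 𝓘(ℝ, ES) 𝓘(ℝ, EM) (o ∘ fun k : S => g * k) 1 _ :=
      HasMFDerivAt.comp 1 (hod (g * 1)).hasMFDerivAt h2
    have h6 : (o ∘ fun k : S => g * k) = (fun z : M => g • z) ∘ o := by
      funext k; exact mul_smul g k x
    rw [h6] at h5
    have h7 := congrArg (fun A => A s) (hasMFDerivAt_unique h4 h5)
    have h8 : mfderiv 𝓘(ℝ, ES) 𝓘(ℝ, EM) o (g * 1)
        (mfderiv 𝓘(ℝ, ES) 𝓘(ℝ, ES) (fun k : S => g * k) 1 s) = 0 := by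
      refine h7.symm.trans ?_
      change mfderiv 𝓘(ℝ, EM) 𝓘(ℝ, EM) (fun z : M => g • z) (o 1)
        (mfderiv 𝓘(ℝ, ES) 𝓘(ℝ, EM) o 1 s) = 0
      rw [show mfderiv 𝓘(ℝ, ES) 𝓘(ℝ, EM) o 1 s = 0 from hs]
      exact map_zero (mfderiv 𝓘(ℝ, EM) 𝓘(ℝ, EM) (fun z : M => g • z) (o 1))
    have h9 : ∀ k : S, k = g → mfderiv 𝓘(ℝ, ES) 𝓘(ℝ, EM) o k
        (mfderiv 𝓘(ℝ, ES) 𝓘(ℝ, ES) (fun k : S => g * k) 1 s : ES) = (0 : EM) →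
        mfderiv 𝓘(ℝ, ES) 𝓘(ℝ, EM) o g
        (mfderiv 𝓘(ℝ, ES) 𝓘(ℝ, ES) (fun k : S => g * k) 1 s : ES) = (0 : EM) := by
      rintro _ rfl h; exact h
    exact h9 _ (mul_one g) h8
  have hX : ContMDiffAt 𝓘(ℝ, ES) (𝓘(ℝ, ES).prod 𝓘(ℝ, ES)) 1
      (fun g : S => (⟨g, mulInvariantVectorField s g⟩ : TangentBundle 𝓘(ℝ, ES) S)) 1 :=
    ((contMDiff_mulInvariantVectorField s) 1).of_le (by
      rw [minSmoothness_of_isRCLikeNormedField]; norm_num)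
  have : IsManifold 𝓘(ℝ, ES) 1 S := IsManifold.of_le (n := ∞) (by simp)
  obtain ⟨c, hc0, hc⟩ := exists_isMIntegralCurveAt_of_contMDiffAt_boundaryless 0 hX
  -- The orbit map is constant along the integral curve `c`, so `c t` fixes `x` and equals `1` by
  -- freeness. A constant integral curve forces the field to vanish at `1`.
  have h10 : ∀ᶠ t in 𝓝 (0 : ℝ), c t = 1 := by
    let ψ := extChartAt 𝓘(ℝ, EM) (o (c 0))
    have hcont : ContinuousAt (fun t => o (c t)) 0 :=
      (ho.continuous.continuousAt).comp hc.self_of_nhds.continuousAt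
    have hsrc : ∀ᶠ t in 𝓝 (0 : ℝ), o (c t) ∈ (chartAt EM (o (c 0))).source :=
      hcont.eventually ((chartAt EM (o (c 0))).open_source.mem_nhds (mem_chart_source _ _))
    have h11 : ∀ᶠ t in 𝓝 (0 : ℝ), HasMFDerivAt 𝓘(ℝ, ℝ) 𝓘(ℝ, EM) (fun t => ψ (o (c t))) t 0 := by
      filter_upwards [hc, hsrc] with t ht hts
      have h12 := HasMFDerivAt.comp t (hod (c t)).hasMFDerivAt ht
      have h13 : HasMFDerivAt 𝓘(ℝ, EM) 𝓘(ℝ, EM) ψ (o (c t)) _ :=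
        (mdifferentiableAt_extChartAt (I := 𝓘(ℝ, EM)) hts).hasMFDerivAt
      refine (HasMFDerivAt.comp t h13 h12).congr_mfderiv ?_
      refine ContinuousLinearMap.ext fun (r : ℝ) => ?_
      change mfderiv 𝓘(ℝ, EM) 𝓘(ℝ, EM) ψ (o (c t)) (mfderiv 𝓘(ℝ, ES) 𝓘(ℝ, EM) o (c t)
        (r • mulInvariantVectorField s (c t))) = 0
      rw [map_smul, h1, smul_zero]
      exact map_zero (mfderiv 𝓘(ℝ, EM) 𝓘(ℝ, EM) ψ (o (c t)))
    filter_upwards [eventually_eq_of_hasMFDerivAt_zero h11, hsrc] with t ht hts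
    have h14 : o (c t) = o (c 0) := ψ.injOn (by simpa [ψ] using hts) (by simp [ψ]) ht
    refine hfree _ x ?_
    simpa [o, hc0] using h14
  have h15 : HasMFDerivAt 𝓘(ℝ, ℝ) 𝓘(ℝ, ES) c 0 0 :=
    (hasMFDerivAt_const (1 : S) (0 : ℝ)).congr_of_eventuallyEq h10
  have h16 := congrArg (fun A => A (1 : ℝ)) (hasMFDerivAt_unique hc.self_of_nhds h15)
  have h17 : mulInvariantVectorField s (c 0) = 0 := by
    refine Eq.trans ?_ h16
    exact (one_smul ℝ (mulInvariantVectorField s (c 0))).symm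
  have h18 : ∀ g : S, g = 1 → mulInvariantVectorField s g = 0 → s = 0 := by
    rintro _ rfl h
    have h19 : (fun k : S => 1 * k) = id := by funext k; exact one_mul k
    have h20 : mfderiv 𝓘(ℝ, ES) 𝓘(ℝ, ES) (fun k : S => 1 * k) 1 s = 0 := h
    rw [h19, mfderiv_id] at h20
    exact h20
  exact h18 _ hc0 h17

/-- If `z = g(z) s(z)` for a free and proper action, then `g` is continuous where `s(z) = z`. -/
lemma tendsto_of_smul_eq [ProperSMul S M] [T1Space M]
    (hfree : ∀ (g : S) (x : M), g • x = x → g = 1) {s : M → M} {z₁ : M} (hs : ContinuousAt s z₁)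
    (hs₁ : s z₁ = z₁) {g : M → S} (hg : ∀ᶠ z in 𝓝 z₁, g z • s z = z) :
    Tendsto g (𝓝 z₁) (𝓝 1) := by
  intro U hU
  let T : Set (S × M) := Prod.fst ⁻¹' (interior U)ᶜ
  have hT : IsClosed T := isOpen_interior.isClosed_compl.preimage continuous_fst
  have h1 := (ProperSMul.isProperMap_smul_pair (G := S) (X := M)).isClosedMap T hT
  -- A point of `T` over `(z₁, z₁)` would be a group element outside `U` that fixes `z₁`, which
  -- freeness excludes. By properness the image of `T` is closed, hence misses a neighbourhood of
  -- `(z₁, z₁)`.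
  have h2 : (z₁, z₁) ∉ (fun gx : S × M => (gx.1 • gx.2, gx.2)) '' T := by
    rintro ⟨⟨k, z⟩, hk, hkz⟩
    obtain ⟨h3, h4⟩ := Prod.ext_iff.1 hkz
    obtain rfl : z = z₁ := h4
    exact hk (by rw [hfree k z h3]; exact mem_interior_iff_mem_nhds.2 hU)
  have h3 : Tendsto (fun z => (z, s z)) (𝓝 z₁) (𝓝 (z₁, z₁)) := by
    have := continuousAt_id.prodMk hs
    rw [ContinuousAt, hs₁] at this
    exact this
  change ∀ᶠ z in 𝓝 z₁, g z ∈ U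
  filter_upwards [h3.eventually (h1.isOpen_compl.mem_nhds h2), hg] with z hz hgz
  by_contra hgU
  exact hz ⟨(g z, s z), fun h => hgU (interior_subset h), Prod.ext hgz rfl⟩

/-- If `z = g(z) s(z)` for a free and proper action, then `g` is smooth where `s(z) = z`. -/
lemma contMDiffAt_of_smul_eq [ProperSMul S M] [T1Space M] [FiniteDimensional ℝ EM]
    [FiniteDimensional ℝ ES]
    (hfree : ∀ (g : S) (x : M), g • x = x → g = 1) {s : M → M} {z₁ : M}
    (hs : ContMDiffAt 𝓘(ℝ, EM) 𝓘(ℝ, EM) ∞ s z₁)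
    (hs₁ : s z₁ = z₁) {g : M → S} (hg : ∀ᶠ z in 𝓝 z₁, g z • s z = z) :
    ContMDiffAt 𝓘(ℝ, EM) 𝓘(ℝ, ES) ∞ g z₁ := by
  have : CompleteSpace EM := FiniteDimensional.complete ℝ EM
  have hlim := tendsto_of_smul_eq hfree hs.continuousAt hs₁ hg
  have hone : (1 : S) • z₁ = z₁ := one_smul S z₁
  let φ := extChartAt 𝓘(ℝ, ES) (1 : S)
  let ψ := extChartAt 𝓘(ℝ, EM) ((1 : S) • z₁)
  let o : S → M := fun g => g • z₁
  have ho : ContMDiff 𝓘(ℝ, ES) 𝓘(ℝ, EM) ∞ o := contMDiff_id.smul contMDiff_const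
  let D : ES →L[ℝ] EM := mfderiv 𝓘(ℝ, ES) 𝓘(ℝ, EM) o 1
  have hD : HasFDerivAt (ψ ∘ o ∘ φ.symm) D (φ 1) := by
    have h1 : HasFDerivWithinAt (ψ ∘ o ∘ φ.symm) D (range 𝓘(ℝ, ES)) (φ 1) :=
      ((ho 1).mdifferentiableAt (by simp)).hasMFDerivAt.2
    rwa [ModelWithCorners.range_eq_univ, hasFDerivWithinAt_univ] at h1
  have hker : LinearMap.ker (D : ES →ₗ[ℝ] EM) = ⊥ :=
    LinearMap.ker_eq_bot'.2 fun v hv => orbit_immersion hfree z₁ v hv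
  obtain ⟨P, hP⟩ := LinearMap.exists_leftInverse_of_injective (D : ES →ₗ[ℝ] EM) hker
  let Q : EM →L[ℝ] ES := LinearMap.toContinuousLinearMap P
  -- The equation `g s(z) = z` in charts is overdetermined for `g`. Composing with a left inverse
  -- `Q` of the derivative of the orbit map leaves as many equations as unknowns, with invertible
  -- partial derivative, so the implicit function theorem applies. The continuity of `g` established
  -- above places `g(z)` on the branch through `1`.
  let f : EM × ES → ES := fun p => Q (ψ (φ.symm p.2 • s (ψ.symm p.1)) - p.1)
  have hz₁ : z₁ ∈ (chartAt EM ((1 : S) • z₁)).source := by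
    have h : ∀ w, w = z₁ → z₁ ∈ (chartAt EM w).source := by
      rintro _ rfl; exact mem_chart_source _ _
    exact h _ hone
  have hψ₁ : ψ.symm (ψ z₁) = z₁ := ψ.left_inv (by simp [ψ])
  have hφ₁ : φ.symm (φ 1) = 1 := φ.left_inv (by simp [φ])
  have hψ : ContMDiffAt 𝓘(ℝ, EM) 𝓘(ℝ, EM) ∞ ψ z₁ := contMDiffAt_extChartAt' hz₁
  have hψs : ContMDiffAt 𝓘(ℝ, EM) 𝓘(ℝ, EM) ∞ ψ.symm (ψ z₁) :=
    (contMDiffOn_extChartAt_symm _).contMDiffAt ((isOpen_extChartAt_target _).mem_nhds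
      (ψ.map_source (by simp [ψ])))
  have hφs : ContMDiffAt 𝓘(ℝ, ES) 𝓘(ℝ, ES) ∞ φ.symm (φ 1) :=
    (contMDiffOn_extChartAt_symm _).contMDiffAt (extChartAt_target_mem_nhds _)
  have hφ : ContMDiffAt 𝓘(ℝ, ES) 𝓘(ℝ, ES) ∞ φ 1 := contMDiffAt_extChartAt
  let u : EM × ES := (ψ z₁, φ 1)
  have hf : ContDiffAt ℝ ∞ f u := by
    rw [← contMDiffAt_iff_contDiffAt]
    have e1 : ContMDiffAt 𝓘(ℝ, EM × ES) 𝓘(ℝ, EM) ∞ (fun p : EM × ES => p.1) u :=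
      contDiffAt_fst.contMDiffAt
    have e2 : ContMDiffAt 𝓘(ℝ, EM × ES) 𝓘(ℝ, ES) ∞ (fun p : EM × ES => p.2) u :=
      contDiffAt_snd.contMDiffAt
    have e3 : ContMDiffAt 𝓘(ℝ, EM × ES) 𝓘(ℝ, EM) ∞ (fun p : EM × ES => ψ.symm p.1) u :=
      ContMDiffAt.comp u hψs e1
    have e4 : ContMDiffAt 𝓘(ℝ, EM × ES) 𝓘(ℝ, EM) ∞ (fun p : EM × ES => s (ψ.symm p.1)) u :=
      ContMDiffAt.comp (g := s) u (by
        change ContMDiffAt _ _ _ s (ψ.symm (ψ z₁))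
        rwa [hψ₁]) e3
    have e5 : ContMDiffAt 𝓘(ℝ, EM × ES) 𝓘(ℝ, ES) ∞ (fun p : EM × ES => φ.symm p.2) u :=
      ContMDiffAt.comp u hφs e2
    have e6 : ContMDiffAt 𝓘(ℝ, EM × ES) 𝓘(ℝ, EM) ∞
        (fun p : EM × ES => φ.symm p.2 • s (ψ.symm p.1)) u := e5.smul e4
    have e7 : ContMDiffAt 𝓘(ℝ, EM × ES) 𝓘(ℝ, EM) ∞
        (fun p : EM × ES => ψ (φ.symm p.2 • s (ψ.symm p.1))) u :=
      ContMDiffAt.comp (g := ψ) u (by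
        change ContMDiffAt _ _ _ ψ (φ.symm (φ 1) • s (ψ.symm (ψ z₁)))
        rwa [hψ₁, hφ₁, hs₁, hone]) e6
    exact Q.contMDiff.contMDiffAt.comp u (e7.sub e1)
  have hinv : (fderiv ℝ f u ∘L .inr ℝ EM ES).IsInvertible := by
    have h1 : HasFDerivAt (fun ξ => f (ψ z₁, ξ)) (fderiv ℝ f u ∘L .inr ℝ EM ES) (φ 1) :=
      (hf.differentiableAt (by simp)).hasFDerivAt.comp (φ 1) (hasFDerivAt_prodMk_right (ψ z₁) (φ 1))
    have h2 : HasFDerivAt (fun ξ => f (ψ z₁, ξ)) (Q ∘L D) (φ 1) := by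
      have h3 := Q.hasFDerivAt.comp (φ 1) (hD.sub_const (ψ z₁))
      refine h3.congr_of_eventuallyEq (Eventually.of_forall fun ξ => ?_)
      simp only [f, o, Function.comp_apply, hψ₁, hs₁]
    have h4 : Q ∘L D = ContinuousLinearMap.id ℝ ES := by
      ext v
      exact LinearMap.congr_fun hP v
    rw [h1.unique h2, h4]
    exact ContinuousLinearMap.isInvertible_equiv (f := ContinuousLinearEquiv.refl ℝ ES)
  have hfu : f u = 0 := by
    simp only [f, u, hψ₁, hφ₁, hs₁, hone, sub_self, map_zero]
  let ι := hf.implicitFunction (by simp) hinv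
  have hι : ContDiffAt ℝ ∞ ι (ψ z₁) := hf.contDiffAt_implicitFunction (by simp) hinv
  have hι₁ : ι (ψ z₁) = φ 1 := hf.implicitFunction_apply_self (by simp) hinv
  have hg₁ : Tendsto (fun z => (ψ z, φ (g z))) (𝓝 z₁) (𝓝 u) :=
    hψ.continuousAt.prodMk_nhds (hφ.continuousAt.tendsto.comp hlim)
  have hgι : g =ᶠ[𝓝 z₁] fun z => φ.symm (ι (ψ z)) := by
    filter_upwards [hg₁.eventually (hf.eventually_apply_eq_iff_implicitFunction (by simp) hinv), hg,
      (chartAt EM ((1 : S) • z₁)).open_source.mem_nhds hz₁,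
      hlim.eventually (extChartAt_source_mem_nhds (I := 𝓘(ℝ, ES)) (1 : S))] with z h1 h2 h3 h4
    have h5 : φ.symm (φ (g z)) = g z := φ.left_inv h4
    have h6 : ψ.symm (ψ z) = z := ψ.left_inv (by simpa [ψ] using h3)
    have h7 : ι (ψ z) = φ (g z) := h1.1 (by
      rw [hfu]
      simp only [f, h5, h6, h2, sub_self, map_zero])
    rw [h7, h5]
  refine ContMDiffAt.congr_of_eventuallyEq ?_ hgι
  have h1 : ContMDiffAt 𝓘(ℝ, EM) 𝓘(ℝ, ES) ∞ (fun z => ι (ψ z)) z₁ :=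
    ContMDiffAt.comp (g := ι) z₁ hι.contMDiffAt hψ
  exact ContMDiffAt.comp (g := φ.symm) z₁ (by rwa [hι₁]) h1

end Slice

/-! ### Local sections of submersions -/

section LocalSection

variable {EM : Type*} [NormedAddCommGroup EM] [NormedSpace ℝ EM]
  {M : Type*} [TopologicalSpace M] [ChartedSpace EM M] [IsManifold 𝓘(ℝ, EM) ∞ M]
  {EN : Type*} [NormedAddCommGroup EN] [NormedSpace ℝ EN]
  {N : Type*} [TopologicalSpace N] [ChartedSpace EN N] [IsManifold 𝓘(ℝ, EN) ∞ N]

/-- Submersions have local sections. -/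
lemma exists_local_section {f : M → N} (hf : Manifold.IsSubmersion 𝓘(ℝ, EM) 𝓘(ℝ, EN) ∞ f)
    (x₀ : M) : ∃ (U : Set N) (σ : N → M), IsOpen U ∧ f x₀ ∈ U ∧
      ContMDiffOn 𝓘(ℝ, EN) 𝓘(ℝ, EM) ∞ σ U ∧ (∀ y ∈ U, f (σ y) = y) ∧ σ (f x₀) = x₀ := by
  have h := hf.isSubmersionAt x₀
  let φ := h.domChart
  let ψ := h.codChart
  -- The complementary coordinate is frozen at that of `x₀`, so that the section passes through
  -- `x₀`.
  let c := (h.equiv (φ x₀)).2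
  let j : EN → EM := fun w => h.equiv.symm (w, c)
  have hj : ContDiff ℝ ∞ j := h.equiv.symm.contDiff.comp (contDiff_id.prodMk contDiff_const)
  have hw : ∀ z ∈ φ.target, ψ (f (φ.symm z)) = (h.equiv z).1 := by
    intro z hz
    have := h.writtenInCharts (show z ∈ (h.domChart.extend 𝓘(ℝ, EM)).target by simpa using hz)
    simpa using this
  have hψx : j (ψ (f x₀)) = φ x₀ := by
    have h1 := hw (φ x₀) (φ.map_source h.mem_domChart_source)
    rw [φ.left_inv h.mem_domChart_source] at h1
    change h.equiv.symm (ψ (f x₀), c) = φ x₀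
    rw [h1]
    exact h.equiv.symm_apply_apply _
  refine ⟨ψ.source ∩ ψ ⁻¹' (j ⁻¹' φ.target), fun y => φ.symm (j (ψ y)),
    ψ.continuousOn.isOpen_inter_preimage ψ.open_source (φ.open_target.preimage hj.continuous),
    ⟨h.mem_codChart_source, ?_⟩, ?_, ?_, ?_⟩
  · change j (ψ (f x₀)) ∈ φ.target
    rw [hψx]
    exact φ.map_source h.mem_domChart_source
  · have h1 : ContMDiffOn 𝓘(ℝ, EN) 𝓘(ℝ, EN) ∞ ψ ψ.source :=
      contMDiffOn_of_mem_maximalAtlas h.codChart_mem_maximalAtlas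
    have h2 : ContMDiffOn 𝓘(ℝ, EM) 𝓘(ℝ, EM) ∞ φ.symm φ.target :=
      contMDiffOn_symm_of_mem_maximalAtlas h.domChart_mem_maximalAtlas
    exact h2.comp (hj.contMDiff.comp_contMDiffOn (h1.mono inter_subset_left)) fun y hy => hy.2
  · intro y hy
    refine ψ.injOn (h.source_subset_preimage_source (φ.map_target hy.2)) hy.1 ?_
    rw [hw _ hy.2]
    change (h.equiv (h.equiv.symm (ψ y, c))).1 = ψ y
    rw [h.equiv.apply_symm_apply]
  · change φ.symm (j (ψ (f x₀))) = x₀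
    rw [hψx, φ.left_inv h.mem_domChart_source]

end LocalSection

/-! ### Descending functions and sections, and lifting reduced vectors to invariant sections -/

section Red

variable {EM : Type*} [NormedAddCommGroup EM] [NormedSpace ℝ EM]
  {M : Type*} [TopologicalSpace M] [ChartedSpace EM M]
  {F : Type*} [NormedAddCommGroup F] [NormedSpace ℝ F]
  {E : M → Type*} [∀ x, AddCommGroup (E x)] [∀ x, Module ℝ (E x)]
  [∀ x, TopologicalSpace (E x)] [TopologicalSpace (TotalSpace F E)]
  [FiberBundle F E] [VectorBundle ℝ F E] [IsManifold 𝓘(ℝ, EM) ∞ M]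
  {C : CourantAlgebroid EM F E}
  {ES : Type*} [NormedAddCommGroup ES] [NormedSpace ℝ ES] [CompleteSpace ES]
  {S : Type*} [TopologicalSpace S] [ChartedSpace ES S] [Group S] [LieGroup 𝓘(ℝ, ES) ∞ S]
  [MulAction S M]
  {K : EquivariantStructure C (GroupLieAlgebra 𝓘(ℝ, ES) S)} {L : Integration K}
  {EMr : Type*} [NormedAddCommGroup EMr] [NormedSpace ℝ EMr]
  {Mr : Type*} [TopologicalSpace Mr] [ChartedSpace EMr Mr]
  {Fr : Type*} [NormedAddCommGroup Fr] [NormedSpace ℝ Fr]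
  {Er : Mr → Type*} [∀ y, AddCommGroup (Er y)] [∀ y, Module ℝ (Er y)]
  [∀ y, TopologicalSpace (Er y)] [TopologicalSpace (TotalSpace Fr Er)]
  [FiberBundle Fr Er] [VectorBundle ℝ Fr Er] [IsManifold 𝓘(ℝ, EMr) ∞ Mr]
  {Cr : CourantAlgebroid EMr Fr Er}

lemma mk_total_inj {x : M} {a b : E x} (h : TotalSpace.mk' F x a = TotalSpace.mk' F x b) : a = b :=
  (TotalSpace.mk_inj (F := F) (b := x) (y := a) (y' := b)).1 h

namespace Reduction

variable (R : Reduction L Cr)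

lemma pr_smooth : ContMDiff 𝓘(ℝ, EM) 𝓘(ℝ, EMr) ∞ R.pr :=
  fun x => (R.isSubmersion.isSubmersionAt x).contMDiffAt

lemma pr_smul (g : S) (x : M) : R.pr (g • x) = R.pr x :=
  ((R.pr_eq_iff x (g • x)).2 ⟨g, rfl⟩).symm

/-- The quotient map from the fibre at `x` to the fibre at `y = pr x`. -/
def qTo {x : M} {y : Mr} (h : R.pr x = y) : K.perp x →ₗ[ℝ] Er y := h ▸ R.q x

lemma mk_qTo {x : M} {y : Mr} (h : R.pr x = y) (a : K.perp x) :
    TotalSpace.mk' Fr y (R.qTo h a) = TotalSpace.mk' Fr (R.pr x) (R.q x a) := by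
  subst h; rfl

lemma qTo_actTo {g : S} {x x' : M} (h : g • x = x') {y : Mr} (hx : R.pr x = y) (hx' : R.pr x' = y)
    {a : K.perp x} {b : K.perp x'} (hb : (b : E x') = L.actTo g h a) :
    R.qTo hx' b = R.qTo hx a := by
  refine mk_total_inj (F := Fr) ?_
  rw [R.mk_qTo, R.mk_qTo]
  subst h
  exact R.q_act g x a b hb

lemma pairing_qTo {x : M} {y : Mr} (h : R.pr x = y) (a b : K.perp x) :
    Cr.pairing y (R.qTo h a) (R.qTo h b) = C.pairing x a b := by
  subst h; exact R.pairing x a b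

lemma exists_smul_of_pr_eq {x x' : M} (h : R.pr x = R.pr x') : ∃ g : S, g • x = x' :=
  (R.pr_eq_iff x x').1 h

/-- A right inverse of the projection. -/
def lift (y : Mr) : M := (R.surjective y).choose

lemma pr_lift (y : Mr) : R.pr (R.lift y) = y := (R.surjective y).choose_spec

/-- Smooth functions constant on the orbits descend. -/
lemma exists_descend_fn {f : Fn EM M} (hf : ∀ (g : S) (x : M), f (g • x) = f x) :
    ∃ r : Fn EMr Mr, ∀ x, r (R.pr x) = f x := by
  have h1 : ∀ x x', R.pr x = R.pr x' → f x = f x' := by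
    intro x x' h
    obtain ⟨g, rfl⟩ := R.exists_smul_of_pr_eq h
    exact (hf g x).symm
  refine ⟨⟨fun y => f (R.lift y), fun y => ?_⟩, fun x => h1 _ _ (R.pr_lift _)⟩
  obtain ⟨U, σ, hU, hy, hσ, hpr, -⟩ := exists_local_section R.isSubmersion (R.lift y)
  rw [R.pr_lift] at hy
  have h2 : ContMDiffAt 𝓘(ℝ, EMr) 𝓘(ℝ, ℝ) ∞ (fun y => f (σ y)) y :=
    f.contMDiff.contMDiffAt.comp y (hσ.contMDiffAt (hU.mem_nhds hy))
  refine h2.congr_of_eventuallyEq ?_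
  filter_upwards [hU.mem_nhds hy] with z hz
  exact h1 _ _ ((R.pr_lift z).trans (hpr z hz).symm)

section Descend

variable [FiniteDimensional ℝ EM] [T2Space M] [FiniteDimensional ℝ F]
  [ContMDiffVectorBundle ∞ F E 𝓘(ℝ, EM)]
  [ContMDiffSMul 𝓘(ℝ, ES) 𝓘(ℝ, EM) ∞ S M]

/-- Sections of `𝔰_E^⊥` fixed by the group descend. -/
lemma exists_represents_of_actTo {u : Sec EM F E}
    (h : ∀ (g : S) (x : M), L.actTo g (smul_inv_smul g x) (u (g⁻¹ • x)) = u x)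
    (hu : ∀ x, u x ∈ K.perp x) : ∃ ur : Sec EMr Fr Er, R.Represents u ur := by
  have h1 : ∀ (x x' : M) (y : Mr) (hx : R.pr x = y) (hx' : R.pr x' = y),
      R.qTo hx ⟨u x, hu x⟩ = R.qTo hx' ⟨u x', hu x'⟩ := by
    intro x x' y hx hx'
    obtain ⟨g, rfl⟩ := R.exists_smul_of_pr_eq (hx.trans hx'.symm)
    refine (R.qTo_actTo rfl hx hx' ?_).symm
    have : ∀ (z : M) (hz : g • z = g • x), z = x → L.actTo g hz (u z) = L.actTo g rfl (u x) := by
      rintro _ _ rfl; rfl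
    exact (h g (g • x)).symm.trans (this _ _ (inv_smul_smul g x))
  refine ⟨⟨fun y => R.qTo (R.pr_lift y) ⟨u _, hu _⟩, fun y => ?_⟩,
    L.isInvariant_of_actTo h, hu, fun x => ?_⟩
  · obtain ⟨U, σ, hU, hy, hσ, hpr, -⟩ := exists_local_section R.isSubmersion (R.lift y)
    rw [R.pr_lift] at hy
    have h2 := (R.q_smooth (fun x => ⟨u x, hu x⟩) (σ y) (u.contMDiff (σ y))).comp y
      (hσ.contMDiffAt (hU.mem_nhds hy))
    refine h2.congr_of_eventuallyEq ?_
    filter_upwards [hU.mem_nhds hy] with z hz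
    rw [h1 _ (σ z) z (R.pr_lift z) (hpr z hz), R.mk_qTo]
    rfl
  · exact h1 x (R.lift (R.pr x)) (R.pr x) rfl (R.pr_lift _)

variable (K) in
/-- Vectors in `𝔰_E^⊥` extend to sections of `𝔰_E^⊥`. -/
lemma _root_.Courant.EquivariantStructure.exists_perpOp [FiniteDimensional ℝ ES] (x₀ : M) :
    ∃ (p : Fn EM M) (Q : ∀ x, E x →ₗ[ℝ] E x), (∀ᶠ y in 𝓝 x₀, p y = 1) ∧
      (∀ x a, Q x a ∈ K.perp x) ∧ (∀ x, ∀ a ∈ K.perp x, Q x a = p x • a) ∧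
      ∀ u : Sec EM F E, ∃ v : Sec EM F E, ∀ x, v x = Q x (u x) := by
  have : FiniteDimensional ℝ (GroupLieAlgebra 𝓘(ℝ, ES) S) := inferInstanceAs (FiniteDimensional ℝ ES)
  let b := Module.finBasis ℝ (GroupLieAlgebra 𝓘(ℝ, ES) S)
  have hli : LinearIndependent ℝ fun i => K.χ (b i) x₀ := by
    rw [Fintype.linearIndependent_iff]
    intro c hc
    refine Fintype.linearIndependent_iff.1 b.linearIndependent c (K.injective x₀ _ ?_)
    rw [map_sum, sum_apply, ← hc]
    simp
  obtain ⟨t, p, hp, ht⟩ := exists_dual_sections C (fun i => K.χ (b i)) hli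
  -- Gram–Schmidt against the `χ(b_j)` by means of their dual sections: since `⟨χ(b_i), t_j⟩ = p
  -- δ_ij`, the corrected vector is orthogonal to every `χ(b_i)` at every point, and vectors of
  -- `𝔰_E^⊥` need no correction.
  refine ⟨p, fun x => p x • LinearMap.id -
    ∑ j, ((C.pairing x) (K.χ (b j) x)).smulRight (t j x), hp, fun x a s => ?_, fun x a ha => ?_,
    fun u => ⟨fsmul p u - ∑ j, fsmul (C.pairS (K.χ (b j)) u) (t j), fun x => ?_⟩⟩
  · rw [← b.sum_repr s, map_sum, sum_apply, map_sum, LinearMap.sum_apply]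
    refine Finset.sum_eq_zero fun i _ => ?_
    rw [map_smul, smul_sec, map_smul, LinearMap.smul_apply]
    simp [LinearMap.sub_apply, map_sub, map_sum, ht, mul_comm]
  · rw [LinearMap.sub_apply, LinearMap.sum_apply, Finset.sum_eq_zero, sub_zero]
    · rfl
    · intro j _
      rw [LinearMap.smulRight_apply, ha (b j), zero_smul]
  · rw [sub_sec, sum_apply]
    simp

variable [FiniteDimensional ℝ ES]

variable (K) in
lemma _root_.Courant.EquivariantStructure.exists_perp_section {x₀ : M} {a : E x₀}
    (ha : a ∈ K.perp x₀) : ∃ w : Sec EM F E, w x₀ = a ∧ ∀ x, w x ∈ K.perp x := by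
  obtain ⟨p, Q, hp, hQ, hQp, hQs⟩ := K.exists_perpOp x₀
  obtain ⟨u, rfl⟩ := exists_section (EM := EM) (F := F) x₀ a
  obtain ⟨v, hv⟩ := hQs u
  refine ⟨v, ?_, fun x => ?_⟩
  · rw [hv, hQp _ _ ha, hp.self_of_nhds, one_smul]
  · rw [hv]; exact hQ _ _

variable [ConnectedSpace S] [ProperSMul S M] [FiniteDimensional ℝ EMr] [T2Space Mr]

/-- Every vector of the reduced bundle is the value of a section that is represented by an
invariant section. -/
lemma exists_represents (hfree : ∀ (g : S) (x : M), g • x = x → g = 1) (z₀ : M)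
    (v : Er (R.pr z₀)) :
    ∃ (u : Sec EM F E) (ur : Sec EMr Fr Er), R.Represents u ur ∧ ur (R.pr z₀) = v := by
  classical
  obtain ⟨⟨a, ha⟩, rfl⟩ := R.q_surjective z₀ v
  obtain ⟨w, rfl, hw⟩ := K.exists_perp_section ha
  obtain ⟨U, σ, hU, hz₀, hσ, hpr, hσ₀⟩ := exists_local_section R.isSubmersion z₀
  obtain ⟨ψ, hψ, hψU⟩ := exists_bump (EM := EMr) (hU.mem_nhds hz₀)
  let W : Set M := R.pr ⁻¹' U
  have hW : IsOpen W := hU.preimage R.pr_smooth.continuous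
  -- The point of the slice on the orbit of `z`. Away from the slice the value `z` keeps `g(z) s(z)
  -- = z` solvable everywhere, so that `g` is a total function.
  let s : M → M := fun z => if R.pr z ∈ U then σ (R.pr z) else z
  have hsW : ∀ z ∈ W, s z = σ (R.pr z) := fun z hz => if_pos hz
  have hs : ∀ z, ∃ g : S, g • s z = z := by
    intro z
    refine R.exists_smul_of_pr_eq ?_
    by_cases hz : R.pr z ∈ U
    · rw [hsW z hz, hpr _ hz]
    · simp only [s, if_neg hz]
  choose g hg using hs
  have hprs : ∀ z ∈ W, R.pr (s z) = R.pr z := fun z hz => by rw [hsW z hz, hpr _ hz]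
  have hssm : ∀ z ∈ W, ContMDiffAt 𝓘(ℝ, EM) 𝓘(ℝ, EM) ∞ s z := by
    intro z hz
    refine ((hσ.contMDiffAt (hU.mem_nhds hz)).comp z R.pr_smooth.contMDiffAt).congr_of_eventuallyEq ?_
    filter_upwards [hW.mem_nhds hz] with y hy
    exact hsW y hy
  have huniq : ∀ (k l : S) (z : M), k • z = l • z → k = l := by
    intro k l z h
    have h1 : (l⁻¹ * k) • z = z := by rw [mul_smul, h, inv_smul_smul]
    exact (inv_mul_eq_one.1 (hfree _ _ h1)).symm
  have hsk : ∀ z ∈ W, ∀ k : S, s (k • z) = s z := by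
    intro z hz k
    have : k • z ∈ W := by
      change R.pr (k • z) ∈ U
      rw [R.pr_smul]; exact hz
    rw [hsW _ this, hsW _ hz, R.pr_smul]
  have hgk : ∀ z ∈ W, ∀ k : S, g (k • z) = k * g z := by
    intro z hz k
    refine huniq _ _ (s z) ?_
    rw [mul_smul, hg, ← hsk z hz k, hg]
  have hss : ∀ z ∈ W, s (s z) = s z := by
    intro z hz
    have h1 := hsk (s z) (by change R.pr (s z) ∈ U; rw [hprs z hz]; exact hz) (g z)
    rw [hg] at h1
    exact h1.symm
  -- The implicit function argument works at points of the slice; the rule `g(kz) = k g(z)` carries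
  -- smoothness along the orbit.
  have hgsm : ∀ z ∈ W, ContMDiffAt 𝓘(ℝ, EM) 𝓘(ℝ, ES) ∞ g z := by
    intro z hz
    have hz' : s z ∈ W := by change R.pr (s z) ∈ U; rw [hprs z hz]; exact hz
    have h1 : ContMDiffAt 𝓘(ℝ, EM) 𝓘(ℝ, ES) ∞ g (s z) :=
      contMDiffAt_of_smul_eq hfree (hssm _ hz') (hss z hz) (Eventually.of_forall hg)
    have h2 : (g z)⁻¹ • z = s z := by rw [inv_smul_eq_iff, hg]
    have h3 : ContMDiffAt 𝓘(ℝ, EM) 𝓘(ℝ, EM) ∞ (fun y => (g z)⁻¹ • y) z :=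
      (ContMDiffSMul.contMDiff_const_smul (I := 𝓘(ℝ, ES)) (n := ∞) (g z)⁻¹) z
    have h4 : ContMDiffAt 𝓘(ℝ, EM) 𝓘(ℝ, ES) ∞ (fun y => g z * g ((g z)⁻¹ • y)) z := by
      refine contMDiffAt_const.mul (ContMDiffAt.comp (g := g) z ?_ h3)
      rwa [h2]
    refine h4.congr_of_eventuallyEq ?_
    filter_upwards [hW.mem_nhds hz] with y hy
    rw [hgk y hy, mul_inv_cancel_left]
  have hψ0 : ∀ z, z ∉ W → ψ (R.pr z) = 0 := fun z hz => by
    by_contra h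
    exact hz (hψU (subset_tsupport _ h))
  -- The values of `w` on the slice are spread over the orbits by the action. The cutoff is pulled
  -- back from the quotient, hence invariant.
  let ξ : ∀ z, E z := fun z => ψ (R.pr z) • L.actTo (g z) (hg z) (w (s z))
  have hξ : ∀ z, SmoothAlongAt EM F 𝓘(ℝ, EM) (fun z : M => z) ξ z := by
    intro z
    have hψs : ContMDiffAt 𝓘(ℝ, EM) 𝓘(ℝ, ℝ) ∞ (fun z => ψ (R.pr z)) z :=
      (ψ.contMDiff.comp R.pr_smooth) z
    by_cases hz : R.pr z ∈ tsupport ψ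
    · have hzW : z ∈ W := hψU hz
      exact SmoothAlongAt.smul hψs (L.smoothAlong_actTo (hgsm z hzW)
        (SmoothAlongAt.of_section (hssm z hzW) w) hg)
    · have h0 : SmoothAlongAt EM F 𝓘(ℝ, EM) (fun z : M => z) (fun z => (0 : Sec EM F E) z) z :=
        (0 : Sec EM F E).contMDiff z
      refine h0.congr ?_
      have h1 : ∀ᶠ y in 𝓝 z, R.pr y ∉ tsupport ψ :=
        R.pr_smooth.continuous.continuousAt.eventually
          ((isClosed_tsupport ψ).isOpen_compl.mem_nhds hz)
      filter_upwards [h1] with y hy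
      simp only [ξ, image_eq_zero_of_notMem_tsupport hy, zero_smul, zero_sec]
  let u : Sec EM F E := ⟨ξ, hξ⟩
  have hinv : ∀ (k : S) (z : M), L.actTo k (smul_inv_smul k z) (u (k⁻¹ • z)) = u z := by
    intro k z
    change L.actTo k _ (ψ (R.pr (k⁻¹ • z)) • L.actTo (g (k⁻¹ • z)) _ (w (s (k⁻¹ • z)))) =
      ψ (R.pr z) • L.actTo (g z) (hg z) (w (s z))
    rw [map_smul, R.pr_smul]
    by_cases hz : z ∈ W
    · congr 1
      have h1 : ∀ (l : S) (x : M) (h : l • x = k⁻¹ • z), l = k⁻¹ * g z → x = s z →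
          L.actTo k (smul_inv_smul k z) (L.actTo l h (w x)) = L.actTo (g z) (hg z) (w (s z)) := by
        rintro l _ h hl rfl
        have h2 : ∀ (m : S) (hm : m • s z = z), k * l = m →
            L.actTo k (smul_inv_smul k z) (L.actTo l h (w (s z))) = L.actTo m hm (w (s z)) := by
          rintro _ hm rfl
          exact (L.actTo_mul h _ hm _).symm
        exact h2 _ _ (by rw [hl, mul_inv_cancel_left])
      exact h1 _ _ _ (hgk z hz k⁻¹) (hsk z hz k⁻¹)
    · rw [hψ0 z hz, zero_smul, zero_smul]
  have hone : ∀ z ∈ W, s z = z → u z = ψ (R.pr z) • w z := by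
    intro z hz hsz
    have h1 : g z = 1 := huniq _ _ (s z) (by rw [hg, one_smul, hsz])
    have h2 : ∀ (l : S) (x : M) (h : l • x = z), l = 1 → x = z → L.actTo l h (w x) = w z := by
      rintro _ _ h rfl rfl; exact L.actTo_one h _
    exact congrArg (fun a => ψ (R.pr z) • a) (h2 _ _ (hg z) h1 hsz)
  have hinvar := L.isInvariant_of_actTo hinv
  -- On the slice this holds because `w` takes values in `𝔰_E^⊥`; an invariant section then stays in
  -- `𝔰_E^⊥` along the orbit.
  have hperp : ∀ z, u z ∈ K.perp z := by
    intro z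
    by_cases hz : z ∈ W
    · have hz' : s z ∈ W := by change R.pr (s z) ∈ U; rw [hprs z hz]; exact hz
      have h1 := L.mem_perp_smul hinvar (x := s z) (by
        rw [hone _ hz' (hss z hz)]
        exact Submodule.smul_mem _ _ (hw _)) (g z)
      rwa [hg] at h1
    · have : u z = 0 := by
        change ψ (R.pr z) • L.actTo (g z) (hg z) (w (s z)) = 0
        rw [hψ0 z hz, zero_smul]
      rw [this]
      exact Submodule.zero_mem _
  obtain ⟨ur, hur⟩ := R.exists_represents_of_actTo hinv hperp
  refine ⟨u, ur, hur, ?_⟩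
  obtain ⟨-, hu', hq⟩ := hur
  rw [← hq]
  congr 2
  rw [hone z₀ hz₀ ((hsW z₀ hz₀).trans hσ₀), hψ.self_of_nhds, one_smul]

end Descend

end Reduction

end Red

/-! ### The reduced divergence -/

section RedDiv

variable {EM : Type*} [NormedAddCommGroup EM] [NormedSpace ℝ EM]
  {M : Type*} [TopologicalSpace M] [ChartedSpace EM M]
  {F : Type*} [NormedAddCommGroup F] [NormedSpace ℝ F]
  {E : M → Type*} [∀ x, AddCommGroup (E x)] [∀ x, Module ℝ (E x)]
  [∀ x, TopologicalSpace (E x)] [TopologicalSpace (TotalSpace F E)]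
  [FiberBundle F E] [VectorBundle ℝ F E] [IsManifold 𝓘(ℝ, EM) ∞ M]
  {C : CourantAlgebroid EM F E}

section Isotropic

variable [FiniteDimensional ℝ EM] [T2Space M] [FiniteDimensional ℝ F]
  [ContMDiffVectorBundle ∞ F E 𝓘(ℝ, EM)]
  {𝔰 : Type*} [LieRing 𝔰] [LieAlgebra ℝ 𝔰] {K : EquivariantStructure C 𝔰}

/-- The bracket of invariant sections is invariant. -/
lemma EquivariantStructure.IsInvariant.bracket {u v : Sec EM F E} (hu : K.IsInvariant u)
    (hv : K.IsInvariant v) : K.IsInvariant (C.bracket u v) := by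
  intro s
  rw [C.jacobi, hu s, hv s, map_zero, map_zero, LinearMap.zero_apply, add_zero]

/-- The bracket of invariant sections of `𝔰_E^⊥` is a section of `𝔰_E^⊥`. -/
lemma EquivariantStructure.IsInvariant.bracket_mem_perp {u v : Sec EM F E} (hu : K.IsInvariant u)
    (hu' : ∀ x, u x ∈ K.perp x) (hv' : ∀ x, v x ∈ K.perp x) (x : M) :
    C.bracket u v x ∈ K.perp x := by
  intro s
  have h1 : C.bracket u (K.χ s) = 0 := by
    rw [C.bracket_skew fun y => ?_, hu s, neg_zero]
    rw [C.pairing_symm]; exact hu' y s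
  have h2 := C.invariant u (K.χ s) v x
  rw [h1, zero_sec, map_zero, LinearMap.zero_apply, zero_add,
    dirDeriv_of_eventuallyEq_const (c := 0) (Eventually.of_forall fun y => hv' y s)] at h2
  exact h2.symm

/-- The divergence of an invariant section of `𝔰_E` vanishes. -/
lemma EquivariantStructure.IsEquivariantDivergence.eq_zero_of_mem_χ [FiniteDimensional ℝ 𝔰]
    {div : Divergence C} (hdiv : K.IsEquivariantDivergence div) {w : Sec EM F E}
    (hw : K.IsInvariant w) (h : ∀ x, ∃ s, K.χ s x = w x) (x₀ : M) : div.toFun w x₀ = 0 := by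
  classical
  let b := Module.finBasis ℝ 𝔰
  have hli : LinearIndependent ℝ fun i => K.χ (b i) x₀ := by
    rw [Fintype.linearIndependent_iff]
    intro c hc
    refine Fintype.linearIndependent_iff.1 b.linearIndependent c (K.injective x₀ _ ?_)
    rw [map_sum, sum_apply, ← hc]
    simp
  obtain ⟨t, p, hp, ht⟩ := exists_dual_sections C (fun i => K.χ (b i)) hli
  have hsum : ∀ s y, K.χ s y = ∑ l, b.repr s l • K.χ (b l) y := by
    intro s y
    conv_lhs => rw [← b.sum_repr s, map_sum, sum_apply]
    simp
  have hpt : ∀ s y l, C.pairing y (K.χ s y) (t l y) = b.repr s l * p y := by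
    intro s y l
    rw [hsum, map_sum, LinearMap.sum_apply]
    simp [ht]
  let k : Fin (Module.finrank ℝ 𝔰) → Fn EM M := fun l => C.pairS w (t l)
  -- Dual sections make the coefficients of `w` in the `χ(b_l)` smooth.
  have hw' : fsmul p w = ∑ l, fsmul (k l) (K.χ (b l)) := by
    ext y
    obtain ⟨s, hs⟩ := h y
    rw [sum_apply, fsmul_apply, ← hs, hsum, Finset.smul_sum]
    refine Finset.sum_congr rfl fun l _ => ?_
    rw [fsmul_apply, smul_smul, CourantAlgebroid.pairS_apply, ← hs, hpt, mul_comm]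
  have hp0 : ∀ u : Sec EM F E, C.lieS u p x₀ = 0 := fun u =>
    dirDeriv_of_eventuallyEq_const hp _
  have hp1 : p x₀ = 1 := hp.self_of_nhds
  -- Invariance of `w` in coefficients: the derivative of the coefficients compensates the bracket
  -- of the `χ(b_i)`.
  have h1 : ∀ j l, C.lieS (K.χ (b j)) (k l) x₀ = - ∑ i, k i x₀ * b.repr ⁅b j, b i⁆ l := by
    intro j l
    have h2 := congrArg (fun u => C.pairing x₀ (C.bracket (K.χ (b j)) u x₀) (t l x₀)) hw'
    simp only [C.bracket_fsmul, hw (b j), map_sum, sum_apply, add_sec, fsmul_apply, hp0, zero_smul,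
      zero_sec, smul_zero, add_zero, map_zero, LinearMap.zero_apply, LinearMap.sum_apply, map_add,
      LinearMap.add_apply, map_smul, LinearMap.smul_apply, smul_eq_mul, K.bracket_χ, hpt, hp1,
      mul_one, Module.Basis.repr_self, Finset.sum_add_distrib, Finsupp.single_apply, mul_ite,
      mul_zero, Finset.sum_ite_eq', Finset.mem_univ, if_true] at h2
    rw [eq_neg_iff_add_eq_zero, add_comm]
    exact h2.symm
  have htr : ∀ i, LinearMap.trace ℝ 𝔰 (LieAlgebra.ad ℝ 𝔰 (b i)) = ∑ j, b.repr ⁅b i, b j⁆ j := by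
    intro i
    rw [LinearMap.trace_eq_matrix_trace ℝ b, Matrix.trace]
    refine Finset.sum_congr rfl fun j _ => ?_
    rw [Matrix.diag_apply, LinearMap.toMatrix_apply, LieAlgebra.ad_apply]
  have h3 := congrArg (fun u => div.toFun u x₀) hw'
  simp only [map_sum, Fn.sum_apply, div.map_fsmul, hp1, one_mul, hdiv.div_χ] at h3
  have h4 : dirDeriv p x₀ (C.anchor x₀ (w x₀)) = 0 := hp0 w
  rw [h4, add_zero] at h3
  rw [h3, Finset.sum_add_distrib]
  -- The derivative terms add up to `∑ k_i Tr ad(b_i)`, which is cancelled by `∑ k_i div χ(b_i)`.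
  -- This is the purpose of the normalization of `div χ`.
  have h5 : ∑ i, dirDeriv (k i) x₀ (C.anchor x₀ (K.χ (b i) x₀)) =
      ∑ i, k i x₀ * LinearMap.trace ℝ 𝔰 (LieAlgebra.ad ℝ 𝔰 (b i)) := by
    have h6 : ∀ i, dirDeriv (k i) x₀ (C.anchor x₀ (K.χ (b i) x₀)) =
        ∑ j, k j x₀ * b.repr ⁅b j, b i⁆ i := by
      intro i
      refine (h1 i i).trans ?_
      rw [← Finset.sum_neg_distrib]
      refine Finset.sum_congr rfl fun j _ => ?_
      rw [← lie_skew, map_neg, Finsupp.neg_apply, mul_neg, neg_neg]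
    simp only [h6, htr, Finset.mul_sum]
    exact Finset.sum_comm
  rw [h5, ← Finset.sum_add_distrib]
  exact Finset.sum_eq_zero fun i _ => by ring

end Isotropic

variable
  {ES : Type*} [NormedAddCommGroup ES] [NormedSpace ℝ ES] [CompleteSpace ES]
  {S : Type*} [TopologicalSpace S] [ChartedSpace ES S] [Group S] [LieGroup 𝓘(ℝ, ES) ∞ S]
  [MulAction S M]
  {K : EquivariantStructure C (GroupLieAlgebra 𝓘(ℝ, ES) S)} {L : Integration K}
  {EMr : Type*} [NormedAddCommGroup EMr] [NormedSpace ℝ EMr]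
  {Mr : Type*} [TopologicalSpace Mr] [ChartedSpace EMr Mr]
  {Fr : Type*} [NormedAddCommGroup Fr] [NormedSpace ℝ Fr]
  {Er : Mr → Type*} [∀ y, AddCommGroup (Er y)] [∀ y, Module ℝ (Er y)]
  [∀ y, TopologicalSpace (Er y)] [TopologicalSpace (TotalSpace Fr Er)]
  [FiberBundle Fr Er] [VectorBundle ℝ Fr Er] [IsManifold 𝓘(ℝ, EMr) ∞ Mr]
  {Cr : CourantAlgebroid EMr Fr Er}

namespace Reduction

variable (R : Reduction L Cr)

/-- The pullback of a smooth function along the projection. -/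
def prFn (f : Fn EMr Mr) : Fn EM M := ⟨fun x => f (R.pr x), f.contMDiff.comp R.pr_smooth⟩

lemma dirDeriv_prFn (f : Fn EMr Mr) {x : M} (a : K.perp x) :
    dirDeriv (R.prFn f) x (C.anchor x a) = dirDeriv f (R.pr x) (Cr.anchor (R.pr x) (R.q x a)) := by
  have h1 : mfderiv 𝓘(ℝ, EM) 𝓘(ℝ, ℝ) (f ∘ R.pr) x =
      (mfderiv 𝓘(ℝ, EMr) 𝓘(ℝ, ℝ) f (R.pr x)).comp (mfderiv 𝓘(ℝ, EM) 𝓘(ℝ, EMr) R.pr x) :=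
    mfderiv_comp x (Fn.mdiff f (R.pr x)) (R.pr_smooth.mdifferentiableAt (by simp))
  change mfderiv 𝓘(ℝ, EM) 𝓘(ℝ, ℝ) (f ∘ R.pr) x _ = mfderiv 𝓘(ℝ, EMr) 𝓘(ℝ, ℝ) f (R.pr x) _
  rw [h1, R.anchor]
  rfl

/-- By isotropy `χ(s)` lies in `𝔰_E^⊥`, and its class in the quotient is zero, so its anchor is
tangent to the fibres of the projection. -/
lemma lieS_χ_prFn (s : GroupLieAlgebra 𝓘(ℝ, ES) S) (f : Fn EMr Mr) :
    C.lieS (K.χ s) (R.prFn f) = 0 := by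
  ext x
  refine (R.dirDeriv_prFn f ⟨K.χ s x, fun t => K.isotropic t s x⟩).trans ?_
  rw [(R.q_eq_zero_iff x _).2 ⟨s, rfl⟩, map_zero, dirDeriv_map_zero]
  rfl

namespace Represents

variable {R} {u v : Sec EM F E} {ur vr : Sec EMr Fr Er}

lemma mem_perp (hu : R.Represents u ur) (x : M) : u x ∈ K.perp x := hu.2.choose x

lemma q_eq (hu : R.Represents u ur) {x : M} (h : u x ∈ K.perp x) :
    R.q x ⟨u x, h⟩ = ur (R.pr x) := hu.2.choose_spec x

lemma lieS (hu : R.Represents u ur) (f : Fn EMr Mr) (x : M) :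
    C.lieS u (R.prFn f) x = Cr.lieS ur f (R.pr x) := by
  refine (R.dirDeriv_prFn f ⟨u x, hu.mem_perp x⟩).trans ?_
  rw [hu.q_eq]
  rfl

lemma zero : R.Represents (0 : Sec EM F E) (0 : Sec EMr Fr Er) :=
  ⟨fun _ => map_zero _, fun _ => Submodule.zero_mem _, fun x => map_zero (R.q x)⟩

lemma add (hu : R.Represents u ur) (hv : R.Represents v vr) : R.Represents (u + v) (ur + vr) := by
  refine ⟨fun s => ?_, fun x => Submodule.add_mem _ (hu.mem_perp x) (hv.mem_perp x), fun x => ?_⟩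
  · rw [map_add, hu.1, hv.1, add_zero]
  · change _ = ur (R.pr x) + vr (R.pr x)
    rw [← hu.q_eq (hu.mem_perp x), ← hv.q_eq (hv.mem_perp x)]
    exact map_add (R.q x) ⟨u x, hu.mem_perp x⟩ ⟨v x, hv.mem_perp x⟩

lemma sub (hu : R.Represents u ur) (hv : R.Represents v vr) : R.Represents (u - v) (ur - vr) := by
  refine ⟨fun s => ?_, fun x => Submodule.sub_mem _ (hu.mem_perp x) (hv.mem_perp x), fun x => ?_⟩
  · rw [map_sub, hu.1, hv.1, sub_zero]
  · change _ = ur (R.pr x) - vr (R.pr x)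
    rw [← hu.q_eq (hu.mem_perp x), ← hv.q_eq (hv.mem_perp x)]
    exact map_sub (R.q x) ⟨u x, hu.mem_perp x⟩ ⟨v x, hv.mem_perp x⟩

lemma fsmul (f : Fn EMr Mr) (hu : R.Represents u ur) :
    R.Represents (fsmul (R.prFn f) u) (fsmul f ur) := by
  refine ⟨fun s => ?_, fun x => Submodule.smul_mem _ _ (hu.mem_perp x), fun x => ?_⟩
  · rw [C.bracket_fsmul, hu.1, R.lieS_χ_prFn]
    ext x
    simp
  · change _ = f (R.pr x) • ur (R.pr x)
    rw [← hu.q_eq (hu.mem_perp x)]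
    exact map_smul (R.q x) (f (R.pr x)) ⟨u x, hu.mem_perp x⟩

lemma sum {ι : Type*} (s : Finset ι) {u : ι → Sec EM F E} {ur : ι → Sec EMr Fr Er}
    (h : ∀ i, R.Represents (u i) (ur i)) : R.Represents (∑ i ∈ s, u i) (∑ i ∈ s, ur i) := by
  classical
  induction s using Finset.induction_on with
  | empty => exact zero
  | insert a s ha ih =>
    rw [Finset.sum_insert ha, Finset.sum_insert ha]
    exact (h a).add ih

variable [FiniteDimensional ℝ EM] [T2Space M] [FiniteDimensional ℝ F]
  [ContMDiffVectorBundle ∞ F E 𝓘(ℝ, EM)]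

lemma bracket (hu : R.Represents u ur) (hv : R.Represents v vr) :
    R.Represents (C.bracket u v) (Cr.bracket ur vr) := by
  have hp := hu.1.bracket_mem_perp hu.mem_perp hv.mem_perp
  exact ⟨hu.1.bracket hv.1, hp, R.bracket u v _ ur vr hu.mem_perp hv.mem_perp hp hu.1 hv.1 rfl
    (fun x => hu.q_eq _) (fun x => hv.q_eq _)⟩

end Represents

variable [FiniteDimensional ℝ EM] [T2Space M] [FiniteDimensional ℝ F]
  [ContMDiffVectorBundle ∞ F E 𝓘(ℝ, EM)]
  [ContMDiffSMul 𝓘(ℝ, ES) 𝓘(ℝ, EM) ∞ S M]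
  [FiniteDimensional ℝ ES] [ConnectedSpace S] [ProperSMul S M]
  [FiniteDimensional ℝ EMr] [T2Space Mr] [FiniteDimensional ℝ Fr]
  [ContMDiffVectorBundle ∞ Fr Er 𝓘(ℝ, EMr)]

/-- The divergence of an invariant section descends. -/
lemma exists_descend_div {div : Divergence C} (hdiv : K.IsEquivariantDivergence div)
    {u : Sec EM F E} (hu : K.IsInvariant u) :
    ∃ r : Fn EMr Mr, ∀ x, r (R.pr x) = div.toFun u x := by
  refine R.exists_descend_fn fun g x => L.apply_smul_of_lieS (fun s => ?_) g x
  rw [hdiv.lieS, hu s, map_zero]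

/-- An equivariant divergence descends to the reduced Courant algebroid. -/
lemma exists_reduced_divergence (hfree : ∀ (g : S) (x : M), g • x = x → g = 1)
    {div : Divergence C} (hdiv : K.IsEquivariantDivergence div) :
    ∃ d' : Divergence Cr, ∀ d, R.IsReducedDivergence div d ↔ d = d' := by
  have : FiniteDimensional ℝ (GroupLieAlgebra 𝓘(ℝ, ES) S) := inferInstanceAs (FiniteDimensional ℝ ES)
  let T : Set (Sec EMr Fr Er × (Mr → ℝ)) :=
    {s | ∃ u, R.Represents u s.1 ∧ ∀ x, s.2 (R.pr x) = div.toFun u x}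
  have hT : ∀ u ur, R.Represents u ur → ∃ r : Fn EMr Mr, (ur, (r : Mr → ℝ)) ∈ T := by
    intro u ur hu
    obtain ⟨r, hr⟩ := R.exists_descend_div hdiv hu.1
    exact ⟨r, u, hu, hr⟩
  have hspan : ∀ y (v : Er y), ∃ s ∈ T, s.1 y = v := by
    intro y v
    obtain ⟨z, rfl⟩ := R.surjective y
    obtain ⟨u, ur, hu, rfl⟩ := R.exists_represents hfree z v
    obtain ⟨r, hr⟩ := hT u ur hu
    exact ⟨_, hr, rfl⟩
  obtain ⟨d', hd'⟩ := exists_divergence Cr T hspan fun y₀ => by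
    obtain ⟨z₀, rfl⟩ := R.surjective y₀
    have : FiniteDimensional ℝ (Er (R.pr z₀)) := VectorBundle.finiteDimensional ℝ Fr Er _
    let b := Module.finBasisOfFinrankEq ℝ (Er (R.pr z₀)) (VectorBundle.finrank_eq ℝ Fr Er (R.pr z₀))
    -- A frame of the reduced bundle whose members are represented upstairs; their divergences
    -- descend and serve as local data.
    choose e er he hb using fun i => R.exists_represents hfree z₀ (b i)
    obtain ⟨B, hB⟩ := exists_dualFrame_of_basis Cr er (x₀ := R.pr z₀)
      (by simp only [hb]; exact b.linearIndependent) (by simp)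
    choose δ hδ using fun i => R.exists_descend_div hdiv (he i).1
    refine ⟨B, δ, ?_⟩
    filter_upwards [eventually_eventually_nhds.2 B.p_one] with y hy
    rintro ⟨ur, r⟩ ⟨u, hu, hr⟩
    obtain ⟨x, rfl⟩ := R.surjective y
    -- The expansion in the frame holds downstairs. Upstairs it holds up to an invariant section of
    -- `𝔰_E`, whose divergence is zero, so applying `div` to it yields the local formula.
    have h1 := (hu.fsmul B.p).sub
      (Represents.sum Finset.univ fun i => (he i).fsmul (Cr.pairS ur (B.t i)))
    have h2 := B.fsmul_p ur
    rw [hB] at h2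
    rw [h2, sub_self] at h1
    have h3 := hdiv.eq_zero_of_mem_χ h1.1 (fun z =>
      (R.q_eq_zero_iff z ⟨_, h1.mem_perp z⟩).1 (h1.q_eq _)) x
    have h4 : Cr.lieS ur B.p (R.pr x) = 0 := dirDeriv_of_eventuallyEq_const hy _
    have h5 : div.toFun (fsmul (R.prFn B.p) u) x = r (R.pr x) := by
      rw [div.map_fsmul', show r (R.pr x) = div.toFun u x from hr x]
      change B.p (R.pr x) * _ + C.lieS u (R.prFn B.p) x = _
      rw [hy.self_of_nhds, one_mul, hu.lieS, h4, add_zero]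
    rw [map_sub, map_sum] at h3
    change div.toFun (fsmul (R.prFn B.p) u) x - (∑ i, _ : Fn EM M) x = 0 at h3
    rw [h5, Fn.sum_apply] at h3
    change B.localDiv δ ur (R.pr x) = r (R.pr x)
    rw [sub_eq_zero.1 h3, B.localDiv_apply, Fn.sum_apply]
    refine Finset.sum_congr rfl fun i _ => ?_
    rw [div.map_fsmul']
    change _ * δ i (R.pr x) + Cr.lieS (B.e i) _ (R.pr x) = _ * _ + C.lieS (e i) (R.prFn _) x
    rw [(he i).lieS, hδ, hB]
    rfl
  refine ⟨d', fun d => ⟨fun hd => ?_, ?_⟩⟩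
  · refine Divergence.unique_of_span (S := Prod.fst '' T) (fun x v => ?_) ?_
    · obtain ⟨s, hs, hsv⟩ := hspan x v
      exact ⟨s.1, ⟨s, hs, rfl⟩, hsv⟩
    · rintro _ ⟨⟨ur, r⟩, hs, rfl⟩ y
      have h1 := hd' _ hs y
      obtain ⟨u, hu, hr⟩ := hs
      obtain ⟨x, rfl⟩ := R.surjective y
      exact (hd u ur hu x).trans ((hr x).symm.trans h1.symm)
  · rintro rfl u ur hu x
    obtain ⟨r, hr⟩ := R.exists_descend_div hdiv hu.1
    exact (hd' (ur, r) ⟨u, hu, hr⟩ (R.pr x)).trans (hr x)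

end Reduction

end RedDiv

/-! ### The reduced generalized pseudometric and its Ricci tensor -/

section RedMetric

variable {EM : Type*} [NormedAddCommGroup EM] [NormedSpace ℝ EM]
  {M : Type*} [TopologicalSpace M] [ChartedSpace EM M]
  {F : Type*} [NormedAddCommGroup F] [NormedSpace ℝ F]
  {E : M → Type*} [∀ x, AddCommGroup (E x)] [∀ x, Module ℝ (E x)]
  [∀ x, TopologicalSpace (E x)] [TopologicalSpace (TotalSpace F E)]
  [FiberBundle F E] [VectorBundle ℝ F E] [IsManifold 𝓘(ℝ, EM) ∞ M]
  {C : CourantAlgebroid EM F E}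
  {ES : Type*} [NormedAddCommGroup ES] [NormedSpace ℝ ES] [CompleteSpace ES]
  {S : Type*} [TopologicalSpace S] [ChartedSpace ES S] [Group S] [LieGroup 𝓘(ℝ, ES) ∞ S]
  [MulAction S M]
  {K : EquivariantStructure C (GroupLieAlgebra 𝓘(ℝ, ES) S)} {L : Integration K}
  {EMr : Type*} [NormedAddCommGroup EMr] [NormedSpace ℝ EMr]
  {Mr : Type*} [TopologicalSpace Mr] [ChartedSpace EMr Mr]
  {Fr : Type*} [NormedAddCommGroup Fr] [NormedSpace ℝ Fr]
  {Er : Mr → Type*} [∀ y, AddCommGroup (Er y)] [∀ y, Module ℝ (Er y)]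
  [∀ y, TopologicalSpace (Er y)] [TopologicalSpace (TotalSpace Fr Er)]
  [FiberBundle Fr Er] [VectorBundle ℝ Fr Er] [IsManifold 𝓘(ℝ, EMr) ∞ Mr]
  {Cr : CourantAlgebroid EMr Fr Er}
  [FiniteDimensional ℝ EM] [T2Space M] [FiniteDimensional ℝ F]
  [ContMDiffVectorBundle ∞ F E 𝓘(ℝ, EM)]

/-- Lets a single construction of frames serve both for reducing one generalized pseudometric and
for reducing a curve. -/
lemma GenPseudometric.isSmoothCurve_const (V : GenPseudometric C) :
    GenPseudometric.IsSmoothCurve (fun _ => V) := by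
  intro p₀
  obtain ⟨U, n, e, hU, hx₀, he, hspan⟩ := V.exists_frame p₀.2
  refine ⟨Prod.snd ⁻¹' U, n, fun i p => e i p.2, hU.preimage continuous_snd, hx₀, fun i p hp => ?_,
    fun p hp => hspan p.2 hp⟩
  have h1 : SmoothAlongAt EM F 𝓘(ℝ, EM) (fun y : M => y) (e i) p.2 :=
    (he i).contMDiffAt (hU.mem_nhds hp)
  exact ContMDiffAt.contMDiffWithinAt (h1.comp (g := (Prod.snd : ℝ × M → M)) (n' := p)
    contMDiffAt_snd)

namespace Reduction

variable (R : Reduction L Cr) {V : GenPseudometric C}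

lemma smoothAlongAt_q {EN HN : Type*} [NormedAddCommGroup EN] [NormedSpace ℝ EN]
    [TopologicalSpace HN] {J : ModelWithCorners ℝ EN HN} {N : Type*} [TopologicalSpace N]
    [ChartedSpace HN N] {Q : ∀ x, E x →ₗ[ℝ] E x} (hQ : ∀ x a, Q x a ∈ K.perp x)
    (hQs : ∀ u : Sec EM F E, ∃ v : Sec EM F E, ∀ x, v x = Q x (u x))
    {f : N → M} {ξ : ∀ n, E (f n)} {n₀ : N} (h : SmoothAlongAt EM F J f ξ n₀) :
    SmoothAlongAt EMr Fr J (fun n => R.pr (f n))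
      (fun n => R.q (f n) ((Q (f n)).codRestrict (K.perp (f n)) (hQ (f n)) (ξ n))) n₀ := by
  choose T hT using hQs
  let B := dualFrame C (f n₀)
  have h1 : ∀ i, SmoothAlongAt EMr Fr J (fun n => R.pr (f n))
      (fun n => R.q (f n) ((Q (f n)).codRestrict (K.perp (f n)) (hQ (f n)) (B.e i (f n)))) n₀ := by
    intro i
    refine (R.q_smooth (fun x => (Q x).codRestrict (K.perp x) (hQ x) (B.e i x)) (f n₀) ?_).comp n₀
      h.base
    exact (SmoothAlongAt.of_section contMDiffAt_id (T (B.e i))).congr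
      (Eventually.of_forall fun x => (hT (B.e i) x).symm)
  refine (SmoothAlongAt.sum (s := Finset.univ) (R.pr_smooth.contMDiffAt.comp n₀ h.base)
    (fun i _ => h.pairing_section C (B.t i)) (fun i _ => h1 i)).congr ?_
  filter_upwards [h.base.continuousAt.eventually B.p_one] with n hn
  conv_lhs => rw [B.sum_of_p_one hn (ξ n)]
  simp only [map_sum, map_smul]

/-- The quotient map on the fibre of an admissible generalized pseudometric. -/
def qPlus (hV : K.IsAdmissible V) {x : M} {y : Mr} (h : R.pr x = y) : V.plus x →ₗ[ℝ] Er y :=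
  R.qTo h ∘ₗ Submodule.inclusion (hV.le_perp x)

lemma pairing_qPlus (hV : K.IsAdmissible V) {x : M} {y : Mr} (h : R.pr x = y) (a b : V.plus x) :
    Cr.pairing y (R.qPlus hV h a) (R.qPlus hV h b) = C.pairing x a b :=
  R.pairing_qTo h _ _

/-- The quotient map preserves pairings, so a vector in its kernel is orthogonal to `V₊`, on which
the pairing is non-degenerate. -/
lemma qPlus_injective (hV : K.IsAdmissible V) {x : M} {y : Mr} (h : R.pr x = y) :
    Function.Injective (R.qPlus hV h) := by
  rw [← LinearMap.ker_eq_bot, LinearMap.ker_eq_bot']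
  intro a ha
  refine Subtype.ext (V.nondegenerate x a a.2 fun b hb => ?_)
  rw [← R.pairing_qPlus hV h a ⟨b, hb⟩, ha, map_zero, LinearMap.zero_apply]

lemma isReducedPseudometric_iff (hV : K.IsAdmissible V) {W : GenPseudometric Cr} :
    R.IsReducedPseudometric V W ↔
      ∀ x, W.plus (R.pr x) = LinearMap.range (R.qPlus hV (rfl : R.pr x = R.pr x)) := by
  refine forall_congr' fun x => ?_
  rw [qPlus, LinearMap.range_comp, Submodule.range_inclusion]
  rfl

/-- The images of a frame of an admissible generalized pseudometric. -/
lemma frame_qPlus (hV : K.IsAdmissible V) {x : M} {y : Mr} (h : R.pr x = y) {n : ℕ}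
    {e : Fin n → E x} (hli : LinearIndependent ℝ e) (hspan : Submodule.span ℝ (range e) = V.plus x)
    {e' : Fin n → Er y} (he' : ∀ i (hi : e i ∈ V.plus x), e' i = R.qPlus hV h ⟨e i, hi⟩) :
    LinearIndependent ℝ e' ∧ Submodule.span ℝ (range e') = LinearMap.range (R.qPlus hV h) := by
  have hmem : ∀ i, e i ∈ V.plus x := fun i => by
    rw [← hspan]; exact Submodule.subset_span ⟨i, rfl⟩
  let f : Fin n → V.plus x := fun i => ⟨e i, hmem i⟩
  have hf : LinearIndependent ℝ f := LinearIndependent.of_comp (V.plus x).subtype hli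
  have hfs : Submodule.span ℝ (range f) = ⊤ := by
    apply Submodule.map_injective_of_injective (V.plus x).injective_subtype
    rw [Submodule.map_span, ← range_comp, Submodule.map_top, Submodule.range_subtype]
    exact hspan
  have he : e' = R.qPlus hV h ∘ f := funext fun i => he' i (hmem i)
  rw [he, range_comp, ← Submodule.map_span, hfs, Submodule.map_top]
  exact ⟨hf.map' _ (LinearMap.ker_eq_bot.2 (R.qPlus_injective hV h)), rfl⟩

variable [ContMDiffSMul 𝓘(ℝ, ES) 𝓘(ℝ, EM) ∞ S M] [FiniteDimensional ℝ ES] [ConnectedSpace S]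

/-- Some group element moves `x` to `x'`; it carries `V₊` to `V₊` and does not change classes in the
quotient. -/
lemma range_qPlus_le (hV : K.IsAdmissible V) {x x' : M} {y : Mr} (h : R.pr x = y)
    (h' : R.pr x' = y) : LinearMap.range (R.qPlus hV h) ≤ LinearMap.range (R.qPlus hV h') := by
  rintro _ ⟨a, rfl⟩
  obtain ⟨g, hg⟩ := R.exists_smul_of_pr_eq (h.trans h'.symm)
  refine ⟨⟨L.actTo g hg a, L.actTo_mem_plus V hV.preserves hg a.2⟩, ?_⟩
  exact R.qTo_actTo hg h h' rfl

lemma range_qPlus_eq (hV : K.IsAdmissible V) {x x' : M} {y : Mr} (h : R.pr x = y)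
    (h' : R.pr x' = y) : LinearMap.range (R.qPlus hV h) = LinearMap.range (R.qPlus hV h') :=
  le_antisymm (R.range_qPlus_le hV h h') (R.range_qPlus_le hV h' h)

/-- The images of a smooth curve of admissible generalized pseudometrics have smooth frames. -/
lemma exists_frame_curve {γ : ℝ → GenPseudometric C} (hγ : GenPseudometric.IsSmoothCurve γ)
    (hV : ∀ t, K.IsAdmissible (γ t)) (p₀ : ℝ × Mr) :
    ∃ (W : Set (ℝ × Mr)) (n : ℕ) (e : Fin n → ∀ p : ℝ × Mr, Er p.2), IsOpen W ∧ p₀ ∈ W ∧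
      (∀ i, ContMDiffOn (𝓘(ℝ, ℝ).prod 𝓘(ℝ, EMr)) (𝓘(ℝ, EMr).prod 𝓘(ℝ, Fr)) ∞
        (fun p : ℝ × Mr => TotalSpace.mk' Fr p.2 (e i p)) W) ∧
      ∀ p ∈ W, LinearIndependent ℝ (fun i => e i p) ∧
        Submodule.span ℝ (range fun i => e i p) =
          LinearMap.range (R.qPlus (hV p.1) (R.pr_lift p.2)) := by
  classical
  obtain ⟨t₀, y₀⟩ := p₀
  obtain ⟨x₀, rfl⟩ := R.surjective y₀
  obtain ⟨p, Q, hp, hQ, hQp, hQs⟩ := K.exists_perpOp x₀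
  obtain ⟨U, σ, hU, hy₀, hσ, hpr, hσ₀⟩ := exists_local_section R.isSubmersion x₀
  obtain ⟨W, n, e, hW, hp₀, he, hspan⟩ := hγ (t₀, x₀)
  let j : ℝ × Mr → ℝ × M := fun q => (q.1, σ q.2)
  have hj : ∀ q : ℝ × Mr, q.2 ∈ U → ContMDiffAt (𝓘(ℝ, ℝ).prod 𝓘(ℝ, EMr))
      (𝓘(ℝ, ℝ).prod 𝓘(ℝ, EM)) ∞ j q := fun q hq =>
    contMDiffAt_fst.prodMk ((hσ.contMDiffAt (hU.mem_nhds hq)).comp q contMDiffAt_snd)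
  have hj₀ : j (t₀, R.pr x₀) = (t₀, x₀) := Prod.ext rfl hσ₀
  have hev : ∀ᶠ q : ℝ × Mr in 𝓝 (t₀, R.pr x₀), q.2 ∈ U ∧ j q ∈ W ∧ p (σ q.2) = 1 := by
    have hc := (hj (t₀, R.pr x₀) hy₀).continuousAt
    refine (continuous_snd.continuousAt.eventually_mem (hU.mem_nhds hy₀)).and ((hc.eventually_mem
      (by rw [hj₀]; exact hW.mem_nhds hp₀)).and ?_)
    have h1 : Tendsto (fun q => (j q).2) (𝓝 (t₀, R.pr x₀)) (𝓝 x₀) := by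
      have := (continuous_snd.continuousAt (x := j (t₀, R.pr x₀))).tendsto.comp hc
      rwa [hj₀] at this
    exact h1.eventually hp
  obtain ⟨W', hW', hW'o, hp₀'⟩ := mem_nhds_iff.1 hev
  -- The frame upstairs is restricted to a local section of the projection and mapped to the
  -- quotient. Its vectors are known to lie in `𝔰_E^⊥` only on `W`, so the operator `Q` is
  -- interposed; it acts on them as the identity where `p = 1`. The case distinction only identifies
  -- the fibre over `pr(σ y)` with that over `y`.
  refine ⟨W', n, fun i q => if h : R.pr (σ q.2) = q.2 then
    R.qTo h ((Q _).codRestrict (K.perp _) (hQ _) (e i (j q))) else 0, hW'o, hp₀', fun i q hq => ?_,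
    fun q hq => ?_⟩
  · have h1 : SmoothAlongAt EM F (𝓘(ℝ, ℝ).prod 𝓘(ℝ, EM)) (fun p : ℝ × M => p.2) (e i) (j q) :=
      (he i).contMDiffAt (hW.mem_nhds (hW' hq).2.1)
    have h2 := R.smoothAlongAt_q hQ hQs (h1.comp (hj q (hW' hq).1))
    refine ContMDiffAt.contMDiffWithinAt (ContMDiffAt.congr_of_eventuallyEq h2 ?_)
    filter_upwards [hW'o.mem_nhds hq] with r hr
    rw [dif_pos (hpr _ (hW' hr).1), R.mk_qTo]
  · obtain ⟨hqU, hqW, hq1⟩ := hW' hq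
    rw [R.range_qPlus_eq (hV q.1) (R.pr_lift q.2) (hpr _ hqU)]
    refine R.frame_qPlus (hV q.1) (hpr _ hqU) (hspan (j q) hqW).1 (hspan (j q) hqW).2 fun i hi => ?_
    refine (dif_pos (hpr _ hqU)).trans ?_
    refine congrArg (R.qTo (hpr _ hqU)) (Subtype.ext ?_)
    exact (hQp _ _ ((hV q.1).le_perp _ hi)).trans (by rw [hq1, one_smul]; rfl)

/-- The reduction of an admissible generalized pseudometric. -/
def reduce (hV : K.IsAdmissible V) : GenPseudometric Cr where
  plus y := LinearMap.range (R.qPlus hV (R.pr_lift y))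
  exists_frame y₀ := by
    obtain ⟨W, n, e, hW, hp₀, he, hspan⟩ :=
      R.exists_frame_curve V.isSmoothCurve_const (fun _ => hV) (0, y₀)
    have hc : ContMDiff 𝓘(ℝ, EMr) (𝓘(ℝ, ℝ).prod 𝓘(ℝ, EMr)) ∞ (fun y : Mr => ((0 : ℝ), y)) :=
      contMDiff_const.prodMk contMDiff_id
    refine ⟨(fun y => ((0 : ℝ), y)) ⁻¹' W, n, fun i y => e i (0, y),
      hW.preimage hc.continuous, hp₀, fun i y hy => ?_, fun y hy => hspan (0, y) hy⟩
    have h1 : SmoothAlongAt EMr Fr (𝓘(ℝ, ℝ).prod 𝓘(ℝ, EMr)) (fun p : ℝ × Mr => p.2) (e i) (0, y) :=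
      (he i).contMDiffAt (hW.mem_nhds hy)
    exact ContMDiffAt.contMDiffWithinAt (h1.comp (g := fun y : Mr => ((0 : ℝ), y)) (hc y))
  nondegenerate y := by
    rintro _ ⟨a, rfl⟩ h
    have ha : (a : E (R.lift y)) = 0 := V.nondegenerate _ a.1 a.2 fun b hb => by
      rw [← R.pairing_qPlus hV (R.pr_lift y) a ⟨b, hb⟩]
      exact h _ ⟨_, rfl⟩
    rw [show a = 0 from Subtype.ext ha, map_zero]

lemma isReducedPseudometric_reduce_iff (hV : K.IsAdmissible V) (W : GenPseudometric Cr) :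
    R.IsReducedPseudometric V W ↔ W = R.reduce hV := by
  rw [R.isReducedPseudometric_iff hV]
  constructor
  · refine fun h => GenPseudometric.ext_plus fun y => ?_
    obtain ⟨x, rfl⟩ := R.surjective y
    rw [h x]
    exact R.range_qPlus_eq hV _ _
  · rintro rfl x
    exact R.range_qPlus_eq hV _ _

lemma isSmoothCurve_reduce {γ : ℝ → GenPseudometric C} (hγ : GenPseudometric.IsSmoothCurve γ)
    (hV : ∀ t, K.IsAdmissible (γ t)) :
    GenPseudometric.IsSmoothCurve (fun t => R.reduce (hV t)) :=
  R.exists_frame_curve hγ hV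

section Values

variable [FiniteDimensional ℝ EMr] [T2Space Mr] [FiniteDimensional ℝ Fr]
  [ContMDiffVectorBundle ∞ Fr Er 𝓘(ℝ, EMr)]

lemma reduce_plus (hV : K.IsAdmissible V) (x : M) :
    (R.reduce hV).plus (R.pr x) = LinearMap.range (R.qPlus hV (rfl : R.pr x = R.pr x)) :=
  R.range_qPlus_eq hV _ _

lemma q_mem_reduce_plus (hV : K.IsAdmissible V) {x : M} (a : K.perp x) (ha : (a : E x) ∈ V.plus x) :
    R.q x a ∈ (R.reduce hV).plus (R.pr x) := by
  rw [R.reduce_plus]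
  exact ⟨⟨a, ha⟩, rfl⟩

lemma q_mem_reduce_minus (hV : K.IsAdmissible V) {x : M} (b : K.perp x)
    (hb : (b : E x) ∈ V.minus x) : R.q x b ∈ (R.reduce hV).minus (R.pr x) := by
  rw [GenPseudometric.mem_minus, R.reduce_plus]
  rintro _ ⟨a, rfl⟩
  exact (R.pairing x _ b).trans (V.mem_minus.1 hb _ a.2)

lemma proj_q (hV : K.IsAdmissible V) {x : M} (a : K.perp x) :
    (R.reduce hV).proj (R.pr x) (R.q x a) =
      R.q x ⟨V.proj x a, hV.le_perp x (V.proj_mem x a)⟩ := by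
  refine GenPseudometric.proj_eq _ (R.q_mem_reduce_plus hV _ (V.proj_mem x a)) ?_
  rw [← map_sub]
  exact R.q_mem_reduce_minus hV _ (V.sub_proj_mem x a)

variable {R} in
lemma Represents.projPlus (hV : K.IsAdmissible V) {u : Sec EM F E} {ur : Sec EMr Fr Er}
    (hu : R.Represents u ur) : R.Represents (V.projPlus u) ((R.reduce hV).projPlus ur) := by
  refine ⟨fun s => ?_, fun x => hV.le_perp x (V.proj_mem x _), fun x => ?_⟩
  · rw [← (hV.preserves s).projPlus, hu.1, map_zero]
  · refine (R.proj_q hV ⟨u x, hu.mem_perp x⟩).symm.trans ?_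
    rw [hu.q_eq]
    rfl

variable {R} in
lemma Represents.projMinus (hV : K.IsAdmissible V) {u : Sec EM F E} {ur : Sec EMr Fr Er}
    (hu : R.Represents u ur) : R.Represents (V.projMinus u) ((R.reduce hV).projMinus ur) :=
  hu.sub (hu.projPlus hV)

variable [ProperSMul S M]

/-- The generalized Ricci tensor of the reduction. -/
lemma GRic_reduce (hfree : ∀ (g : S) (x : M), g • x = x → g = 1) (hV : K.IsAdmissible V)
    {div : Divergence C} {d : Divergence Cr} (hd : R.IsReducedDivergence div d)
    (a : V.sectionsPlus) (b : V.sectionsMinus)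
    (ar : (R.reduce hV).sectionsPlus) (br : (R.reduce hV).sectionsMinus)
    (ha : R.Represents a.1 ar.1) (hb : R.Represents b.1 br.1) (x : M) :
    (R.reduce hV).GRic d ar br (R.pr x) = V.GRic div a b x := by
  have h1 := hd _ _ ((hb.bracket ha).projPlus hV) x
  have h2 : dirDeriv (d.toFun ar.1) (R.pr x) (Cr.anchor (R.pr x) (br.1 (R.pr x))) =
      dirDeriv (div.toFun a.1) x (C.anchor x (b.1 x)) := by
    have h3 : R.prFn (d.toFun ar.1) = div.toFun a.1 := by
      ext z; exact hd _ _ ha z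
    rw [← h3]
    exact (hb.lieS (d.toFun ar.1) x).symm
  have hmem : ∀ v, R.qPlus hV (rfl : R.pr x = R.pr x) v ∈ (R.reduce hV).plus (R.pr x) := by
    intro v
    rw [R.reduce_plus]
    exact ⟨v, rfl⟩
  -- The quotient map identifies `V₊` with its reduction. It intertwines the two Ricci endomorphisms
  -- because every bracket and projection in them is taken of represented sections, so their traces
  -- agree.
  let Θ : V.plus x ≃ₗ[ℝ] (R.reduce hV).plus (R.pr x) := LinearEquiv.ofBijective
    ((R.qPlus hV (rfl : R.pr x = R.pr x)).codRestrict _ hmem) ⟨fun v w h =>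
      R.qPlus_injective hV rfl (congrArg Subtype.val h), fun w => by
        obtain ⟨v, hv⟩ : (w : Er (R.pr x)) ∈ LinearMap.range (R.qPlus hV (rfl : R.pr x = R.pr x)) := by
          rw [← R.reduce_plus]; exact w.2
        exact ⟨v, Subtype.ext hv⟩⟩
  have h4 : (R.reduce hV).ricciEnd ar br (R.pr x) = Θ.conj (V.ricciEnd a b x) := by
    refine LinearMap.ext fun w => ?_
    obtain ⟨v, rfl⟩ := Θ.surjective w
    rw [LinearEquiv.conj_apply_apply, LinearEquiv.symm_apply_apply]
    obtain ⟨u, ur, hu, hur⟩ := R.exists_represents hfree x (Θ v : Er (R.pr x))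
    have hu' := hu.projPlus hV
    have hv1 : (R.reduce hV).projPlus ur (R.pr x) = Θ v := by
      rw [GenPseudometric.projPlus_apply, hur]
      exact GenPseudometric.proj_of_mem _ (Θ v).2
    have hv2 : V.projPlus u x = v := by
      have h5 : R.qPlus hV rfl ⟨V.projPlus u x, V.proj_mem x _⟩ = R.qPlus hV rfl v :=
        (hu'.q_eq (hu'.mem_perp x)).trans hv1
      exact congrArg Subtype.val (R.qPlus_injective hV rfl h5)
    have h6 := (R.reduce hV).ricciEnd_apply ar br (R.pr x) ⟨_, (R.reduce hV).projPlus_mem ur⟩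
    have h7 := V.ricciEnd_apply a b x ⟨_, V.projPlus_mem u⟩
    have hv1' : (⟨_, (R.reduce hV).projPlus_mem ur (R.pr x)⟩ : (R.reduce hV).plus (R.pr x)) = Θ v :=
      Subtype.ext hv1
    have hv2' : (⟨_, V.projPlus_mem u x⟩ : V.plus x) = v := Subtype.ext hv2
    rw [hv1'] at h6
    rw [hv2'] at h7
    have h8 := (((hu'.bracket hb).projMinus hV).bracket ha).projPlus hV
    refine Subtype.ext (h6.trans ((h8.q_eq (h8.mem_perp x)).symm.trans ?_))
    exact congrArg (R.q x) (Subtype.ext h7.symm)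
  unfold GenPseudometric.GRic
  rw [h1, h2, h4, LinearMap.trace_conj']

/-- The reduction of curves maps the generalized Ricci tensor to the generalized Ricci tensor. -/
lemma hasVelocityAt_reduce (hfree : ∀ (g : S) (x : M), g • x = x → g = 1)
    {γ : ℝ → GenPseudometric C} (hV : ∀ t, K.IsAdmissible (γ t))
    {div : Divergence C} {d : Divergence Cr} (hd : R.IsReducedDivergence div d) {t : ℝ}
    (h : GenPseudometric.HasVelocityAt γ t ((γ t).GRic div)) :
    GenPseudometric.HasVelocityAt (fun s => R.reduce (hV s)) t ((R.reduce (hV t)).GRic d) := by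
  intro α β y
  obtain ⟨x, rfl⟩ := R.surjective y
  -- Arbitrary sections downstairs need not be known to be represented. Tensoriality allows them to
  -- be replaced by represented ones with the same value at the point.
  obtain ⟨u, ur, hu, hur⟩ := R.exists_represents hfree x (α.1 (R.pr x))
  obtain ⟨v, vr, hv, hvr⟩ := R.exists_represents hfree x (β.1 (R.pr x))
  let a : (γ t).sectionsPlus := ⟨_, (γ t).projPlus_mem u⟩
  let b : (γ t).sectionsMinus := ⟨_, (γ t).projMinus_mem v⟩
  let ar : (R.reduce (hV t)).sectionsPlus := ⟨_, (R.reduce (hV t)).projPlus_mem ur⟩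
  let br : (R.reduce (hV t)).sectionsMinus := ⟨_, (R.reduce (hV t)).projMinus_mem vr⟩
  have ha : R.Represents a.1 ar.1 := hu.projPlus (hV t)
  have hb : R.Represents b.1 br.1 := hv.projMinus (hV t)
  have hα : α.1 (R.pr x) = ar.1 (R.pr x) := by
    change _ = (R.reduce (hV t)).projPlus ur (R.pr x)
    rw [GenPseudometric.projPlus_apply, hur, GenPseudometric.proj_of_mem _ (α.2 _)]
  have hβ : β.1 (R.pr x) = br.1 (R.pr x) := by
    change _ = (R.reduce (hV t)).projMinus vr (R.pr x)
    rw [GenPseudometric.projMinus_apply, hvr, GenPseudometric.proj_of_mem_minus _ (β.2 _), sub_zero]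
  rw [GenPseudometric.GRic_congr _ d hα hβ, R.GRic_reduce hfree (hV t) hd a b ar br ha hb, hα, hβ]
  refine (h a b x).congr_of_eventuallyEq (Eventually.of_forall fun s => ?_)
  change Cr.pairing _ ((R.reduce (hV s)).proj _ _) _ = _
  rw [← ha.q_eq (ha.mem_perp x), ← hb.q_eq (hb.mem_perp x), R.proj_q (hV s), R.pairing]

end Values

end Reduction

end RedMetric

/-! ### Pullback of curves and of their velocities -/

section PullbackCurves

variable {EM : Type*} [NormedAddCommGroup EM] [NormedSpace ℝ EM] [FiniteDimensional ℝ EM]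
  {M : Type*} [TopologicalSpace M] [ChartedSpace EM M] [IsManifold 𝓘(ℝ, EM) ∞ M] [T2Space M]
  {F : Type*} [NormedAddCommGroup F] [NormedSpace ℝ F] [FiniteDimensional ℝ F]
  {E : M → Type*} [∀ x, AddCommGroup (E x)] [∀ x, Module ℝ (E x)]
  [∀ x, TopologicalSpace (E x)] [TopologicalSpace (TotalSpace F E)]
  [FiberBundle F E] [VectorBundle ℝ F E] [ContMDiffVectorBundle ∞ F E 𝓘(ℝ, EM)]
  {EM' : Type*} [NormedAddCommGroup EM'] [NormedSpace ℝ EM'] [FiniteDimensional ℝ EM']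
  {M' : Type*} [TopologicalSpace M'] [ChartedSpace EM' M'] [IsManifold 𝓘(ℝ, EM') ∞ M']
  [T2Space M']
  {τ : C^∞⟮𝓘(ℝ, EM'), M'; 𝓘(ℝ, EM), M⟯}
  {C : CourantAlgebroid EM F E} {C' : CourantAlgebroid EM' F (τ *ᵖ E)}

/-- A section of `E` that is smooth along `τ ∘ f` is smooth along `f` as a section of `τ^*E`. -/
lemma SmoothAlongAt.pullback (C : CourantAlgebroid EM F E) {EN HN : Type*} [NormedAddCommGroup EN]
    [NormedSpace ℝ EN] [TopologicalSpace HN] {J : ModelWithCorners ℝ EN HN} {N : Type*}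
    [TopologicalSpace N] [ChartedSpace HN N] {f : N → M'} {n₀ : N} {ξ : ∀ n, E (τ (f n))}
    (h : SmoothAlongAt EM F J (fun n => τ (f n)) ξ n₀) (hf : ContMDiffAt J 𝓘(ℝ, EM') ∞ f n₀) :
    SmoothAlongAt (E := τ *ᵖ E) EM' F J f ξ n₀ := by
  let B := dualFrame C (τ (f n₀))
  refine (SmoothAlongAt.sum (E := τ *ᵖ E) (s := Finset.univ) hf
    (fun i _ => h.pairing_section C (B.t i))
    (fun i _ => SmoothAlongAt.of_section hf (pullbackSection τ (B.e i)))).congr ?_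
  filter_upwards [h.base.continuousAt.eventually B.p_one] with n hn
  exact B.sum_of_p_one hn (ξ n)

namespace IsCAPullback

variable (h : IsCAPullback τ C C')

include h

lemma isSmoothCurve_pullback {γ : ℝ → GenPseudometric C}
    (hγ : GenPseudometric.IsSmoothCurve γ) :
    GenPseudometric.IsSmoothCurve (fun t => (γ t).pullback h) := by
  intro p₀
  obtain ⟨W, n, e, hW, hp₀, he, hspan⟩ := hγ (p₀.1, τ p₀.2)
  let j : ℝ × M' → ℝ × M := fun q => (q.1, τ q.2)
  have hj : ContMDiff (𝓘(ℝ, ℝ).prod 𝓘(ℝ, EM')) (𝓘(ℝ, ℝ).prod 𝓘(ℝ, EM)) ∞ j :=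
    contMDiff_fst.prodMk (τ.contMDiff.comp contMDiff_snd)
  refine ⟨j ⁻¹' W, n, fun i q => e i (j q), hW.preimage hj.continuous, hp₀, fun i q hq => ?_,
    fun q hq => hspan (j q) hq⟩
  have h1 : SmoothAlongAt EM F (𝓘(ℝ, ℝ).prod 𝓘(ℝ, EM)) (fun p : ℝ × M => p.2) (e i) (j q) :=
    (he i).contMDiffAt (hW.mem_nhds hq)
  exact ContMDiffAt.contMDiffWithinAt
    (SmoothAlongAt.pullback C (f := fun q : ℝ × M' => q.2) (h1.comp (hj q)) contMDiffAt_snd)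

/-- The pullback of curves maps the generalized Ricci tensor to the generalized Ricci tensor. -/
lemma hasVelocityAt_pullback {γ : ℝ → GenPseudometric C} {d : Divergence C} {d' : Divergence C'}
    (hd' : IsPullbackDivergence d d') {t : ℝ}
    (hγ : GenPseudometric.HasVelocityAt γ t ((γ t).GRic d)) :
    GenPseudometric.HasVelocityAt (fun t => (γ t).pullback h) t
      (((γ t).pullback h).GRic d') := by
  intro α β x
  -- By tensoriality, sections of the pullback may be replaced at `x` by pullbacks of sections of
  -- `E`, on which the two Ricci tensors agree.
  obtain ⟨u, hu⟩ := exists_section (EM := EM) (F := F) (E := E) (τ x) (α.1 x)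
  obtain ⟨v, hv⟩ := exists_section (EM := EM) (F := F) (E := E) (τ x) (β.1 x)
  let V := γ t
  let a : V.sectionsPlus := ⟨_, V.projPlus_mem u⟩
  let b : V.sectionsMinus := ⟨_, V.projMinus_mem v⟩
  let a' : (V.pullback h).sectionsPlus := ⟨pullbackSection τ a.1, fun x => a.2 (τ x)⟩
  let b' : (V.pullback h).sectionsMinus := ⟨pullbackSection τ b.1, by
    rw [← h.projMinus_pullback]
    exact GenPseudometric.projMinus_mem _ _⟩
  have hα : α.1 x = a'.1 x := by
    refine Eq.trans ?_ (V.projPlus_apply u (τ x)).symm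
    rw [hu]
    exact (V.proj_of_mem (α.2 x)).symm
  have hβ : β.1 x = b'.1 x := by
    have h1 : V.proj (τ x) (β.1 x) = 0 :=
      (h.proj_pullback V x _).symm.trans (GenPseudometric.proj_of_mem_minus _ (β.2 x))
    refine Eq.trans ?_ (V.projMinus_apply v (τ x)).symm
    rw [hv, h1]
    exact (sub_zero (β.1 x : E (τ x))).symm
  rw [GenPseudometric.GRic_congr _ d' hα hβ, ← GenPseudometric.gricS_apply,
    h.gricS_pullback V hd' a b a' b' rfl rfl, GenPseudometric.gricS_apply, hα, hβ]
  refine (hγ a b (τ x)).congr_of_eventuallyEq (Eventually.of_forall fun s => ?_)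
  refine (h.pairing x _ _).trans ?_
  exact congrArg (fun w => C.pairing (τ x) w (b.1 (τ x))) (h.proj_pullback (γ s) x _)

end IsCAPullback

end PullbackCurves

end Courant

end

/-! ### The theorem: reduction composed with pullback -/

theorem mainTheorem6
    -- the vector bundle `E → M`
    {EM : Type*} [NormedAddCommGroup EM] [NormedSpace ℝ EM] [FiniteDimensional ℝ EM]
    {M : Type*} [TopologicalSpace M] [ChartedSpace EM M] [IsManifold 𝓘(ℝ, EM) ∞ M]
    [T2Space M] [SecondCountableTopology M]
    {F : Type*} [NormedAddCommGroup F] [NormedSpace ℝ F] [FiniteDimensional ℝ F]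
    {E : M → Type*} [∀ x, AddCommGroup (E x)] [∀ x, Module ℝ (E x)]
    [∀ x, TopologicalSpace (E x)] [TopologicalSpace (TotalSpace F E)]
    [FiberBundle F E] [VectorBundle ℝ F E] [ContMDiffVectorBundle ∞ F E 𝓘(ℝ, EM)]
    -- the connected Lie group `S`
    {ES : Type*} [NormedAddCommGroup ES] [NormedSpace ℝ ES] [FiniteDimensional ℝ ES]
    [CompleteSpace ES]
    {S : Type*} [TopologicalSpace S] [ChartedSpace ES S] [Group S] [LieGroup 𝓘(ℝ, ES) ∞ S]
    [ConnectedSpace S]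
    -- the `𝔰`-equivariant Courant algebroid structure on `E`, and an equivariant divergence
    (C : Courant.CourantAlgebroid EM F E)
    (K : Courant.EquivariantStructure C (GroupLieAlgebra 𝓘(ℝ, ES) S))
    (div : Courant.Divergence C) (hdiv : K.IsEquivariantDivergence div)
    -- the CA-pullback `E' = τ^*E → M'`
    {EM' : Type*} [NormedAddCommGroup EM'] [NormedSpace ℝ EM'] [FiniteDimensional ℝ EM']
    {M' : Type*} [TopologicalSpace M'] [ChartedSpace EM' M'] [IsManifold 𝓘(ℝ, EM') ∞ M']
    [T2Space M'] [SecondCountableTopology M']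
    (τ : C^∞⟮𝓘(ℝ, EM'), M'; 𝓘(ℝ, EM), M⟯)
    (C' : Courant.CourantAlgebroid EM' F (τ *ᵖ E)) (hC' : Courant.IsCAPullback τ C C')
    -- the action of `𝔰` on `E' → M'` integrates to an action of `S`, free and proper on `M'`
    [MulAction S M'] [ContMDiffSMul 𝓘(ℝ, ES) 𝓘(ℝ, EM') ∞ S M'] [ProperSMul S M']
    (hfree : ∀ (g : S) (x : M'), g • x = x → g = 1)
    (L : Courant.Integration (K.pullback hC'))
    -- the reduced Courant algebroid `E'_red = E'_{/S} → M'/S`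
    {EMr : Type*} [NormedAddCommGroup EMr] [NormedSpace ℝ EMr] [FiniteDimensional ℝ EMr]
    {Mr : Type*} [TopologicalSpace Mr] [ChartedSpace EMr Mr] [IsManifold 𝓘(ℝ, EMr) ∞ Mr]
    [T2Space Mr] [SecondCountableTopology Mr]
    {Fr : Type*} [NormedAddCommGroup Fr] [NormedSpace ℝ Fr] [FiniteDimensional ℝ Fr]
    {Er : Mr → Type*} [∀ y, AddCommGroup (Er y)] [∀ y, Module ℝ (Er y)]
    [∀ y, TopologicalSpace (Er y)] [TopologicalSpace (TotalSpace Fr Er)]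
    [FiberBundle Fr Er] [VectorBundle ℝ Fr Er] [ContMDiffVectorBundle ∞ Fr Er 𝓘(ℝ, EMr)]
    (Cr : Courant.CourantAlgebroid EMr Fr Er) (R : Courant.Reduction L Cr) :
    -- the divergences `div' = τ^*div` on `E'` and `div'_red` on `E'_red` are well defined
    ∃ (div' : Courant.Divergence C') (divr : Courant.Divergence Cr),
      (∀ d, Courant.IsPullbackDivergence div d ↔ d = div') ∧
      (∀ d, R.IsReducedDivergence div' d ↔ d = divr) ∧
    -- the map `φ`, from admissible generalized pseudometrics on `E` to generalized pseudometrics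
    -- on `E'_red`, is well defined by pullback and reduction
    ∃ φ : {V : Courant.GenPseudometric C // K.IsAdmissible V} → Courant.GenPseudometric Cr,
      (∀ V Vr, R.IsReducedPseudometric (V.1.pullback hC') Vr ↔ Vr = φ V) ∧
      -- `GRic^E_div` is a vector field on the space of admissible generalized pseudometrics
      (∀ V, ∃ γ : ℝ → {V : Courant.GenPseudometric C // K.IsAdmissible V},
        γ 0 = V ∧ Courant.GenPseudometric.IsSmoothCurve (fun t => (γ t).1) ∧
        Courant.GenPseudometric.HasVelocityAt (fun t => (γ t).1) 0 ((γ 0).1.GRic div)) ∧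
      -- `φ` maps smooth curves to smooth curves, and a velocity `GRic^E_div` to a velocity
      -- `GRic^{E'_red}_{div'_red}`
      ∀ γ : ℝ → {V : Courant.GenPseudometric C // K.IsAdmissible V},
        Courant.GenPseudometric.IsSmoothCurve (fun t => (γ t).1) →
        Courant.GenPseudometric.IsSmoothCurve (fun t => φ (γ t)) ∧
        ∀ t, Courant.GenPseudometric.HasVelocityAt (fun s => (γ s).1) t ((γ t).1.GRic div) →
          Courant.GenPseudometric.HasVelocityAt (fun s => φ (γ s)) t ((φ (γ t)).GRic divr) := by
  obtain ⟨div', hdiv'⟩ := hC'.exists_pullback_divergence div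
  have hp : Courant.IsPullbackDivergence div div' := (hdiv' div').2 rfl
  obtain ⟨divr, hdivr⟩ := R.exists_reduced_divergence hfree (hC'.equivariantDivergence hdiv hp)
  have hr : R.IsReducedDivergence div' divr := (hdivr divr).2 rfl
  refine ⟨div', divr, hdiv', hdivr, fun V => R.reduce (hC'.admissible V.2),
    fun V Vr => R.isReducedPseudometric_reduce_iff (hC'.admissible V.2) Vr,
    fun V => Courant.exists_curve_gric div hdiv V, fun γ hγ => ⟨?_, fun t ht => ?_⟩⟩
  · exact R.isSmoothCurve_reduce (hC'.isSmoothCurve_pullback hγ)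
      fun t => hC'.admissible (γ t).2
  · exact R.hasVelocityAt_reduce hfree (fun t => hC'.admissible (γ t).2) hr
      (hC'.hasVelocityAt_pullback hp ht)
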